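/- Let $n\ge 0$ and $h>0$, and let $q:\mathbb{R}^n_x\times\mathbb{R}^n_\xi\to\mathbb{C}$ be a complex-valued quadratic form. Let $$F=\frac12\begin{pmatrix}\partial_\xi\partial_x q&\partial_\xi^2 q\\-\partial_x^2 q&-\partial_x\partial_\xi q\end{pmatrix}$$ be its Hamilton map, acting on $\mathbb{C}^{2n}$. Suppose that $\operatorname{Re} q(x,\xi)\ge 0$ for all $(x,\xi)\in\mathbb{R}^{2n}$ and that the singular space of $q$ is trivial: $$S:=\bigcap_{k=0}^\infty\ker\big((\operatorname{Re}F)(\operatorname{Im}F)^k\big)=\{0\}.$$ Let $\Lambda^{\pm}=\bigoplus_{\pm\operatorname{Im}\lambda>0}V_\lambda\subseteq\mathbb{C}^{2n}$, where $V_\lambda$ is the generalized eigenspace of $F$ for the eigenvalue $\lambda$, and let $\mu_0=\frac hi\sum_j\lambda_j$, where the $\lambda_j$ are the eigenvalues of $F$ with $\operatorname{Im}\lambda_j>0$, repeated according to algebraic multiplicity. Write $q(x,\xi)=\sum_{|\alpha+\beta|=2}q_{\alpha\beta}x^\alpha\xi^\beta$ and, with $D_x=-i\partial_x$, let $$q^w(x,hD_x)=\sum_{|\alpha+\beta|=2}q_{\alpha\beta}\,\frac{x^\alpha(hD_x)^\beta+(hD_x)^\beta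 x^\alpha}{2}$$ be the semiclassical Weyl quantization, regarded as an unbounded operator on $L^2(\mathbb{R}^n)$ with its maximal domain $\{u\in L^2(\mathbb{R}^n): q^w(x,hD_x)u\in L^2(\mathbb{R}^n)\}$, where $q^w(x,hD_x)u$ is taken in the sense of tempered distributions. Let $q^w(x,hD_x)^*$ be its adjoint. Then $\mu_0$ is an isolated point of $\operatorname{Spec}q^w(x,hD_x)$. Moreover, let $r>0$ be such that the closed disc $\{|\zeta-\mu_0|\le r\}$ contains no point of the spectrum other than $\mu_0$, and let $$\Pi_{\mu_0}=\frac1{2\pi i}\oint_{|\zeta-\mu_0|=r}(\zeta-q^w(x,hD_x))^{-1}\,d\zeta$$ be the spectral (Riesz) projection for $q^w(x,hD_x)$ and $\{\mu_0\}$. Then the following are equivalent: (i) the ground states of the operator and of its adjoint match: $\ker(q^w(x,hD_x)-\mu_0)=\ker(q^w(x,hD_x)^*-\overline{\mu_0})$; (ii) $\Lambda^+=\overline{\Lambda^-}$; (iii) $\Pi_{\mu_0}$ is an orthogonal projection on $L^2(\mathbb{R}^n)$. -/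

import Mathlib

open scoped SchwartzMap

noncomputable section

namespace QuadraticWeyl

/-- Phase space `ℝⁿ_x × ℝⁿ_ξ`. -/
abbrev PhaseSpace (n : ℕ) : Type := (Fin n → ℝ) × (Fin n → ℝ)

/-- Complex-valued quadratic forms on phase space. -/
abbrev Form (n : ℕ) : Type := QuadraticMap ℝ (PhaseSpace n) ℂ

/-- Configuration space `ℝⁿ`. -/
abbrev Conf (n : ℕ) : Type := EuclideanSpace ℝ (Fin n)

/-- The Hilbert space `L²(ℝⁿ)`. -/
abbrev L2 (n : ℕ) : Type := MeasureTheory.Lp ℂ 2 (MeasureTheory.volume : MeasureTheory.Measure (Conf n))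

/-! ### Second derivatives of a quadratic form

The Hessian of a quadratic form `q` is its polar form `q (X + Y) - q X - q Y`. -/

/-- The `j`-th basis vector in the position directions. -/
def ePos {n : ℕ} (j : Fin n) : PhaseSpace n := (Pi.single j 1, 0)

/-- The `j`-th basis vector in the momentum directions. -/
def eMom {n : ℕ} (j : Fin n) : PhaseSpace n := (0, Pi.single j 1)

/-- `∂²q/∂x_j∂x_k` -/
def dxx {n : ℕ} (q : Form n) : Matrix (Fin n) (Fin n) ℂ :=
  Matrix.of fun j k => QuadraticMap.polar q (ePos j) (ePos k)

/-- `∂²q/∂x_j∂ξ_k` -/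
def dxXi {n : ℕ} (q : Form n) : Matrix (Fin n) (Fin n) ℂ :=
  Matrix.of fun j k => QuadraticMap.polar q (ePos j) (eMom k)

/-- `∂²q/∂ξ_j∂x_k` -/
def dXix {n : ℕ} (q : Form n) : Matrix (Fin n) (Fin n) ℂ :=
  Matrix.of fun j k => QuadraticMap.polar q (eMom j) (ePos k)

/-- `∂²q/∂ξ_j∂ξ_k` -/
def dXiXi {n : ℕ} (q : Form n) : Matrix (Fin n) (Fin n) ℂ :=
  Matrix.of fun j k => QuadraticMap.polar q (eMom j) (eMom k)

/-! ### The Hamilton map and its invariant subspaces -/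

/-- The Hamilton map (fundamental matrix) `F(q)`, acting on `ℂ²ⁿ`. -/
def hamiltonMatrix {n : ℕ} (q : Form n) : Matrix (Fin n ⊕ Fin n) (Fin n ⊕ Fin n) ℂ :=
  (1 / 2 : ℂ) • Matrix.fromBlocks (dXix q) (dXiXi q) (-dxx q) (-dxXi q)

/-- The singular space `⋂ₖ ker (Re F (Im F)ᵏ)`. -/
def singularSpace {n : ℕ} (q : Form n) : Submodule ℝ (Fin n ⊕ Fin n → ℝ) :=
  ⨅ k : ℕ, LinearMap.ker (Matrix.toLin'
    ((hamiltonMatrix q).map Complex.re * (hamiltonMatrix q).map Complex.im ^ k))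

/-- `Λ⁺`: the sum of the generalized eigenspaces of `F` for the eigenvalues with `Im λ > 0`. -/
def lambdaPlus {n : ℕ} (q : Form n) : Submodule ℂ (Fin n ⊕ Fin n → ℂ) :=
  ⨆ (l : ℂ) (_ : 0 < l.im), Module.End.maxGenEigenspace (Matrix.toLin' (hamiltonMatrix q)) l

/-- `Λ⁻`: the sum of the generalized eigenspaces of `F` for the eigenvalues with `Im λ < 0`. -/
def lambdaMinus {n : ℕ} (q : Form n) : Submodule ℂ (Fin n ⊕ Fin n → ℂ) :=
  ⨆ (l : ℂ) (_ : l.im < 0), Module.End.maxGenEigenspace (Matrix.toLin' (hamiltonMatrix q)) l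

/-- `μ₀ = (h/i) ∑ⱼ λⱼ`, where the `λⱼ` are the eigenvalues of `F` in the open upper half plane,
repeated according to their algebraic multiplicity. -/
def mu0 {n : ℕ} (q : Form n) (h : ℝ) : ℂ :=
  (h / Complex.I) * ((hamiltonMatrix q).charpoly.roots.filter fun l => 0 < l.im).sum

/-! ### The Weyl quantization -/

/-- Multiplication by the coordinate `x_j` on tempered distributions. -/
def mulX {n : ℕ} (j : Fin n) : 𝓢'(Conf n, ℂ) →L[ℂ] 𝓢'(Conf n, ℂ) :=
  TemperedDistribution.smulLeftCLM ℂ fun x : Conf n => (x j : ℂ)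

/-- `h D_{x_j} = (h/i) ∂_{x_j}` on tempered distributions. -/
def hD {n : ℕ} (h : ℝ) (j : Fin n) : 𝓢'(Conf n, ℂ) →L[ℂ] 𝓢'(Conf n, ℂ) :=
  ((h : ℂ) / Complex.I) •
    LineDeriv.lineDerivOpCLM ℂ 𝓢'(Conf n, ℂ) (EuclideanSpace.single j (1 : ℝ))

/-- The semiclassical Weyl quantization of `q` as an operator on tempered distributions: since
`q = ∑ⱼₖ (½ q_{xⱼxₖ} xⱼxₖ + q_{xⱼξₖ} xⱼξₖ + ½ q_{ξⱼξₖ} ξⱼξₖ)`, one replaces `xⱼ`, `ξⱼ` by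
`xⱼ`, `hDⱼ` and `xⱼξₖ` by `(xⱼ hDₖ + hDₖ xⱼ)/2`. -/
def weylDistribution {n : ℕ} (q : Form n) (h : ℝ) : 𝓢'(Conf n, ℂ) →L[ℂ] 𝓢'(Conf n, ℂ) :=
  ∑ j, ∑ k,
    ((dxx q j k / 2) • (mulX j ∘L mulX k)
      + (dxXi q j k / 2) • (mulX j ∘L hD h k + hD h k ∘L mulX j)
      + (dXiXi q j k / 2) • (hD h j ∘L hD h k))

/-- The inclusion of `L²` into the tempered distributions. -/
abbrev incl (n : ℕ) : L2 n →L[ℂ] 𝓢'(Conf n, ℂ) :=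
  MeasureTheory.Lp.toTemperedDistributionCLM ℂ MeasureTheory.volume 2

/-- The pairs `(u, v)` of functions in `L²` with `q^w(x, hD_x) u = v` in the sense of
distributions. -/
def weylGraph {n : ℕ} (q : Form n) (h : ℝ) : Submodule ℂ (L2 n × L2 n) :=
  ((weylDistribution q h ∘L incl n ∘L ContinuousLinearMap.fst ℂ (L2 n) (L2 n)
    - incl n ∘L ContinuousLinearMap.snd ℂ (L2 n) (L2 n) :
      L2 n × L2 n →L[ℂ] 𝓢'(Conf n, ℂ)) : L2 n × L2 n →ₗ[ℂ] 𝓢'(Conf n, ℂ)).ker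

/-- `q^w(x, hD_x)` as an unbounded operator on `L²(ℝⁿ)`, with its maximal domain
`{u ∈ L² : q^w(x, hD_x) u ∈ L²}`. -/
def weyl {n : ℕ} (q : Form n) (h : ℝ) : L2 n →ₗ.[ℂ] L2 n :=
  (weylGraph q h).toLinearPMap

theorem mem_weylGraph_iff {n : ℕ} (q : Form n) (h : ℝ) (u v : L2 n) :
    (u, v) ∈ weylGraph q h ↔ weylDistribution q h (incl n u) = incl n v := by
  simp [weylGraph, sub_eq_zero]

/-- The graph of `weyl q h` is the intended one. -/
theorem mem_graph_weyl_iff {n : ℕ} (q : Form n) (h : ℝ) (u v : L2 n) :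
    (u, v) ∈ (weyl q h).graph ↔ weylDistribution q h (incl n u) = incl n v := by
  rw [weyl, Submodule.toLinearPMap_graph_eq, mem_weylGraph_iff]
  intro x hx hx1
  obtain ⟨u, v⟩ := x
  rw [mem_weylGraph_iff] at hx
  simp only at hx1
  subst hx1
  have hker := MeasureTheory.Lp.ker_toTemperedDistributionCLM_eq_bot (E := Conf n) (F := ℂ)
    (μ := MeasureTheory.volume) (p := 2)
  have hv : v ∈ (incl n).ker := by
    rw [map_zero, map_zero] at hx
    exact hx.symm
  rw [hker] at hv
  simpa using hv

theorem isClosed_weyl {n : ℕ} (q : Form n) (h : ℝ) : (weyl q h).IsClosed := by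
  have hs : ((weyl q h).graph : Set (L2 n × L2 n)) =
      {x | weylDistribution q h (incl n x.1) = incl n x.2} := by
    ext ⟨u, v⟩
    exact mem_graph_weyl_iff q h u v
  rw [LinearPMap.IsClosed, hs]
  exact isClosed_eq (by fun_prop) (by fun_prop)

/-- The tempered distributions given by Schwartz functions. -/
def schwartzRange (n : ℕ) : Submodule ℂ 𝓢'(Conf n, ℂ) :=
  ((SchwartzMap.toTemperedDistributionCLM (Conf n) ℂ MeasureTheory.volume :
    𝓢(Conf n, ℂ) →L[ℂ] 𝓢'(Conf n, ℂ)) : 𝓢(Conf n, ℂ) →ₗ[ℂ] 𝓢'(Conf n, ℂ)).range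

theorem mulX_mem {n : ℕ} (j : Fin n) {T : 𝓢'(Conf n, ℂ)} (hT : T ∈ schwartzRange n) :
    mulX j T ∈ schwartzRange n := by
  obtain ⟨f, rfl⟩ := hT
  have hg : (fun x : Conf n => (x j : ℂ)).HasTemperateGrowth := by
    have : (fun x : Conf n => (x j : ℂ)) =
        (Complex.ofRealCLM ∘L EuclideanSpace.proj j : Conf n →L[ℝ] ℂ) := by
      ext x; simp
    rw [this]
    fun_prop
  refine ⟨SchwartzMap.smulLeftCLM ℂ (fun x : Conf n => (x j : ℂ)) f, ?_⟩
  ext g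
  simp [mulX, SchwartzMap.smulLeftCLM_apply_apply hg, mul_comm, mul_left_comm]

theorem hD_mem {n : ℕ} (h : ℝ) (j : Fin n) {T : 𝓢'(Conf n, ℂ)} (hT : T ∈ schwartzRange n) :
    hD h j T ∈ schwartzRange n := by
  obtain ⟨f, rfl⟩ := hT
  refine Submodule.smul_mem _ _ ⟨LineDeriv.lineDerivOp (EuclideanSpace.single j (1 : ℝ)) f, ?_⟩
  simpa using
    (TemperedDistribution.lineDerivOp_toTemperedDistributionCLM_eq f
      (EuclideanSpace.single j (1 : ℝ))).symm

/-- `q^w(x, hD_x)` is densely defined, so that its adjoint is meaningful. -/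
theorem dense_domain_weyl {n : ℕ} (q : Form n) (h : ℝ) :
    Dense ((weyl q h).domain : Set (L2 n)) := by
  have hd := SchwartzMap.denseRange_toLpCLM (E := Conf n) (F := ℂ) (p := 2)
    (μ := MeasureTheory.volume) (by simp)
  refine hd.mono ?_
  rintro _ ⟨f, rfl⟩
  have h0 : incl n (f.toLp 2) ∈ schwartzRange n :=
    ⟨f, (MeasureTheory.Lp.toTemperedDistribution_toLp_eq f).symm⟩
  have h1 : weylDistribution q h (incl n (f.toLp 2)) ∈ schwartzRange n := by
    generalize incl n (f.toLp 2) = T at h0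
    have he : weylDistribution q h T = ∑ j, ∑ k,
        ((dxx q j k / 2) • mulX j (mulX k T)
          + (dxXi q j k / 2) • (mulX j (hD h k T) + hD h k (mulX j T))
          + (dXiXi q j k / 2) • hD h j (hD h k T)) := by
      simp only [weylDistribution, sum_apply]
      rfl
    rw [he]
    refine Submodule.sum_mem _ fun j _ => Submodule.sum_mem _ fun k _ => ?_
    have m1 := Submodule.smul_mem _ (dxx q j k / 2) (mulX_mem j (mulX_mem k h0))
    have m2 := Submodule.smul_mem _ (dxXi q j k / 2) (Submodule.add_mem _
      (mulX_mem j (hD_mem h k h0)) (hD_mem h k (mulX_mem j h0)))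
    have m3 := Submodule.smul_mem _ (dXiXi q j k / 2) (hD_mem h j (hD_mem h k h0))
    exact Submodule.add_mem _ (Submodule.add_mem _ m1 m2) m3
  obtain ⟨g, hg⟩ := h1
  have h2 : (f.toLp 2 MeasureTheory.volume, g.toLp 2 MeasureTheory.volume) ∈ (weyl q h).graph := by
    rw [mem_graph_weyl_iff, ← hg]
    exact (MeasureTheory.Lp.toTemperedDistribution_toLp_eq g).symm
  exact LinearPMap.mem_domain_of_mem_graph h2

/-! ### Kernels, spectra and Riesz projections of unbounded operators -/

variable {H : Type*} [NormedAddCommGroup H] [InnerProductSpace ℂ H]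

/-- The kernel of `A - z`. -/
def eigenspace (A : H →ₗ.[ℂ] H) (z : ℂ) : Set H :=
  {u | ∃ hu : u ∈ A.domain, A ⟨u, hu⟩ = z • u}

/-- The bounded operator `R` is the (two-sided) inverse of `z - A : dom A → H`. -/
def IsResolvent (A : H →ₗ.[ℂ] H) (z : ℂ) (R : H →L[ℂ] H) : Prop :=
  (∀ v : H, ∃ hv : R v ∈ A.domain, z • R v - A ⟨R v, hv⟩ = v) ∧
    ∀ u : A.domain, R (z • (u : H) - A u) = u

/-- The spectrum of an unbounded operator. -/
def spec (A : H →ₗ.[ℂ] H) : Set ℂ :=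
  {z | ¬ ∃ R : H →L[ℂ] H, IsResolvent A z R}

open Classical in
/-- The resolvent `(z - A)⁻¹` (and `0` when `z` is in the spectrum). -/
def resolvent (A : H →ₗ.[ℂ] H) (z : ℂ) : H →L[ℂ] H :=
  if hz : ∃ R : H →L[ℂ] H, IsResolvent A z R then hz.choose else 0

/-- The closed disc of radius `r > 0` about `z` meets the spectrum of `A` exactly in `z`. -/
def IsIsolatingRadius (A : H →ₗ.[ℂ] H) (z : ℂ) (r : ℝ) : Prop :=
  0 < r ∧ spec A ∩ Metric.closedBall z r = {z}

/-- The contour integral `(2πi)⁻¹ ∮ (ζ - A)⁻¹ dζ` over the positively oriented circle `|ζ - z| = r`.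
It is the spectral (Riesz) projection for `A` and `{z}` when `r` is an isolating radius. -/
def rieszProjection (A : H →ₗ.[ℂ] H) (z : ℂ) (r : ℝ) : H →L[ℂ] H :=
  (2 * Real.pi * Complex.I : ℂ)⁻¹ • ∮ ζ in C(z, r), resolvent A ζ

end QuadraticWeyl

end

/-! Let `Q` be the symmetric matrix of `q` and `J` the symplectic matrix, so that `F = JQ`.
Triviality of the singular space says that the pair (Re Q, J Im Q) is observable. Along the flow of
`iF` the Hermitian form Im(v̄ · Jv) has derivative −2⟨v, Re Q v⟩ ≤ 0, while vectors of Λ⁺ flow to 0;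
observability excludes that the form vanishes at a nonzero vector of Λ⁺, so it is positive there
(`IsPartiallyElliptic.krein_pos`). As Λ⁺ is also isotropic, it is the graph of a symmetric `Γ` with
Im Γ > 0, and `F` acts on it as a matrix `N` with spectrum in the upper half plane
(`IsPartiallyElliptic.isPolarization`).

The Gaussian u = exp(i Γx·x / 2h) is killed by the quantized linear forms vanishing on Λ⁺
(annihilation operators), which forces the eigenvalue (h/i) tr N = μ₀ (`IsPolarization.quad_vacuum`,
`IsPolarization.sum_roots_pos`). Polynomials times u form a dense union of finite-dimensional
invariant spaces. An annihilation operator lowers the degree and lowers the real part of the energy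
by a definite amount, so on this core every other eigenvalue lies in a half plane strictly to the
right of μ₀ (`IsPolarization.mem_span_or_gap_le`). The same applies to the formal adjoint, the
quantization of the conjugate matrix; its Gaussian v belongs to the matrix Γ' whose graph is the
conjugate of Λ⁻.

The core statement passes to L² through a lower bound for q^w − ζ on the core
(`exists_lower_bound`). It follows from compactness: the heat flow at time one maps bounded sets
into sets of bounded oscillator energy, by a Lyapunov argument with the observability Gramian as
weight (`IsPartiallyElliptic.exists_smoothing`). The bound, closedness of the operator and density
for the adjoint give a resolvent near μ₀ (`GroundStatePair.exists_isResolvent`).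

Algebraic simplicity on the core then yields Π f = (⟨v, f⟩ / ⟨v, u⟩) u, and the two kernels are the
lines through u and v. Matching kernels and orthogonality of Π both say that u and v are parallel;
for Gaussians this means Γ = Γ', which is the equality of the two Lagrangian subspaces. -/

open scoped SchwartzMap

noncomputable section

namespace QuadraticWeyl

open Matrix Complex

/-! ### Quadratic expressions in operators with canonical commutation relations -/

section CCR

variable {n : ℕ} {V : Type*} [NormedAddCommGroup V] [InnerProductSpace ℂ V]

/-- The matrix of the standard symplectic form. -/
def symJ (n : ℕ) (R : Type*) [Ring R] : Matrix (Fin n ⊕ Fin n) (Fin n ⊕ Fin n) R :=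
  Matrix.fromBlocks 0 1 (-1) 0

theorem symJ_transpose (n : ℕ) (R : Type*) [Ring R] : (symJ n R)ᵀ = -symJ n R := by
  simp [symJ, Matrix.fromBlocks_transpose, Matrix.fromBlocks_neg]

theorem symJ_mul_self (n : ℕ) (R : Type*) [Ring R] : symJ n R * symJ n R = -1 := by
  rw [symJ, Matrix.fromBlocks_multiply]
  simp [← Matrix.fromBlocks_one, Matrix.fromBlocks_neg]

theorem symJ_map (n : ℕ) : (symJ n ℝ).map Complex.ofReal = symJ n ℂ := by
  ext (i | i) (j | j) <;> simp [symJ, Matrix.one_apply, apply_ite Complex.ofReal]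

/-- A family of symmetric operators satisfying the canonical commutation relations. -/
structure IsCCR (h : ℝ) (P : Fin n ⊕ Fin n → Module.End ℂ V) : Prop where
  symm : ∀ a u v, inner ℂ (P a u) v = inner ℂ u (P a v)
  comm : ∀ a b u, P a (P b u) - P b (P a u) = (I * h * symJ n ℂ a b) • u

/-- The quantization of a linear form. -/
def lin (P : Fin n ⊕ Fin n → Module.End ℂ V) (y : Fin n ⊕ Fin n → ℂ) : Module.End ℂ V :=
  ∑ a, y a • P a

/-- The quantization of a quadratic form. -/
def quad (P : Fin n ⊕ Fin n → Module.End ℂ V)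
    (Q : Matrix (Fin n ⊕ Fin n) (Fin n ⊕ Fin n) ℂ) : Module.End ℂ V :=
  ∑ a, ∑ b, Q a b • (P a * P b)

variable {h : ℝ} {P : Fin n ⊕ Fin n → Module.End ℂ V}

theorem lin_apply (y : Fin n ⊕ Fin n → ℂ) (u : V) : lin P y u = ∑ a, y a • P a u := by
  simp [lin]

theorem quad_apply (Q : Matrix (Fin n ⊕ Fin n) (Fin n ⊕ Fin n) ℂ) (u : V) :
    quad P Q u = ∑ a, ∑ b, Q a b • P a (P b u) := by
  simp [quad]

theorem quad_apply_lin (Q : Matrix (Fin n ⊕ Fin n) (Fin n ⊕ Fin n) ℂ) (u : V) :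
    quad P Q u = ∑ a, P a (lin P (Q a) u) := by
  simp [quad, lin]

theorem lin_single (a : Fin n ⊕ Fin n) : lin P (Pi.single a 1) = P a := by
  ext u; simp [lin_apply, Pi.single_apply]

theorem lin_add (y z : Fin n ⊕ Fin n → ℂ) : lin P (y + z) = lin P y + lin P z := by
  simp [lin, add_smul, Finset.sum_add_distrib]

theorem lin_smul (c : ℂ) (y : Fin n ⊕ Fin n → ℂ) : lin P (c • y) = c • lin P y := by
  simp [lin, Finset.smul_sum, mul_smul]

theorem quad_add (Q Q' : Matrix (Fin n ⊕ Fin n) (Fin n ⊕ Fin n) ℂ) :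
    quad P (Q + Q') = quad P Q + quad P Q' := by
  simp [quad, add_smul, Finset.sum_add_distrib]

theorem quad_smul (c : ℂ) (Q : Matrix (Fin n ⊕ Fin n) (Fin n ⊕ Fin n) ℂ) :
    quad P (c • Q) = c • quad P Q := by
  simp [quad, Finset.smul_sum, mul_smul]

theorem quad_sub (Q Q' : Matrix (Fin n ⊕ Fin n) (Fin n ⊕ Fin n) ℂ) :
    quad P (Q - Q') = quad P Q - quad P Q' := by
  simp [quad, sub_smul, Finset.sum_sub_distrib]

namespace IsCCR

theorem apply_lin (hP : IsCCR h P) (a : Fin n ⊕ Fin n) (y : Fin n ⊕ Fin n → ℂ) (u : V) :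
    P a (lin P y u) = lin P y (P a u) + (I * h * (symJ n ℂ *ᵥ y) a) • u := by
  simp only [lin_apply, map_sum, map_smul]
  rw [← sub_eq_iff_eq_add', ← Finset.sum_sub_distrib]
  simp only [← smul_sub, hP.comm, Matrix.mulVec, dotProduct, Finset.mul_sum, Finset.sum_smul,
    smul_smul]
  exact Finset.sum_congr rfl fun b _ => by ring_nf

theorem lin_lin (hP : IsCCR h P) (y z : Fin n ⊕ Fin n → ℂ) (u : V) :
    lin P y (lin P z u) = lin P z (lin P y u) + (I * h * (y ⬝ᵥ symJ n ℂ *ᵥ z)) • u := by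
  rw [lin_apply y (lin P z u), lin_apply y u]
  simp only [hP.apply_lin, map_sum, map_smul, smul_add, Finset.sum_add_distrib, dotProduct,
    Finset.mul_sum, Finset.sum_smul, smul_smul]
  congr 1
  exact Finset.sum_congr rfl fun b _ => by ring_nf

/-- The commutator of a quadratic with a linear expression is again linear, because [P a, P b] is
scalar. Symmetry of `Q` makes the two contributions equal, whence the factor 2. All ladder relations
below are instances. -/
theorem quad_lin (hP : IsCCR h P) {Q : Matrix (Fin n ⊕ Fin n) (Fin n ⊕ Fin n) ℂ}
    (hQ : Qᵀ = Q) (y : Fin n ⊕ Fin n → ℂ) (u : V) :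
    quad P Q (lin P y u) =
      lin P y (quad P Q u) + (2 * I * h) • lin P (Q *ᵥ (symJ n ℂ *ᵥ y)) u := by
  have hsymm : ∀ a b, Q a b = Q b a := fun a b => by
    conv_lhs => rw [← hQ]
    rfl
  set c := symJ n ℂ *ᵥ y with hc
  have key : ∀ a b, P a (P b (lin P y u)) = lin P y (P a (P b u)) + (I * h * c a) • P b u
      + (I * h * c b) • P a u := by
    intro a b
    rw [hP.apply_lin, map_add, hP.apply_lin, map_smul]
  simp only [quad_apply, key, smul_add, Finset.sum_add_distrib, map_sum, map_smul]
  rw [add_assoc]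
  congr 1
  have e1 : ∑ a, ∑ b, Q a b • (I * h * c a) • P b u = (I * h) • lin P (Q *ᵥ c) u := by
    rw [Finset.sum_comm]
    simp only [lin_apply, Matrix.mulVec, dotProduct, Finset.smul_sum, Finset.sum_smul, smul_smul]
    exact Finset.sum_congr rfl fun b _ => Finset.sum_congr rfl fun a _ => by
      rw [hsymm a b]; ring_nf
  have e2 : ∑ a, ∑ b, Q a b • (I * h * c b) • P a u = (I * h) • lin P (Q *ᵥ c) u := by
    simp only [lin_apply, Matrix.mulVec, dotProduct, Finset.smul_sum, Finset.sum_smul, smul_smul]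
    exact Finset.sum_congr rfl fun b _ => Finset.sum_congr rfl fun a _ => by ring_nf
  rw [e1, e2, ← add_smul]
  ring_nf

/-- The quantized Poisson bracket of two quadratic forms, exact with no correction term; symmetry is
needed only for the left factor. -/
theorem quad_quad (hP : IsCCR h P) {Q : Matrix (Fin n ⊕ Fin n) (Fin n ⊕ Fin n) ℂ}
    (hQ : Qᵀ = Q) (g : Matrix (Fin n ⊕ Fin n) (Fin n ⊕ Fin n) ℂ) (u : V) :
    quad P Q (quad P g u) = quad P g (quad P Q u)
      + (2 * I * h) • quad P (Q * symJ n ℂ * g - g * symJ n ℂ * Q) u := by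
  have h1 : ∀ a v, quad P Q (P a v) = P a (quad P Q v)
      + (2 * I * h) • lin P ((Q * symJ n ℂ).col a) v := by
    intro a v
    conv_lhs => rw [← lin_single (P := P) a]
    rw [hP.quad_lin hQ, lin_single, mulVec_mulVec, mulVec_single_one]
  have hsw : ∀ a b, (Q * symJ n ℂ) a b = -(symJ n ℂ * Q) b a := by
    intro a b
    have : (Q * symJ n ℂ)ᵀ = -(symJ n ℂ * Q) := by
      rw [transpose_mul, hQ, symJ_transpose, neg_mul]
    exact congrFun (congrFun this b) a
  rw [quad_apply g, quad_apply g]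
  simp only [map_sum, map_smul, h1, map_add, smul_add, Finset.sum_add_distrib, add_assoc]
  congr 1
  rw [quad_sub, sub_eq_add_neg, LinearMap.add_apply, smul_add, add_comm]
  congr 1
  · simp only [quad_apply, lin_apply, Matrix.mul_apply, Finset.smul_sum, Finset.sum_smul]
    have : ∀ a b, ∑ c, g a b • (2 * I * h) • ((Q * symJ n ℂ).col a) c • P c (P b u) =
      ∑ c, (2 * I * h * (Q * symJ n ℂ) c a * g a b) • P c (P b u) := fun a b =>
      Finset.sum_congr rfl fun c _ => by simp only [smul_smul, col_apply]; ring_nf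
    simp only [this]
    rw [Finset.sum_congr rfl fun a _ => Finset.sum_comm, Finset.sum_comm]
    refine Finset.sum_congr rfl fun c _ => ?_
    rw [Finset.sum_comm]
    refine Finset.sum_congr rfl fun b _ => Finset.sum_congr rfl fun a _ => ?_
    simp only [smul_smul, Matrix.mul_apply]; ring_nf
  · simp only [LinearMap.neg_apply, quad_apply, lin_apply, Finset.smul_sum, smul_neg,
      ← Finset.sum_neg_distrib, map_sum, map_smul]
    refine Finset.sum_congr rfl fun a _ => ?_
    rw [Finset.sum_comm]
    refine Finset.sum_congr rfl fun c _ => ?_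
    simp only [smul_smul, ← neg_smul, ← Finset.sum_smul]
    congr 1
    rw [mul_assoc g, Matrix.mul_apply, Finset.mul_sum, ← Finset.sum_neg_distrib]
    refine Finset.sum_congr rfl fun b _ => ?_
    rw [col_apply, hsw]; ring

theorem inner_lin (hP : IsCCR h P) (y : Fin n ⊕ Fin n → ℂ) (u v : V) :
    inner ℂ (lin P y u) v = inner ℂ u (lin P (star y) v) := by
  simp only [lin_apply, sum_inner, inner_sum, inner_smul_left, inner_smul_right, hP.symm]
  rfl

/-- Taking adjoints reverses the order of the two factors, which symmetry of `Q` undoes; only the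
conjugation of the coefficients remains. -/
theorem inner_quad (hP : IsCCR h P) {Q : Matrix (Fin n ⊕ Fin n) (Fin n ⊕ Fin n) ℂ}
    (hQ : Qᵀ = Q) (u v : V) :
    inner ℂ (quad P Q u) v = inner ℂ u (quad P (Q.map star) v) := by
  have hsymm : ∀ a b, Q a b = Q b a := fun a b => by
    conv_lhs => rw [← hQ]
    rfl
  simp only [quad_apply, sum_inner, inner_sum, inner_smul_left, inner_smul_right, hP.symm]
  rw [Finset.sum_comm]
  exact Finset.sum_congr rfl fun b _ => Finset.sum_congr rfl fun a _ => by
    rw [hsymm a b]; simp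

theorem inner_quad_self (hP : IsCCR h P) (Q : Matrix (Fin n ⊕ Fin n) (Fin n ⊕ Fin n) ℂ) (u : V) :
    inner ℂ u (quad P Q u) = ∑ a, ∑ b, Q a b * inner ℂ (P a u) (P b u) := by
  simp only [quad_apply, inner_sum, inner_smul_right, hP.symm]

theorem _root_.Matrix.PosSemidef.exists_eq_conjTranspose_mul_self {m : Type*} [Fintype m]
    [DecidableEq m] {A : Matrix m m ℝ} (hA : A.PosSemidef) : ∃ B : Matrix m m ℝ, A = Bᴴ * B := by
  open scoped MatrixOrder in
  obtain ⟨X, hX, -, h⟩ := CFC.exists_sqrt_of_isSelfAdjoint_of_quasispectrumRestricts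
    hA.isHermitian (QuasispectrumRestricts.nnreal_of_nonneg hA.nonneg)
  exact ⟨X, by rw [← h, ← star_eq_conjTranspose, hX.star_eq]⟩

/-- Quantizations of nonnegative real quadratic forms are nonnegative. -/
theorem re_inner_quad_nonneg (hP : IsCCR h P) {g : Matrix (Fin n ⊕ Fin n) (Fin n ⊕ Fin n) ℝ}
    (hg : g.PosSemidef) (u : V) : 0 ≤ (inner ℂ u (quad P (g.map ofReal) u)).re := by
  obtain ⟨B, rfl⟩ := hg.exists_eq_conjTranspose_mul_self
  -- With `g = BᴴB` the quantization is a sum of squares of symmetric operators, one for each row of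
  -- `B`.
  have : inner ℂ u (quad P ((Bᴴ * B).map ofReal) u) =
      ∑ k, inner ℂ (lin P (fun a => (B k a : ℂ)) u) (lin P (fun a => (B k a : ℂ)) u) := by
    rw [hP.inner_quad_self]
    simp only [lin_apply, sum_inner, inner_sum, inner_smul_left, inner_smul_right, Matrix.mul_apply,
      map_apply, conjTranspose_apply, ofReal_sum, Finset.sum_mul]
    rw [Finset.sum_congr rfl fun a _ => Finset.sum_comm, Finset.sum_comm]
    refine Finset.sum_congr rfl fun k _ => ?_
    rw [Finset.sum_comm]
    refine Finset.sum_congr rfl fun b _ => ?_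
    rw [Finset.mul_sum]
    refine Finset.sum_congr rfl fun a _ => ?_
    simp only [star_trivial, ofReal_mul, conj_ofReal]
    ring
  rw [this, Complex.re_sum]
  exact Finset.sum_nonneg fun k _ => inner_self_nonneg (𝕜 := ℂ)

end IsCCR

end CCR

/-! ### Annihilation operators, the vacuum, and the filtration by degree -/

section Filtration

variable {n : ℕ} {V : Type*} [NormedAddCommGroup V] [InnerProductSpace ℂ V]
variable {h : ℝ} {P : Fin n ⊕ Fin n → Module.End ℂ V}

/-- The vector `(x, Γ x)` of the graph of `Γ`. -/
def graphVec (Γ : Matrix (Fin n) (Fin n) ℂ) (x : Fin n → ℂ) : Fin n ⊕ Fin n → ℂ :=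
  Sum.elim x (Γ *ᵥ x)

/-- The coefficients of the linear form `x ⬝ (ξ - Γ x)`, which vanishes on the graph of `Γ`. -/
def annVec (Γ : Matrix (Fin n) (Fin n) ℂ) (x : Fin n → ℂ) : Fin n ⊕ Fin n → ℂ :=
  Sum.elim (-(Γ *ᵥ x)) x

theorem symJ_mulVec_elim (R : Type*) [Ring R] (x y : Fin n → R) :
    symJ n R *ᵥ Sum.elim x y = Sum.elim y (-x) := by
  rw [symJ, fromBlocks_mulVec]
  simp [neg_mulVec]

/-- The Hamilton vector fields of the linear forms vanishing on the graph are tangent to it: the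
graph is its own symplectic complement when `Γ` is symmetric. The formula itself needs no symmetry.
-/
theorem symJ_mulVec_annVec (Γ : Matrix (Fin n) (Fin n) ℂ) (x : Fin n → ℂ) :
    symJ n ℂ *ᵥ annVec Γ x = graphVec Γ x := by
  simp [annVec, graphVec, symJ_mulVec_elim]

theorem annVec_smul (Γ : Matrix (Fin n) (Fin n) ℂ) (c : ℂ) (x : Fin n → ℂ) :
    annVec Γ (c • x) = c • annVec Γ x := by
  ext (i | i) <;> simp [annVec, mulVec_smul]

theorem annVec_add (Γ : Matrix (Fin n) (Fin n) ℂ) (x y : Fin n → ℂ) :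
    annVec Γ (x + y) = annVec Γ x + annVec Γ y := by
  ext (i | i) <;> simp [annVec, mulVec_add]; ring

/-- `u` is annihilated by the quantizations of the linear forms vanishing on the graph of `Γ`. -/
def IsVacuum (P : Fin n ⊕ Fin n → Module.End ℂ V) (Γ : Matrix (Fin n) (Fin n) ℂ) (u : V) : Prop :=
  ∀ x, lin P (annVec Γ x) u = 0

/-- The span of the products of at most `m` of the operators `P a`, applied to `u`. -/
def polySpan (P : Fin n ⊕ Fin n → Module.End ℂ V) (u : V) : ℕ → Submodule ℂ V
  | 0 => Submodule.span ℂ {u}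
  | m + 1 => polySpan P u m ⊔ ⨆ a, (polySpan P u m).map (P a)

/-- The span of all products of the operators `P a`, applied to `u`. -/
def polySpanTop (P : Fin n ⊕ Fin n → Module.End ℂ V) (u : V) : Submodule ℂ V :=
  ⨆ m, polySpan P u m

variable {u : V}

instance finiteDimensional_polySpan (m : ℕ) : FiniteDimensional ℂ (polySpan P u m) := by
  induction m with
  | zero => rw [polySpan]; infer_instance
  | succ m ih => rw [polySpan]; infer_instance

theorem polySpan_le_succ (m : ℕ) : polySpan P u m ≤ polySpan P u (m + 1) := le_sup_left

theorem polySpan_mono : Monotone (polySpan P u) := monotone_nat_of_le_succ polySpan_le_succ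

theorem apply_mem_polySpan (a : Fin n ⊕ Fin n) {m : ℕ} {w : V} (hw : w ∈ polySpan P u m) :
    P a w ∈ polySpan P u (m + 1) :=
  Submodule.mem_sup_right (Submodule.mem_iSup_of_mem a (Submodule.mem_map_of_mem hw))

theorem lin_mem_polySpan (y : Fin n ⊕ Fin n → ℂ) {m : ℕ} {w : V} (hw : w ∈ polySpan P u m) :
    lin P y w ∈ polySpan P u (m + 1) := by
  rw [lin_apply]
  exact Submodule.sum_mem _ fun a _ => Submodule.smul_mem _ _ (apply_mem_polySpan a hw)

theorem polySpan_succ_le {m : ℕ} {S : Submodule ℂ V} (h0 : ∀ w ∈ polySpan P u m, w ∈ S)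
    (h1 : ∀ a, ∀ w ∈ polySpan P u m, P a w ∈ S) : polySpan P u (m + 1) ≤ S := by
  rw [polySpan]
  refine sup_le h0 (iSup_le fun a => ?_)
  rintro _ ⟨w, hw, rfl⟩
  exact h1 a w hw

theorem mem_polySpanTop {w : V} : w ∈ polySpanTop P u ↔ ∃ m, w ∈ polySpan P u m := by
  rw [polySpanTop, Submodule.mem_iSup_of_directed _ polySpan_mono.directed_le]

theorem self_mem_polySpan (m : ℕ) : u ∈ polySpan P u m :=
  polySpan_mono (Nat.zero_le m) (Submodule.mem_span_singleton_self u)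

theorem IsVacuum.lin_zero {Γ : Matrix (Fin n) (Fin n) ℂ} (hu : IsVacuum P Γ u) (x : Fin n → ℂ)
    {w : V} (hw : w ∈ polySpan P u 0) : lin P (annVec Γ x) w = 0 := by
  obtain ⟨c, rfl⟩ := Submodule.mem_span_singleton.mp hw
  rw [map_smul, hu x, smul_zero]

/-- Annihilation operators lower the degree. -/
theorem IsVacuum.lin_mem (hP : IsCCR h P) {Γ : Matrix (Fin n) (Fin n) ℂ} (hu : IsVacuum P Γ u)
    (x : Fin n → ℂ) {m : ℕ} {w : V} (hw : w ∈ polySpan P u (m + 1)) :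
    lin P (annVec Γ x) w ∈ polySpan P u m := by
  induction m generalizing w with
  | zero =>
    refine polySpan_succ_le (S := (polySpan P u 0).comap (lin P (annVec Γ x))) (fun w hw => ?_)
      (fun a w hw => ?_) hw
    · rw [Submodule.mem_comap, hu.lin_zero x hw]
      exact zero_mem _
    · rw [Submodule.mem_comap, eq_sub_of_add_eq (hP.apply_lin a (annVec Γ x) w).symm,
        hu.lin_zero x hw, map_zero, zero_sub]
      exact neg_mem (Submodule.smul_mem _ _ hw)
  | succ m ih =>
    refine polySpan_succ_le (S := (polySpan P u (m + 1)).comap (lin P (annVec Γ x)))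
      (fun w hw => ?_) (fun a w hw => ?_) hw
    · exact polySpan_le_succ m (ih hw)
    · rw [Submodule.mem_comap, eq_sub_of_add_eq (hP.apply_lin a (annVec Γ x) w).symm]
      exact sub_mem (apply_mem_polySpan a (ih hw)) (Submodule.smul_mem _ _ hw)

/-- Commuting `quad P Q` past one generator costs a linear term, of degree at most that of the
generator, so invariance propagates from the eigenvector `u` to every degree. -/
theorem quad_mem_polySpan (hP : IsCCR h P) {Q : Matrix (Fin n ⊕ Fin n) (Fin n ⊕ Fin n) ℂ}
    (hQ : Qᵀ = Q) {c : ℂ} (hc : quad P Q u = c • u) {m : ℕ} {w : V} (hw : w ∈ polySpan P u m) :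
    quad P Q w ∈ polySpan P u m := by
  induction m generalizing w with
  | zero =>
    obtain ⟨d, rfl⟩ := Submodule.mem_span_singleton.mp hw
    rw [map_smul, hc]
    exact Submodule.smul_mem _ _ (Submodule.smul_mem _ _ (self_mem_polySpan 0))
  | succ m ih =>
    refine polySpan_succ_le (S := (polySpan P u (m + 1)).comap (quad P Q)) (fun w hw => ?_)
      (fun a w hw => ?_) hw
    · exact polySpan_le_succ m (ih hw)
    · rw [Submodule.mem_comap, ← lin_single (P := P) a, hP.quad_lin hQ, lin_single]
      exact add_mem (apply_mem_polySpan a (ih hw)) (Submodule.smul_mem _ _ (lin_mem_polySpan _ hw))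

/-- The graph of `Γ` is a positive Lagrangian subspace, and the Hamilton map of `Q` acts on it as
the matrix `N`. -/
structure IsPolarization (Q : Matrix (Fin n ⊕ Fin n) (Fin n ⊕ Fin n) ℂ)
    (Γ N : Matrix (Fin n) (Fin n) ℂ) : Prop where
  symm_form : Qᵀ = Q
  symm : Γᵀ = Γ
  posDef : (Γ.map im).PosDef
  mulVec_graph : ∀ x, Q *ᵥ graphVec Γ x = annVec Γ (N *ᵥ x)

namespace IsPolarization

variable {Q : Matrix (Fin n ⊕ Fin n) (Fin n ⊕ Fin n) ℂ} {Γ N : Matrix (Fin n) (Fin n) ℂ}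

/-- Invariance of the Lagrangian under the Hamilton map closes the annihilation operators under
commutation, with `N` as matrix. -/
theorem quad_ann (hΓ : IsPolarization Q Γ N) (hP : IsCCR h P) (x : Fin n → ℂ) (w : V) :
    quad P Q (lin P (annVec Γ x) w) =
      lin P (annVec Γ x) (quad P Q w) + (2 * I * h) • lin P (annVec Γ (N *ᵥ x)) w := by
  rw [hP.quad_lin hΓ.symm_form, symJ_mulVec_annVec, hΓ.mulVec_graph]

/-- On a vacuum the momenta act as `Γ` times the positions. After this substitution the terms
quadratic in the positions cancel by invariance of the graph, and reordering momentum past position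
leaves the trace. -/
theorem quad_vacuum (hΓ : IsPolarization Q Γ N) (hP : IsCCR h P) {w : V} (hw : IsVacuum P Γ w) :
    quad P Q w = (h / I * N.trace) • w := by
  have hsymm : ∀ i j, Γ i j = Γ j i := fun i j => congrFun (congrFun hΓ.symm j) i
  have hxi : ∀ j, P (Sum.inr j) w = ∑ k, Γ j k • P (Sum.inl k) w := by
    intro j
    have := hw (Pi.single j 1)
    simp only [lin_apply, annVec, Fintype.sum_sum_type, Sum.elim_inl, Sum.elim_inr, Pi.single_apply,
      ite_smul, one_smul, zero_smul, Finset.sum_ite_eq', Finset.mem_univ, if_true, Pi.neg_apply,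
      mulVec_single_one, col_apply, neg_smul, Finset.sum_neg_distrib] at this
    rw [← sub_eq_zero, ← this]
    simp only [hsymm j]
    abel
  have hlin : ∀ y : Fin n ⊕ Fin n → ℂ, lin P y w =
      ∑ k, (y (Sum.inl k) + ∑ j, y (Sum.inr j) * Γ j k) • P (Sum.inl k) w := by
    intro y
    simp only [lin_apply, Fintype.sum_sum_type, hxi, add_smul, Finset.sum_add_distrib,
      Finset.smul_sum, Finset.sum_smul, smul_smul]
    rw [Finset.sum_comm (γ := Fin n) (α := Fin n)]
  -- Each row of `Q`, applied to the vacuum, becomes a combination of positions whose coefficients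
  -- are read off from the invariance relation.
  have hQS : ∀ a k, Q a (Sum.inl k) + ∑ j, Q a (Sum.inr j) * Γ j k =
      annVec Γ (N *ᵥ Pi.single k 1) a := by
    intro a k
    rw [← hΓ.mulVec_graph]
    simp [mulVec, dotProduct, graphVec, Fintype.sum_sum_type, Pi.single_apply]
  have hx : ∀ j k v, P (Sum.inl j) (P (Sum.inl k) v) = P (Sum.inl k) (P (Sum.inl j) v) := by
    intro j k v
    have := hP.comm (Sum.inl j) (Sum.inl k) v
    simpa [symJ, sub_eq_zero] using this
  have hp : ∀ j k v, P (Sum.inr j) (P (Sum.inl k) v) = P (Sum.inl k) (P (Sum.inr j) v)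
      + (I * h * (if j = k then -1 else 0)) • v := by
    intro j k v
    have := hP.comm (Sum.inr j) (Sum.inl k) v
    rw [sub_eq_iff_eq_add'] at this
    rw [this]
    simp only [symJ, fromBlocks_apply₂₁, Matrix.neg_apply, Matrix.one_apply]
    split_ifs <;> simp
  rw [quad_apply_lin]
  simp only [hlin, hQS, Fintype.sum_sum_type, map_sum, map_smul, hp, hxi]
  simp only [annVec, Sum.elim_inl, Sum.elim_inr, mulVec_single_one, Pi.neg_apply, mulVec, dotProduct,
    col_apply, smul_add, Finset.sum_add_distrib, neg_smul, Finset.sum_neg_distrib]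
  -- The block −ΓN from the position rows cancels the block produced by the momentum rows, by
  -- symmetry of `Γ` and commutativity of the positions.
  have e1 : ∑ j, ∑ k, (∑ l, Γ j l * N l k) • P (Sum.inl j) (P (Sum.inl k) w) =
      ∑ l, ∑ k, N l k • ∑ j, Γ l j • P (Sum.inl k) (P (Sum.inl j) w) := by
    simp only [Finset.sum_smul, Finset.smul_sum, smul_smul]
    rw [Finset.sum_congr rfl fun j _ => Finset.sum_comm, Finset.sum_comm]
    refine Finset.sum_congr rfl fun l _ => ?_
    rw [Finset.sum_comm]
    refine Finset.sum_congr rfl fun k _ => Finset.sum_congr rfl fun j _ => ?_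
    rw [hsymm j l, hx j k, mul_comm]
  rw [e1, ← add_assoc, neg_add_cancel, zero_add]
  simp only [mul_ite, mul_zero, ite_smul, zero_smul, smul_ite, smul_zero, Finset.sum_ite_eq,
    Finset.mem_univ, if_true, smul_smul, ← Finset.sum_smul]
  congr 1
  rw [trace, Finset.mul_sum]
  refine Finset.sum_congr rfl fun j _ => ?_
  rw [div_I, diag_apply]
  ring

end IsPolarization

/-- The graph of `Γ` and its conjugate are transversal since Γ − Γ̄ = 2i Im Γ is invertible. Every
generator thus splits into an annihilation and a creation operator. -/
theorem exists_annVec_add_star {Γ : Matrix (Fin n) (Fin n) ℂ} (hpos : (Γ.map im).PosDef)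
    (y : Fin n ⊕ Fin n → ℂ) : ∃ x z, y = annVec Γ x + star (annVec Γ z) := by
  set G := (Γ.map im).map ofReal with hG
  have hdet : IsUnit G.det := by
    rw [hG]
    have h1 : ((Γ.map im).map ofReal).det = ((Γ.map im).det : ℂ) :=
      (RingHom.map_det ofRealHom (Γ.map im)).symm
    rw [h1, isUnit_iff_ne_zero]
    exact_mod_cast hpos.det_pos.ne'
  have hΓG : ∀ v, Γ *ᵥ v = Γ.map star *ᵥ v + (2 * I) • (G *ᵥ v) := by
    intro v
    ext j
    simp only [mulVec, dotProduct, Pi.add_apply, Pi.smul_apply, smul_eq_mul, Finset.mul_sum,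
      ← Finset.sum_add_distrib, hG, map_apply]
    refine Finset.sum_congr rfl fun k _ => ?_
    rw [← mul_assoc, ← add_mul]
    congr 1
    apply Complex.ext <;> simp; ring
  obtain ⟨p, r, rfl⟩ : ∃ p r, y = Sum.elim p r := ⟨y ∘ Sum.inl, y ∘ Sum.inr, by simp⟩
  -- For y = (p, r) the momentum entries give z̄ = r − x, and the position entries then read 2i (Im
  -- Γ) x = −(p + Γ̄ r).
  set x := -((2 * I)⁻¹ • (G⁻¹ *ᵥ (p + Γ.map star *ᵥ r))) with hx
  have hGx : (2 * I) • (G *ᵥ x) = -(p + Γ.map star *ᵥ r) := by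
    rw [hx, mulVec_neg, mulVec_smul, mulVec_mulVec, mul_nonsing_inv _ hdet, one_mulVec, smul_neg,
      smul_smul, mul_inv_cancel₀ (by simp), one_smul]
  refine ⟨x, star (r - x), ?_⟩
  have hstar : ∀ v : Fin n → ℂ, star (Γ *ᵥ star v) = Γ.map star *ᵥ v := by
    intro v
    ext j
    simp [mulVec, dotProduct]
  ext (i | i)
  · have e : star (annVec Γ (star (r - x))) (Sum.inl i) = -(Γ.map star *ᵥ (r - x)) i := by
      rw [← hstar]; simp [annVec]
    rw [Pi.add_apply, e]
    simp only [annVec, Sum.elim_inl, Pi.neg_apply]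
    rw [hΓG, hGx, mulVec_sub]
    simp only [Pi.add_apply, Pi.neg_apply, Pi.sub_apply]
    ring
  · simp [annVec]

end Filtration

/-! ### The adapted harmonic oscillator and the spectrum on polynomials times the vacuum -/

section Number

variable {n : ℕ} {V : Type*} [NormedAddCommGroup V] [InnerProductSpace ℂ V]
variable {h : ℝ} {P : Fin n ⊕ Fin n → Module.End ℂ V} {u : V}

/-- The harmonic oscillator whose ground state is the vacuum of the positive Lagrangian graph
of `Γ`. -/
theorem exists_harmonic (hh : 0 < h) {Γ : Matrix (Fin n) (Fin n) ℂ} (hsymm : Γᵀ = Γ)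
    (hpos : (Γ.map im).PosDef) : ∃ Q₀ : Matrix (Fin n ⊕ Fin n) (Fin n ⊕ Fin n) ℝ,
      Q₀.PosSemidef ∧ IsPolarization (Q₀.map ofReal) Γ ((I / (2 * h)) • 1) := by
  set G := Γ.map im with hG
  set A := Γ.map re with hA
  set R := G⁻¹ with hR
  have hdet : IsUnit G.det := by
    rw [isUnit_iff_ne_zero]; exact hpos.det_pos.ne'
  have hAsymm : Aᵀ = A := by rw [hA, ← transpose_map, hsymm]
  have hGsymm : Gᵀ = G := by rw [hG, ← transpose_map, hsymm]
  have hRsymm : Rᵀ = R := by rw [hR, transpose_nonsing_inv, hGsymm]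
  -- With Γ = A + iG this is the form Gx·x + G⁻¹(ξ − Ax)·(ξ − Ax), whose Hamilton map is i on the
  -- graph of `Γ`.
  set B : Matrix (Fin n ⊕ Fin n) (Fin n ⊕ Fin n) ℝ :=
    fromBlocks (G + A * R * A) (-(A * R)) (-(R * A)) R with hB
  have hBsemi : B.PosSemidef := by
    have e : B = (fromBlocks 1 0 (-A) 1)ᴴ * fromBlocks G 0 0 R * fromBlocks 1 0 (-A) 1 := by
      rw [fromBlocks_conjTranspose]
      simp [fromBlocks_multiply, conjTranspose_eq_transpose_of_trivial,
        hAsymm, Matrix.mul_assoc, hB]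
    have hblock : (fromBlocks G 0 0 R : Matrix (Fin n ⊕ Fin n) (Fin n ⊕ Fin n) ℝ).PosSemidef := by
      have : Invertible G := Matrix.invertibleOfIsUnitDet _ hdet
      simpa using (Matrix.PosDef.fromBlocks₁₁ (0 : Matrix (Fin n) (Fin n) ℝ) R hpos).2
        (by simpa using hpos.inv.posSemidef)
    rw [e]
    exact hblock.conjTranspose_mul_mul_same _
  have hBsymm : Bᵀ = B := by
    rw [hB, fromBlocks_transpose]
    simp [transpose_mul, hAsymm, hGsymm, hRsymm, Matrix.mul_assoc]
  -- The factor 1/(2h) turns the commutator constant 2ih into −1, so the oscillator counts degrees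
  -- in unit steps.
  refine ⟨(2 * h)⁻¹ • B, hBsemi.smul (by positivity), ?_, hsymm, hpos, fun x => ?_⟩
  · change (((2 * h)⁻¹ • B)ᵀ).map ofReal = _
    rw [transpose_smul, hBsymm]
  · have hΓ : Γ = A.map ofReal + I • G.map ofReal := by
      ext i j
      simp [hA, hG, mul_comm I, re_add_im]
    have hmul : ∀ X Y : Matrix (Fin n) (Fin n) ℝ, (X * Y).map ofReal =
        X.map ofReal * Y.map ofReal := fun X Y => Matrix.map_mul (f := ofRealHom)
    have hRG : R.map ofReal * G.map ofReal = (1 : Matrix (Fin n) (Fin n) ℂ) := by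
      rw [← hmul, hR, nonsing_inv_mul _ hdet]
      simp
    have e : ((2 * h)⁻¹ • B).map ofReal = ((2 * h : ℂ)⁻¹) •
        fromBlocks (G.map ofReal + A.map ofReal * R.map ofReal * A.map ofReal)
          (-(A.map ofReal * R.map ofReal)) (-(R.map ofReal * A.map ofReal)) (R.map ofReal) := by
      simp only [← hmul]
      ext (i | i) (j | j) <;> simp [hB]
    have e1 : (G.map ofReal + A.map ofReal * R.map ofReal * A.map ofReal)
        + -(A.map ofReal * R.map ofReal) * Γ = -I • Γ := by
      rw [hΓ, neg_mul, Matrix.mul_add, Matrix.mul_smul, Matrix.mul_assoc (A.map ofReal) _ (G.map ofReal),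
        hRG, Matrix.mul_one, smul_add, smul_smul, neg_mul, I_mul_I, neg_neg, one_smul, neg_smul]
      abel
    have e2 : -(R.map ofReal * A.map ofReal) + R.map ofReal * Γ = I • 1 := by
      rw [hΓ, Matrix.mul_add, Matrix.mul_smul, hRG]
      abel
    rw [e, smul_mulVec, graphVec, fromBlocks_mulVec]
    simp only [Sum.elim_comp_inl, Sum.elim_comp_inr, mulVec_mulVec, ← add_mulVec, e1, e2]
    have hh' : (h : ℂ) ≠ 0 := by exact_mod_cast hh.ne'
    ext (i | i)
    · simp [annVec, smul_mulVec, mulVec_smul, neg_mulVec]; field_simp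
    · simp [annVec, smul_mulVec]; field_simp

namespace IsPolarization

variable {Q₀ : Matrix (Fin n ⊕ Fin n) (Fin n ⊕ Fin n) ℝ} {Γ : Matrix (Fin n) (Fin n) ℂ}

/-- The ground state energy of the harmonic oscillator adapted to a vacuum vector. -/
theorem harmonic_vacuum (hh : h ≠ 0) (hΓ : IsPolarization (Q₀.map ofReal) Γ ((I / (2 * h)) • 1))
    (hP : IsCCR h P) {w : V} (hw : IsVacuum P Γ w) :
    quad P (Q₀.map ofReal) w = ((n : ℂ) / 2) • w := by
  rw [hΓ.quad_vacuum hP hw]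
  congr 1
  have hh' : (h : ℂ) ≠ 0 := by exact_mod_cast hh
  simp [trace_smul]
  field_simp
  simp

theorem harmonic_ann (hh : h ≠ 0) (hΓ : IsPolarization (Q₀.map ofReal) Γ ((I / (2 * h)) • 1))
    (hP : IsCCR h P) (x : Fin n → ℂ) (w : V) :
    quad P (Q₀.map ofReal) (lin P (annVec Γ x) w) =
      lin P (annVec Γ x) (quad P (Q₀.map ofReal) w) - lin P (annVec Γ x) w := by
  have hh' : (h : ℂ) ≠ 0 := by exact_mod_cast hh
  rw [hΓ.quad_ann hP, smul_mulVec, one_mulVec, annVec_smul, lin_smul, LinearMap.smul_apply,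
    smul_smul, sub_eq_add_neg]
  congr 1
  have : 2 * I * h * (I / (2 * h)) = -1 := by
    field_simp; rw [I_sq]
  rw [this, neg_one_smul]

/-- Reality of the oscillator matrix: conjugating the invariance relation for the graph reverses the
sign of the commutator, so creation operators raise the energy by one. -/
theorem harmonic_star_ann (hh : h ≠ 0)
    (hΓ : IsPolarization (Q₀.map ofReal) Γ ((I / (2 * h)) • 1))
    (hP : IsCCR h P) (x : Fin n → ℂ) (w : V) :
    quad P (Q₀.map ofReal) (lin P (star (annVec Γ x)) w) =
      lin P (star (annVec Γ x)) (quad P (Q₀.map ofReal) w) + lin P (star (annVec Γ x)) w := by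
  have hh' : (h : ℂ) ≠ 0 := by exact_mod_cast hh
  have hJ : symJ n ℂ *ᵥ star (annVec Γ x) = star (graphVec Γ x) := by
    rw [← symJ_mulVec_annVec, ← symJ_map]
    ext i
    simp [mulVec, dotProduct]
  have hQ : Q₀.map ofReal *ᵥ star (graphVec Γ x) = star (annVec Γ ((I / (2 * h)) • x)) := by
    have := hΓ.mulVec_graph x
    rw [smul_mulVec, one_mulVec] at this
    rw [← this]
    ext i
    simp only [mulVec, dotProduct, map_apply, Pi.star_apply, star_sum, star_mul']
    simp
  rw [hP.quad_lin hΓ.symm_form, hJ, hQ, annVec_smul, star_smul, lin_smul, LinearMap.smul_apply,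
    smul_smul]
  congr 1
  have : 2 * I * h * star (I / (2 * h)) = 1 := by
    simp
    field_simp; rw [I_sq]; simp
  rw [this, one_smul]

/-- The harmonic oscillator acts as `m + n/2` modulo lower degree. -/
theorem harmonic_sub_mem (hh : h ≠ 0)
    (hΓ : IsPolarization (Q₀.map ofReal) Γ ((I / (2 * h)) • 1)) (hP : IsCCR h P)
    (hu : IsVacuum P Γ u) (m : ℕ) {w : V} (hw : w ∈ polySpan P u (m + 1)) :
    quad P (Q₀.map ofReal) w - ((m + 1 : ℂ) + n / 2) • w ∈ polySpan P u m := by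
  have hc := hΓ.harmonic_vacuum hh hP hu
  have h0 : ∀ w ∈ polySpan P u 0, quad P (Q₀.map ofReal) w - ((n : ℂ) / 2) • w = 0 := by
    intro w hw
    obtain ⟨d, rfl⟩ := Submodule.mem_span_singleton.mp hw
    rw [map_smul, hc, smul_comm, sub_self]
  -- Write `P a` as annihilation plus creation. The shift is +1 on the creation part and −1 on the
  -- annihilation part, so assuming +1 throughout errs by twice the annihilation part, which has
  -- lower degree.
  have step : ∀ (m : ℕ) (a : Fin n ⊕ Fin n) (w : V), ∃ x, quad P (Q₀.map ofReal) (P a w)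
      - ((m + 1 : ℂ) + n / 2) • P a w =
      P a (quad P (Q₀.map ofReal) w - ((m : ℂ) + n / 2) • w)
        - (2 : ℂ) • lin P (annVec Γ x) w := by
    intro m a w
    obtain ⟨x, z, hxz⟩ := exists_annVec_add_star hΓ.posDef (Pi.single a 1)
    refine ⟨x, ?_⟩
    have ha : ∀ v, P a v = lin P (annVec Γ x) v + lin P (star (annVec Γ z)) v := by
      intro v
      rw [← LinearMap.add_apply, ← lin_add, ← hxz, lin_single]
    simp only [map_sub, map_smul, ha, map_add, hΓ.harmonic_ann hh hP, hΓ.harmonic_star_ann hh hP]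
    module
  induction m generalizing w with
  | zero =>
    refine polySpan_succ_le (S := (polySpan P u 0).comap (quad P (Q₀.map ofReal) -
      (((0 : ℕ) + 1 : ℂ) + n / 2) • LinearMap.id)) (fun w hw => ?_) (fun a w hw => ?_) hw
    · rw [Submodule.mem_comap, LinearMap.sub_apply]
      exact sub_mem (quad_mem_polySpan hP hΓ.symm_form hc hw) (Submodule.smul_mem _ _ hw)
    · rw [Submodule.mem_comap, LinearMap.sub_apply, LinearMap.smul_apply, LinearMap.id_apply]
      obtain ⟨x, hx⟩ := step 0 a w
      rw [hx, Nat.cast_zero, zero_add, h0 w hw, hu.lin_zero x hw]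
      simp
  | succ m ih =>
    refine polySpan_succ_le (S := (polySpan P u (m + 1)).comap (quad P (Q₀.map ofReal) -
      (((m + 1 : ℕ) + 1 : ℂ) + n / 2) • LinearMap.id)) (fun w hw => ?_) (fun a w hw => ?_) hw
    · rw [Submodule.mem_comap, LinearMap.sub_apply]
      exact sub_mem (quad_mem_polySpan hP hΓ.symm_form hc hw) (Submodule.smul_mem _ _ hw)
    · rw [Submodule.mem_comap, LinearMap.sub_apply, LinearMap.smul_apply, LinearMap.id_apply]
      obtain ⟨x, hx⟩ := step (m + 1) a w
      rw [hx]
      refine sub_mem (apply_mem_polySpan a ?_)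
        (Submodule.smul_mem _ _ (polySpan_le_succ m (hu.lin_mem hP x hw)))
      push_cast
      exact ih hw

/-- Split off the top degree orthogonally. The oscillator is symmetric and preserves the filtration,
so the top component is an exact eigenvector with energy its degree plus n/2, and the cross terms
vanish. -/
theorem inner_harmonic_lower_bound (hh : h ≠ 0)
    (hΓ : IsPolarization (Q₀.map ofReal) Γ ((I / (2 * h)) • 1)) (hP : IsCCR h P)
    (hu : IsVacuum P Γ u) (m : ℕ) {w : V} (hw : w ∈ polySpanTop P u)
    (hwm : ∀ z ∈ polySpan P u m, inner ℂ z w = 0) :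
    (m + 1 + n / 2) * ‖w‖ ^ 2 ≤ (inner ℂ w (quad P (Q₀.map ofReal) w)).re := by
  have hc := hΓ.harmonic_vacuum hh hP hu
  have hself : ∀ v v', inner ℂ (quad P (Q₀.map ofReal) v) v' =
      inner ℂ v (quad P (Q₀.map ofReal) v') := by
    intro v v'
    rw [hP.inner_quad hΓ.symm_form]
    congr 3
    ext a b
    simp
  obtain ⟨M, hM⟩ := mem_polySpanTop.mp hw
  clear hw
  induction M generalizing w with
  | zero =>
    have := hwm w (polySpan_mono (Nat.zero_le m) hM)
    rw [inner_self_eq_zero] at this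
    simp [this]
  | succ M ih =>
    by_cases hMm : M + 1 ≤ m
    · have := hwm w (polySpan_mono hMm hM)
      rw [inner_self_eq_zero] at this
      simp [this]
    have hmM : m ≤ M := by omega
    obtain ⟨w1, hw1, w2, hw2, rfl⟩ := (polySpan P u M).exists_add_mem_mem_orthogonal w
    rw [Submodule.mem_orthogonal] at hw2
    have hw2M : w2 ∈ polySpan P u (M + 1) := by
      simpa using sub_mem hM (polySpan_le_succ M hw1)
    have hw1' := ih (w := w1) (fun z hz => by
      have := hwm z hz
      rwa [inner_add_right, hw2 z (polySpan_mono hmM hz), add_zero] at this) hw1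
    have hQw1 := quad_mem_polySpan hP hΓ.symm_form hc hw1
    -- The difference of the two sides lies in `polySpan P u M` and is orthogonal to it.
    have hQw2 : quad P (Q₀.map ofReal) w2 = ((M + 1 : ℂ) + n / 2) • w2 := by
      have h1 := hΓ.harmonic_sub_mem hh hP hu M hw2M
      have h2 : ∀ z ∈ polySpan P u M,
          inner ℂ z (quad P (Q₀.map ofReal) w2 - ((M + 1 : ℂ) + n / 2) • w2) = 0 := by
        intro z hz
        rw [inner_sub_right, ← hself, hw2 _ (quad_mem_polySpan hP hΓ.symm_form hc hz),
          inner_smul_right, hw2 z hz, mul_zero, sub_zero]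
      have h3 := h2 _ h1
      rwa [inner_self_eq_zero, sub_eq_zero] at h3
    have h12 : inner ℂ w1 w2 = 0 := hw2 w1 hw1
    have h21 : inner ℂ w2 w1 = 0 := inner_eq_zero_symm.mp h12
    have e : inner ℂ (w1 + w2) (quad P (Q₀.map ofReal) (w1 + w2)) =
        inner ℂ w1 (quad P (Q₀.map ofReal) w1) + ((M + 1 : ℂ) + n / 2) * inner ℂ w2 w2 := by
      rw [map_add, inner_add_left, inner_add_right, inner_add_right, hQw2, inner_smul_right,
        inner_smul_right, h12, inner_eq_zero_symm.mp (hw2 _ hQw1)]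
      ring
    have en : ‖w1 + w2‖ ^ 2 = ‖w1‖ ^ 2 + ‖w2‖ ^ 2 := by
      have := norm_add_sq_eq_norm_sq_add_norm_sq_of_inner_eq_zero w1 w2 h12
      simpa [sq] using this
    have e2 : (((M + 1 : ℂ) + n / 2) * inner ℂ w2 w2).re = (M + 1 + n / 2) * ‖w2‖ ^ 2 := by
      rw [inner_self_eq_norm_sq_to_K]
      have : ((M + 1 : ℂ) + n / 2) * (‖w2‖ : ℂ) ^ 2 =
          (((M + 1 + n / 2) * ‖w2‖ ^ 2 : ℝ) : ℂ) := by push_cast; ring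
      exact (congrArg re this).trans (ofReal_re _)
    rw [e, en, add_re, e2]
    have : (m : ℝ) ≤ M := by exact_mod_cast hmM
    have : (m + 1 + n / 2) * ‖w2‖ ^ 2 ≤ (M + 1 + n / 2 : ℝ) * ‖w2‖ ^ 2 := by gcongr
    linarith

/-- The distance to the degree `m` part is controlled by the harmonic oscillator. -/
theorem exists_approx (hh : h ≠ 0) (hQ₀ : Q₀.PosSemidef)
    (hΓ : IsPolarization (Q₀.map ofReal) Γ ((I / (2 * h)) • 1)) (hP : IsCCR h P)
    (hu : IsVacuum P Γ u) (m : ℕ) {w : V} (hw : w ∈ polySpanTop P u) :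
    ∃ w' ∈ polySpan P u m, ‖w'‖ ≤ ‖w‖ ∧
      (m + 1) * ‖w - w'‖ ^ 2 ≤ (inner ℂ w (quad P (Q₀.map ofReal) w)).re := by
  have hc := hΓ.harmonic_vacuum hh hP hu
  obtain ⟨w1, hw1, w2, hw2, rfl⟩ := (polySpan P u m).exists_add_mem_mem_orthogonal w
  rw [Submodule.mem_orthogonal] at hw2
  have hw2M : w2 ∈ polySpanTop P u := by
    simpa using sub_mem hw (mem_polySpanTop.mpr ⟨m, hw1⟩)
  have h12 : inner ℂ w1 w2 = 0 := hw2 w1 hw1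
  have en : ‖w1 + w2‖ ^ 2 = ‖w1‖ ^ 2 + ‖w2‖ ^ 2 := by
    have := norm_add_sq_eq_norm_sq_add_norm_sq_of_inner_eq_zero w1 w2 h12
    simpa [sq] using this
  refine ⟨w1, hw1, ?_, ?_⟩
  · refine le_of_sq_le_sq ?_ (norm_nonneg _)
    rw [en]; nlinarith [norm_nonneg w2]
  · have hb := hΓ.inner_harmonic_lower_bound hh hP hu m hw2M hw2
    have hQw1 := quad_mem_polySpan hP hΓ.symm_form hc hw1
    have h1 : inner ℂ w1 (quad P (Q₀.map ofReal) w2) = 0 := by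
      have : Q₀.map ofReal = ((Q₀.map ofReal).map star) := by ext a b; simp
      rw [this, ← hP.inner_quad hΓ.symm_form, hw2 _ hQw1]
    have hp := hP.re_inner_quad_nonneg hQ₀ w1
    rw [map_add, inner_add_left, inner_add_right, inner_add_right, h1,
      inner_eq_zero_symm.mp (hw2 _ hQw1), add_sub_cancel_left]
    simp only [add_zero, zero_add, add_re]
    have : (m + 1) * ‖w2‖ ^ 2 ≤ (m + 1 + n / 2 : ℝ) * ‖w2‖ ^ 2 := by
      refine mul_le_mul_of_nonneg_right ?_ (sq_nonneg _)
      linarith [show (0 : ℝ) ≤ n / 2 by positivity]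
    linarith

end IsPolarization

/-- The component of a vacuum orthogonal to `u` is again a vacuum, with oscillator energy n/2; but
orthogonality to degree 0 forces energy at least 1 + n/2. -/
theorem IsVacuum.mem_span (hh : 0 < h) {Γ : Matrix (Fin n) (Fin n) ℂ} (hsymm : Γᵀ = Γ)
    (hpos : (Γ.map im).PosDef) (hP : IsCCR h P) (hu : IsVacuum P Γ u) {w : V}
    (hw : w ∈ polySpanTop P u) (hwv : IsVacuum P Γ w) : w ∈ Submodule.span ℂ {u} := by
  obtain ⟨Q₀, hQ₀, hΓ⟩ := exists_harmonic hh hsymm hpos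
  obtain ⟨w1, hw1, w2, hw2, rfl⟩ := (polySpan P u 0).exists_add_mem_mem_orthogonal w
  rw [Submodule.mem_orthogonal] at hw2
  have hw2M : w2 ∈ polySpanTop P u := by
    simpa using sub_mem hw (mem_polySpanTop.mpr ⟨0, hw1⟩)
  have hv2 : IsVacuum P Γ w2 := by
    intro x
    have := hwv x
    rwa [map_add, hu.lin_zero x hw1, zero_add] at this
  have h1 := hΓ.inner_harmonic_lower_bound hh.ne' hP hu 0 hw2M hw2
  rw [hΓ.harmonic_vacuum hh.ne' hP hv2, inner_smul_right, inner_self_eq_norm_sq_to_K] at h1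
  have e : ((n : ℂ) / 2 * (‖w2‖ : ℂ) ^ 2).re = n / 2 * ‖w2‖ ^ 2 := by
    have : (n : ℂ) / 2 * (‖w2‖ : ℂ) ^ 2 = ((n / 2 * ‖w2‖ ^ 2 : ℝ) : ℂ) := by push_cast; ring
    exact (congrArg re this).trans (ofReal_re _)
  have h2 := h1.trans_eq e
  have h3 : ‖w2‖ ^ 2 ≤ 0 := by push_cast at h2; linarith
  have h4 : w2 = 0 := by
    have := pow_eq_zero_iff (two_ne_zero) |>.mp (le_antisymm h3 (sq_nonneg _))
    simpa using this
  rw [h4, add_zero]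
  exact hw1

/-- `T` is nonzero on some generalized eigenspace; follow the Jordan chain until one more
application of N − l is killed by `T`. The vector found need not itself be an eigenvector of `N`. -/
theorem exists_eigenvector_of_ne_zero {M W : Type*} [AddCommGroup M] [Module ℂ M]
    [FiniteDimensional ℂ M] [AddCommGroup W] [Module ℂ W] (N : Module.End ℂ M) (T : M →ₗ[ℂ] W)
    (hT : T ≠ 0) : ∃ l x, T x ≠ 0 ∧ T (N x) = l • T x ∧ N.HasEigenvalue l := by
  obtain ⟨l, hl⟩ : ∃ l, ¬ N.maxGenEigenspace l ≤ LinearMap.ker T := by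
    by_contra! hcon
    have := iSup_le hcon
    rw [Module.End.iSup_maxGenEigenspace_eq_top, top_le_iff, LinearMap.ker_eq_top] at this
    exact hT this
  obtain ⟨v, hv, hTv⟩ := SetLike.not_le_iff_exists.mp hl
  obtain ⟨k, hk⟩ := (Module.End.mem_maxGenEigenspace N l v).mp hv
  have hlN : N.HasEigenvalue l := by
    rw [Module.End.hasEigenvalue_iff]
    intro hbot
    have hinj : Function.Injective (N - l • (1 : Module.End ℂ M)) := by
      rw [← LinearMap.ker_eq_bot]
      rwa [Module.End.eigenspace_def] at hbot
    have h0 : v = 0 := by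
      have := hinj.iterate k
      rw [← Module.End.coe_pow] at this
      exact this (by rw [hk, map_zero])
    exact hTv (by simp [h0])
  clear hv
  induction k generalizing v with
  | zero => exact absurd (by simpa using hk) fun h0 : v = 0 => hTv (by simp [h0])
  | succ k ih =>
    by_cases h0 : T ((N - l • (1 : Module.End ℂ M)) v) = 0
    · refine ⟨l, v, hTv, ?_, hlN⟩
      simpa [sub_eq_zero] using h0
    · exact ih _ h0 (by rwa [pow_succ] at hk)

/-- The spectrum of `quad P Q` on the span of the polynomials times the vacuum: apart from the
ground state energy it lies in a half plane. -/
theorem IsPolarization.mem_span_or_gap_le (hh : 0 < h)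
    {Q : Matrix (Fin n ⊕ Fin n) (Fin n ⊕ Fin n) ℂ} {Γ N : Matrix (Fin n) (Fin n) ℂ}
    (hΓ : IsPolarization Q Γ N) {δ : ℝ}
    (hδ : ∀ (l : ℂ) x, x ≠ 0 → N *ᵥ x = l • x → δ ≤ l.im) (hδ0 : 0 < δ) (hP : IsCCR h P)
    (hu : IsVacuum P Γ u) {g : V} (hg : g ∈ polySpanTop P u) (μ : ℂ)
    (hμ : IsVacuum P Γ (quad P Q g - μ • g)) :
    g ∈ Submodule.span ℂ {u} ∨ (h / I * N.trace).re + 2 * h * δ ≤ μ.re := by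
  obtain ⟨m, hm⟩ := mem_polySpanTop.mp hg
  clear hg
  induction m generalizing g μ with
  | zero => exact Or.inl hm
  | succ m ih =>
    by_cases hgv : IsVacuum P Γ g
    · exact Or.inl (hu.mem_span hh hΓ.symm hΓ.posDef hP (mem_polySpanTop.mpr ⟨m + 1, hm⟩) hgv)
    right
    -- The annihilators kill the defect of `g` from being an eigenvector, so applying them to `g`
    -- gives a space on which `quad P Q` − μ acts through `N`.
    have key : ∀ x, quad P Q (lin P (annVec Γ x) g) - μ • lin P (annVec Γ x) g =
        (2 * I * h) • lin P (annVec Γ (N *ᵥ x)) g := by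
      intro x
      have := hμ x
      rw [map_sub, map_smul, sub_eq_zero] at this
      rw [hΓ.quad_ann hP, this]
      abel
    let T : (Fin n → ℂ) →ₗ[ℂ] V :=
      { toFun := fun x => lin P (annVec Γ x) g
        map_add' := fun x y => by simp [annVec_add, lin_add]
        map_smul' := fun c x => by simp [annVec_smul, lin_smul] }
    have hT : T ≠ 0 := fun hT => hgv fun x => LinearMap.congr_fun hT x
    obtain ⟨l, x, hx, hl, hlN⟩ := exists_eigenvector_of_ne_zero (Matrix.toLin' N) T hT
    have hδl : δ ≤ l.im := by
      obtain ⟨y, hy⟩ := hlN.exists_hasEigenvector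
      exact hδ l y hy.2 (by simpa using hy.apply_eq_smul)
    have hval : quad P Q (T x) - (μ + 2 * I * h * l) • T x = 0 := by
      have h1 := key x
      change quad P Q (T x) - μ • T x = (2 * I * h) • T (N *ᵥ x) at h1
      rw [toLin'_apply] at hl
      rw [hl, smul_smul] at h1
      rw [add_smul, ← sub_sub, h1, sub_self]
    -- The real part of the energy falls by 2h Im l ≥ 2hδ while the degree falls by one, so the
    -- induction ends at the ground state.
    have hre : (μ + 2 * I * h * l).re = μ.re - 2 * h * l.im := by
      simp
      ring
    have hTx : T x ∈ polySpan P u m := hu.lin_mem hP x hm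
    rcases ih (g := T x) (μ + 2 * I * h * l) (by rw [hval]; intro y; simp) hTx with h1 | h1
    · obtain ⟨c, hc⟩ := Submodule.mem_span_singleton.mp h1
      have h2 : quad P Q (T x) = (h / I * N.trace) • T x := by
        rw [← hc, map_smul, hΓ.quad_vacuum hP hu, smul_comm]
      rw [h2, ← sub_smul] at hval
      have h3 := (smul_eq_zero.mp hval).resolve_right hx
      rw [sub_eq_zero] at h3
      rw [h3, hre]
      nlinarith
    · rw [hre] at h1
      nlinarith

end Number

/-! ### Linear flows and the observability Gramian -/

section Flow

theorem exists_hasDerivAt_clm {F : Type*} [NormedAddCommGroup F] [NormedSpace ℝ F]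
    [CompleteSpace F] (A : F →L[ℝ] F) (w₀ : F) : ∃ w : ℝ → F, w 0 = w₀ ∧
      (∀ t, HasDerivAt w (A (w t)) t) ∧ ∀ t, w t = 0 → w₀ = 0 := by
  refine ⟨fun t => NormedSpace.exp (t • A) w₀, by simp, fun t => ?_, fun t ht => ?_⟩
  · simpa using (hasDerivAt_exp_smul_const' A t).clm_apply (hasDerivAt_const t w₀)
  · have hu := NormedSpace.invertibleExpOfMemBall (𝕂 := ℝ) (x := t • A)
      ((NormedSpace.expSeries_radius_eq_top ℝ (F →L[ℝ] F)).symm ▸ edist_lt_top _ _)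
    have h1 : (⅟(NormedSpace.exp (t • A)) * NormedSpace.exp (t • A)) w₀ = 0 := by
      change ⅟(NormedSpace.exp (t • A)) (NormedSpace.exp (t • A) w₀) = 0
      rw [show NormedSpace.exp (t • A) w₀ = 0 from ht, map_zero]
    simpa using h1

/-- Operators on `V` may be unbounded, but on the finite-dimensional invariant space `E` each one is
continuous. This allows any `L` to be differentiated along the flow. -/
theorem exists_linear_flow {V : Type*} [NormedAddCommGroup V] [InnerProductSpace ℂ V]
    (A : Module.End ℂ V) (E : Submodule ℂ V) [FiniteDimensional ℂ E] (hA : ∀ w ∈ E, A w ∈ E)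
    {w₀ : V} (hw₀ : w₀ ∈ E) : ∃ u : ℝ → V, u 0 = w₀ ∧ (∀ t, u t ∈ E) ∧
      ∀ (L : Module.End ℂ V) (t : ℝ), HasDerivAt (fun s => L (u s)) (-L (A (u t))) t := by
  have : CompleteSpace E := FiniteDimensional.complete ℂ E
  obtain ⟨w, hw0, hw, -⟩ := exists_hasDerivAt_clm
    (-(LinearMap.toContinuousLinearMap (A.restrict hA)).restrictScalars ℝ) (⟨w₀, hw₀⟩ : E)
  refine ⟨fun t => w t, by simp [hw0], fun t => Subtype.prop _, fun L t => ?_⟩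
  set L' : E →L[ℂ] (LinearMap.range (L ∘ₗ E.subtype)) :=
    LinearMap.toContinuousLinearMap (L ∘ₗ E.subtype).rangeRestrict
  have h3 := ((Submodule.subtypeL (LinearMap.range (L ∘ₗ E.subtype))).restrictScalars
    ℝ).hasFDerivAt.comp_hasDerivAt t
    ((L'.restrictScalars ℝ).hasFDerivAt.comp_hasDerivAt t (hw t))
  have h4 : -L (A (w t)) = ((L'.restrictScalars ℝ)
      ((-(LinearMap.toContinuousLinearMap (A.restrict hA)).restrictScalars ℝ) (w t)) : V) := by
    change _ = L ((-(A.restrict hA (w t)) : E) : V)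
    simp
  rw [h4]
  exact h3

variable {ι 𝕜 : Type*} [Fintype ι] [DecidableEq ι] [RCLike 𝕜]

omit [DecidableEq ι] in
theorem hasDerivAt_mulVec {w : ℝ → ι → 𝕜} {w' : ι → 𝕜} {t : ℝ} (hw : HasDerivAt w w' t)
    (B : Matrix ι ι 𝕜) : HasDerivAt (fun s => B *ᵥ w s) (B *ᵥ w') t := by
  rw [hasDerivAt_pi] at hw ⊢
  intro i
  simp only [mulVec, dotProduct]
  exact HasDerivAt.fun_sum fun j _ => (hw j).const_mul _

/-- If an observation `B` vanishes along a linear flow, then so do all its derivatives. -/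
theorem mulVec_pow_eq_zero_of_flow {X B : Matrix ι ι 𝕜} {w : ℝ → ι → 𝕜}
    (hw : ∀ t, HasDerivAt w (X *ᵥ w t) t) (hB : ∀ t ∈ Set.Ioo (0 : ℝ) 1, B *ᵥ w t = 0) (k : ℕ) :
    ∀ t ∈ Set.Ioo (0 : ℝ) 1, (B * X ^ k) *ᵥ w t = 0 := by
  induction k with
  | zero => simpa using hB
  | succ k ih =>
    intro t ht
    have h1 := hasDerivAt_mulVec (hw t) (B * X ^ k)
    have h2 : HasDerivAt (fun s => (B * X ^ k) *ᵥ w s) 0 t := by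
      refine (hasDerivAt_const t (0 : ι → 𝕜)).congr_of_eventuallyEq ?_
      filter_upwards [isOpen_Ioo.mem_nhds ht] with s hs using ih s hs
    have h3 := h1.unique h2
    rwa [mulVec_mulVec, mul_assoc, ← pow_succ] at h3

open scoped Matrix.Norms.Operator in
theorem exists_matrix_flow (K : Matrix ι ι ℝ) : ∃ W : ℝ → Matrix ι ι ℝ, W 0 = 1 ∧
    (∀ t a b, HasDerivAt (fun s => W s a b) ((K * W t) a b) t) ∧
    (∀ t a b, HasDerivAt (fun s => W s a b) ((W t * K) a b) t) ∧ ∀ t, IsUnit (W t) := by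
  refine ⟨fun s => NormedSpace.exp (s • K), by simp, fun t a b => ?_, fun t a b => ?_,
    fun t => Matrix.isUnit_exp _⟩
  · exact (LinearMap.toContinuousLinearMap
      (Matrix.entryLinearMap ℝ ℝ a b)).hasFDerivAt.comp_hasDerivAt t
      (hasDerivAt_exp_smul_const' K t)
  · exact (LinearMap.toContinuousLinearMap
      (Matrix.entryLinearMap ℝ ℝ a b)).hasFDerivAt.comp_hasDerivAt t (hasDerivAt_exp_smul_const K t)

/-- The observability Gramian of the pair `(R, K)`. -/
theorem exists_gramian {K R : Matrix ι ι ℝ} (hR : R.PosSemidef)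
    (hobs : ∀ x, (∀ k, (R * K ^ k) *ᵥ x = 0) → x = 0) : ∃ g : ℝ → Matrix ι ι ℝ, g 0 = 0 ∧
      (∀ t a b, HasDerivAt (fun s => g s a b) ((R + (Kᵀ * g t + g t * K)) a b) t) ∧
      (∀ t, 0 ≤ t → (g t).PosSemidef) ∧ (g 1).PosDef := by
  have hRs : Rᵀ = R := hR.isHermitian
  obtain ⟨W, hW0, hWl, hWr, hWu⟩ := exists_matrix_flow K
  set M : ℝ → Matrix ι ι ℝ := fun s => (W s)ᵀ * R * W s with hM
  have hMd : ∀ t a b, HasDerivAt (fun s => M s a b) ((Kᵀ * M t + M t * K) a b) t := by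
    intro t a b
    have h1 : ∀ c, HasDerivAt (fun s => ((W s)ᵀ * R) a c) ((Kᵀ * (W t)ᵀ * R) a c) t := by
      intro c
      rw [← transpose_mul]
      simp only [Matrix.mul_apply (M := (W _)ᵀ), Matrix.mul_apply (M := (_ * _)ᵀ), transpose_apply]
      exact HasDerivAt.fun_sum fun d _ => (hWr t d a).mul_const _
    have h2 : HasDerivAt (fun s => M s a b) (∑ c, ((Kᵀ * (W t)ᵀ * R) a c * W t c b
        + ((W t)ᵀ * R) a c * (W t * K) c b)) t := by
      simp only [hM, Matrix.mul_apply (M := (W _)ᵀ * R)]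
      exact HasDerivAt.fun_sum fun c _ => (h1 c).mul (hWr t c b)
    convert h2 using 1
    rw [Finset.sum_add_distrib, ← Matrix.mul_apply, ← Matrix.mul_apply, Matrix.add_apply]
    simp only [hM, Matrix.mul_assoc]
  have hMc : ∀ a b, Continuous fun s => M s a b := fun a b =>
    continuous_iff_continuousAt.mpr fun t => (hMd t a b).continuousAt
  set g : ℝ → Matrix ι ι ℝ := fun t => Matrix.of fun a b => ∫ s in (0 : ℝ)..t, M s a b with hg
  have hgd : ∀ t a b, HasDerivAt (fun s => g s a b) (M t a b) t := fun t a b =>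
    intervalIntegral.integral_hasDerivAt_right ((hMc a b).intervalIntegrable _ _)
      ((hMc a b).stronglyMeasurableAtFilter _ _) (hMc a b).continuousAt
  have hMg : ∀ t, M t = R + (Kᵀ * g t + g t * K) := by
    intro t
    ext a b
    have h1 := intervalIntegral.integral_eq_sub_of_hasDerivAt (a := 0) (b := t)
      (fun s _ => hMd s a b) (Continuous.intervalIntegrable (by
        simp only [Matrix.add_apply, Matrix.mul_apply]
        exact (continuous_finsetSum _ fun c _ => (hMc c b).const_mul _).add
          (continuous_finsetSum _ fun c _ => (hMc a c).mul_const _)) _ _)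
    have h0 : M 0 a b = R a b := by simp [hM, hW0]
    have h2 : ∫ s in (0 : ℝ)..t, (Kᵀ * M s + M s * K) a b = (Kᵀ * g t + g t * K) a b := by
      simp only [Matrix.add_apply, Matrix.mul_apply, hg, Matrix.of_apply]
      rw [intervalIntegral.integral_add, intervalIntegral.integral_finsetSum,
        intervalIntegral.integral_finsetSum]
      · simp only [intervalIntegral.integral_const_mul, intervalIntegral.integral_mul_const]
      · exact fun c _ => ((hMc a c).mul_const _).intervalIntegrable _ _
      · exact fun c _ => ((hMc c b).const_mul _).intervalIntegrable _ _
      · exact (continuous_finsetSum _ fun c _ => (hMc c b).const_mul _).intervalIntegrable _ _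
      · exact (continuous_finsetSum _ fun c _ => (hMc a c).mul_const _).intervalIntegrable _ _
    rw [h2, h0] at h1
    rw [Matrix.add_apply, h1]
    ring
  have hMx : ∀ s x, x ⬝ᵥ M s *ᵥ x = (W s *ᵥ x) ⬝ᵥ R *ᵥ (W s *ᵥ x) := by
    intro s x
    simp only [hM, ← mulVec_mulVec, dotProduct_mulVec x, vecMul_transpose]
  have hMnn : ∀ s x, 0 ≤ x ⬝ᵥ M s *ᵥ x := by
    intro s x
    rw [hMx]
    simpa using hR.dotProduct_mulVec_nonneg (W s *ᵥ x)
  have hMxc : ∀ x, Continuous fun s => x ⬝ᵥ M s *ᵥ x := by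
    intro x
    simp only [dotProduct, mulVec]
    exact continuous_finsetSum _ fun a _ => continuous_const.mul
      (continuous_finsetSum _ fun b _ => (hMc a b).mul_const _)
  have hform : ∀ t x, x ⬝ᵥ g t *ᵥ x = ∫ s in (0 : ℝ)..t, x ⬝ᵥ M s *ᵥ x := by
    intro t x
    simp only [dotProduct, mulVec, hg, Matrix.of_apply]
    rw [intervalIntegral.integral_finsetSum]
    · refine Finset.sum_congr rfl fun a _ => ?_
      rw [intervalIntegral.integral_const_mul, intervalIntegral.integral_finsetSum]
      · simp only [intervalIntegral.integral_mul_const]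
      · exact fun c _ => ((hMc a c).mul_const _).intervalIntegrable _ _
    · exact fun a _ => (continuous_const.mul (continuous_finsetSum _ fun b _ =>
        (hMc a b).mul_const _)).intervalIntegrable _ _
  have hgs : ∀ t, (g t).IsHermitian := by
    intro t
    have hMs : ∀ s a b, M s a b = M s b a := by
      intro s a b
      have : (M s)ᵀ = M s := by simp [hM, hRs, Matrix.mul_assoc]
      exact congrFun (congrFun this b) a
    ext a b
    simp only [conjTranspose_apply, star_trivial, hg, Matrix.of_apply, hMs _ a b]
  refine ⟨g, by ext; simp [hg], fun t a b => ?_, fun t ht => ?_, ?_⟩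
  · rw [← hMg]
    exact hgd t a b
  · refine Matrix.PosSemidef.of_dotProduct_mulVec_nonneg (hgs t) fun x => ?_
    rw [star_trivial, hform]
    exact intervalIntegral.integral_nonneg ht fun s _ => hMnn s x
  · refine Matrix.PosDef.of_dotProduct_mulVec_pos (hgs 1) fun x hx => ?_
    rw [star_trivial, hform]
    by_contra hcon
    apply hx
    -- If the Gramian form vanishes at `x`, then `R` vanishes along the whole orbit of `x`;
    -- differentiating in time brings in the powers of `K`, and observability applies.
    have hz : ∀ t ∈ Set.Ioo (0 : ℝ) 1, R *ᵥ (W t *ᵥ x) = 0 := by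
      intro t ht
      by_contra hne
      apply hcon
      refine intervalIntegral.integral_pos one_pos (hMxc x).continuousOn (fun s _ => hMnn s x)
        ⟨t, Set.Ioo_subset_Icc_self ht, lt_of_le_of_ne (hMnn t x) fun h0 => hne ?_⟩
      rw [hMx] at h0
      rw [← hR.dotProduct_mulVec_zero_iff, star_trivial, ← h0]
    have hWx : ∀ t, HasDerivAt (fun t => W t *ᵥ x) (K *ᵥ (W t *ᵥ x)) t := by
      intro t
      rw [mulVec_mulVec, hasDerivAt_pi]
      intro a
      simp only [mulVec, dotProduct]
      exact HasDerivAt.fun_sum fun b _ => (hWl t a b).mul_const _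
    have h1 := mulVec_pow_eq_zero_of_flow (X := K) (B := R) hWx hz
    have h2 := hobs _ fun k => h1 k (1 / 2) (by norm_num)
    exact (Matrix.mulVec_injective_iff_isUnit.mpr (hWu (1 / 2))) (by simpa using h2)

end Flow

/-! ### Energy identities along the heat flow -/

section Dissipation

variable {n : ℕ} {V : Type*} [NormedAddCommGroup V] [InnerProductSpace ℂ V]
variable {h : ℝ} {P : Fin n ⊕ Fin n → Module.End ℂ V}

theorem map_ofReal_map_star {ι : Type*} (g : Matrix ι ι ℝ) :
    (g.map ofReal).map star = g.map ofReal := by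
  ext a b; simp

theorem IsCCR.inner_quad_real (hP : IsCCR h P) {g : Matrix (Fin n ⊕ Fin n) (Fin n ⊕ Fin n) ℝ}
    (hg : gᵀ = g) (u v : V) :
    inner ℂ (quad P (g.map ofReal) u) v = inner ℂ u (quad P (g.map ofReal) v) := by
  have : (g.map ofReal)ᵀ = g.map ofReal := by
    change gᵀ.map ofReal = _
    rw [hg]
  rw [hP.inner_quad this, map_ofReal_map_star]

theorem eq_map_re_add {ι : Type*} (Q : Matrix ι ι ℂ) :
    Q = (Q.map re).map ofReal + I • (Q.map im).map ofReal := by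
  ext a b
  simp [mul_comm I, re_add_im]

theorem two_I_im_eq (z : ℂ) : (2 * z.im : ℂ) * I = z - star z := by
  apply Complex.ext <;> simp; ring

theorem im_inner_eq_zero_of_symm {u : V} {A : Module.End ℂ V}
    (hA : inner ℂ (A u) u = inner ℂ u (A u)) : (inner ℂ u (A u)).im = 0 := by
  rw [← inner_conj_symm, ← conj_eq_iff_im, inner_conj_symm, inner_conj_symm]
  exact hA

/-- The quantization of Im Q is symmetric, hence its expectation is real and i times it has no real
part. -/
theorem IsCCR.re_inner_quad (hP : IsCCR h P) {Q : Matrix (Fin n ⊕ Fin n) (Fin n ⊕ Fin n) ℂ}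
    (hQ : Qᵀ = Q) (u : V) :
    (inner ℂ u (quad P Q u)).re = (inner ℂ u (quad P ((Q.map re).map ofReal) u)).re := by
  have hI : (Q.map im)ᵀ = Q.map im := by
    change Qᵀ.map im = _
    rw [hQ]
  conv_lhs => rw [eq_map_re_add Q]
  rw [quad_add, quad_smul, LinearMap.add_apply, LinearMap.smul_apply, inner_add_right,
    inner_smul_right, add_re, I_mul_re,
    im_inner_eq_zero_of_symm (A := quad P ((Q.map im).map ofReal)) (hP.inner_quad_real hI u u)]
  simp

/-- The imaginary part of `Q` enters only through a commutator with the quantization of `g`. By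
`quad_quad` this commutator is the infinitesimal transport of `g` by `K`, as in the Gramian
equation. -/
theorem IsCCR.re_inner_quad_quad (hP : IsCCR h P)
    {Q : Matrix (Fin n ⊕ Fin n) (Fin n ⊕ Fin n) ℂ} (hQ : Qᵀ = Q)
    {g K : Matrix (Fin n ⊕ Fin n) (Fin n ⊕ Fin n) ℝ} (hg : gᵀ = g)
    (hK : K = (-(2 * h)) • (symJ n ℝ * Q.map im)) (u : V) :
    2 * (inner ℂ (quad P Q u) (quad P (g.map ofReal) u)).re =
      2 * (inner ℂ (quad P ((Q.map re).map ofReal) u) (quad P (g.map ofReal) u)).re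
        + (inner ℂ u (quad P ((Kᵀ * g + g * K).map ofReal) u)).re := by
  have hI : (Q.map im)ᵀ = Q.map im := by
    change Qᵀ.map im = _
    rw [hQ]
  have hIc : ((Q.map im).map ofReal)ᵀ = (Q.map im).map ofReal := by
    change ((Q.map im)ᵀ).map ofReal = _
    rw [hI]
  have hKT : Kᵀ = (2 * h) • (Q.map im * symJ n ℝ) := by
    rw [hK, transpose_smul, transpose_mul, hI, symJ_transpose]
    simp
  have hmat : (Kᵀ * g + g * K).map ofReal = (2 * h : ℂ) •
      ((Q.map im).map ofReal * symJ n ℂ * g.map ofReal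
        - g.map ofReal * symJ n ℂ * (Q.map im).map ofReal) := by
    have hmul : ∀ X Y : Matrix (Fin n ⊕ Fin n) (Fin n ⊕ Fin n) ℝ, (X * Y).map ofReal =
        X.map ofReal * Y.map ofReal := fun X Y => Matrix.map_mul (f := ofRealHom)
    rw [hKT, hK, ← symJ_map, ← hmul, ← hmul, ← hmul, ← hmul]
    ext a b
    simp [Matrix.mul_assoc]
    ring
  conv_lhs => rw [eq_map_re_add Q]
  rw [quad_add, quad_smul, LinearMap.add_apply, LinearMap.smul_apply, inner_add_left,
    inner_smul_left, add_re, mul_add]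
  congr 1
  set C := quad P ((Q.map im).map ofReal) with hC
  set z := inner ℂ (C u) (quad P (g.map ofReal) u) with hz
  have h1 : z - star z = I * inner ℂ u (quad P ((Kᵀ * g + g * K).map ofReal) u) := by
    have e1 : z = inner ℂ u (C (quad P (g.map ofReal) u)) := hP.inner_quad_real hI _ _
    have e2 : star z = inner ℂ u (quad P (g.map ofReal) (C u)) := by
      rw [hz, ← hP.inner_quad_real hg]
      exact inner_conj_symm _ _
    rw [e2, e1, hC, hP.quad_quad hIc, hmat, inner_add_right, add_sub_cancel_left, inner_smul_right,
      quad_smul, LinearMap.smul_apply, inner_smul_right]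
    ring
  rw [← two_I_im_eq, mul_comm, mul_right_inj' I_ne_zero] at h1
  rw [← h1]
  simp

/-- The product of two nonnegative operators need not have nonnegative real part. Writing `R` as a
sum of squares of linear expressions, the failure is a double commutator, which is scalar. The
vectors `r` do not depend on `g`, so the bound can be used uniformly along the Gramian. -/
theorem IsCCR.le_re_inner_quad_quad (hP : IsCCR h P)
    {R : Matrix (Fin n ⊕ Fin n) (Fin n ⊕ Fin n) ℝ} (hR : R.PosSemidef) :
    ∃ r : Fin n ⊕ Fin n → Fin n ⊕ Fin n → ℝ,
    ∀ g : Matrix (Fin n ⊕ Fin n) (Fin n ⊕ Fin n) ℝ, g.PosSemidef → ∀ u : V,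
    2 * h ^ 2 * (∑ j, r j ⬝ᵥ symJ n ℝ *ᵥ (g *ᵥ (symJ n ℝ *ᵥ r j))) * ‖u‖ ^ 2 ≤
      2 * (inner ℂ (quad P (R.map ofReal) u) (quad P (g.map ofReal) u)).re := by
  obtain ⟨B, rfl⟩ := hR.exists_eq_conjTranspose_mul_self
  refine ⟨B, fun g hg u => ?_⟩
  have hgc : (g.map ofReal)ᵀ = g.map ofReal := by
    have : gᵀ = g := hg.isHermitian
    change gᵀ.map ofReal = _
    rw [this]
  have hsum : quad P ((Bᴴ * B).map ofReal) u =
      ∑ j, lin P (fun a => (B j a : ℂ)) (lin P (fun a => (B j a : ℂ)) u) := by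
    simp only [quad_apply, lin_apply, Matrix.mul_apply, map_apply, map_sum, map_smul,
      conjTranspose_apply, star_trivial, ofReal_sum, ofReal_mul, Finset.sum_smul, Finset.smul_sum,
      smul_smul]
    rw [Finset.sum_congr rfl fun a _ => Finset.sum_comm, Finset.sum_comm]
    refine Finset.sum_congr rfl fun j _ => Finset.sum_comm.trans ?_
    exact Finset.sum_congr rfl fun a _ => Finset.sum_congr rfl fun b _ => by rw [mul_comm]
  have key : ∀ r : Fin n ⊕ Fin n → ℝ,
      h ^ 2 * (r ⬝ᵥ symJ n ℝ *ᵥ (g *ᵥ (symJ n ℝ *ᵥ r))) * ‖u‖ ^ 2 ≤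
      (inner ℂ (lin P (fun a => (r a : ℂ)) (lin P (fun a => (r a : ℂ)) u))
        (quad P (g.map ofReal) u)).re := by
    intro r
    set L := lin P (fun a => (r a : ℂ)) with hL
    set s := g *ᵥ (symJ n ℝ *ᵥ r) with hs
    set M := lin P (fun a => (s a : ℂ)) with hM
    have hLs : ∀ v v', inner ℂ (L v) v' = inner ℂ v (L v') := by
      intro v v'
      rw [hL, hP.inner_lin]
      congr 3
      ext a; simp
    have hMs : ∀ v v', inner ℂ (M v) v' = inner ℂ v (M v') := by
      intro v v'
      rw [hM, hP.inner_lin]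
      congr 3
      ext a; simp
    have hcast : ∀ (A : Matrix (Fin n ⊕ Fin n) (Fin n ⊕ Fin n) ℝ) (y : Fin n ⊕ Fin n → ℝ),
        (A.map ofReal *ᵥ fun a => (y a : ℂ)) = fun a => ((A *ᵥ y) a : ℂ) := by
      intro A y
      ext a
      simp [mulVec, dotProduct]
    have hquad : L (quad P (g.map ofReal) u) =
        quad P (g.map ofReal) (L u) - (2 * I * h) • M u := by
      rw [hL, hP.quad_lin hgc, ← symJ_map, hcast, hcast]
      abel
    have hcomm : L (M u) = M (L u) + (I * h * (r ⬝ᵥ symJ n ℝ *ᵥ s : ℝ)) • u := by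
      rw [hL, hM, hP.lin_lin, ← symJ_map, hcast]
      congr 2
      simp [dotProduct]
    -- The imaginary part of ⟨Lu, Mu⟩ is half the scalar commutator of `L` and `M`.
    have him : 2 * (inner ℂ (L u) (M u)).im = h * (r ⬝ᵥ symJ n ℝ *ᵥ s) * ‖u‖ ^ 2 := by
      have h1 := two_I_im_eq (inner ℂ (L u) (M u))
      have e2 : star (inner ℂ (L u) (M u)) = inner ℂ u (M (L u)) := by
        rw [← hMs]
        exact inner_conj_symm _ _
      have e1 : inner ℂ (L u) (M u) = inner ℂ u (M (L u)) +
          I * h * (r ⬝ᵥ symJ n ℝ *ᵥ s : ℝ) * (‖u‖ : ℂ) ^ 2 := by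
        rw [hLs, hcomm, inner_add_right, inner_smul_right, inner_self_eq_norm_sq_to_K]
        rfl
      rw [e2, sub_eq_of_eq_add' e1, mul_comm, mul_assoc I, mul_assoc I, mul_right_inj' I_ne_zero]
        at h1
      apply ofReal_injective
      push_cast
      exact h1
    rw [hLs, hquad, inner_sub_right, inner_smul_right, sub_re]
    have e3 : (2 * I * h * inner ℂ (L u) (M u)).re = -(2 * h * (inner ℂ (L u) (M u)).im) := by
      simp
    have hp := hP.re_inner_quad_nonneg hg (L u)
    have h5 : 2 * h * (inner ℂ (L u) (M u)).im = h ^ 2 * (r ⬝ᵥ symJ n ℝ *ᵥ s) * ‖u‖ ^ 2 := by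
      rw [mul_comm 2 h, mul_assoc, him]
      ring
    rw [e3, h5]
    linarith
  rw [hsum, sum_inner, re_sum, mul_assoc, mul_assoc, ← mul_assoc (h ^ 2), Finset.mul_sum,
    Finset.sum_mul]
  exact mul_le_mul_of_nonneg_left (Finset.sum_le_sum fun j _ => key (B j)) zero_le_two

/-- `u` solves `u' = -A u`. -/
def IsFlow (A : Module.End ℂ V) (u : ℝ → V) : Prop :=
  ∀ (L : Module.End ℂ V) (t : ℝ), HasDerivAt (fun s => L (u s)) (-L (A (u t))) t

theorem IsFlow.map {A : Module.End ℂ V} {u : ℝ → V} (hu : IsFlow A u) {B : Module.End ℂ V}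
    (hB : ∀ v, B (A v) = A (B v)) : IsFlow A fun t => B (u t) := by
  intro L t
  have := hu (L * B) t
  simpa [Module.End.mul_apply, hB] using this

theorem IsFlow.hasDerivAt_norm_sq {A : Module.End ℂ V} {u : ℝ → V} (hu : IsFlow A u) (s : ℝ) :
    HasDerivAt (fun s => ‖u s‖ ^ 2) (-(2 * (inner ℂ (u s) (A (u s))).re)) s := by
  have h1 : HasDerivAt u (-A (u s)) s := hu 1 s
  have h3 := (reCLM.hasFDerivAt).comp_hasDerivAt s (h1.inner ℂ h1)
  have hfun : (fun s => ‖u s‖ ^ 2) = reCLM ∘ fun s => inner ℂ (u s) (u s) := by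
    funext s
    exact (inner_self_eq_norm_sq (𝕜 := ℂ) (u s)).symm
  have hval : -(2 * (inner ℂ (u s) (A (u s))).re) =
      reCLM (inner ℂ (u s) (-A (u s)) + inner ℂ (-A (u s)) (u s)) := by
    have : (inner ℂ (A (u s)) (u s)).re = (inner ℂ (u s) (A (u s))).re := by
      rw [← inner_conj_symm, conj_re]
    rw [inner_neg_left, inner_neg_right, reCLM_apply, add_re, neg_re, neg_re, this]
    ring
  rw [hfun, hval]
  exact h3

theorem IsFlow.norm_le {A : Module.End ℂ V} {u : ℝ → V} (hu : IsFlow A u)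
    (hA : ∀ v, 0 ≤ (inner ℂ v (A v)).re) {t : ℝ} (ht : 0 ≤ t) : ‖u t‖ ≤ ‖u 0‖ := by
  have hanti : Antitone fun s => ‖u s‖ ^ 2 :=
    antitone_of_hasDerivAt_nonpos hu.hasDerivAt_norm_sq fun s => by simpa using hA (u s)
  exact le_of_sq_le_sq (hanti ht) (norm_nonneg _)

end Dissipation

/-! ### Smoothing by the heat flow -/

section Smoothing

variable {n : ℕ} {V : Type*} [NormedAddCommGroup V] [InnerProductSpace ℂ V]
variable {h : ℝ} {P : Fin n ⊕ Fin n → Module.End ℂ V}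

/-- The form `Q` has nonnegative real part and trivial singular space. -/
structure IsPartiallyElliptic (Q : Matrix (Fin n ⊕ Fin n) (Fin n ⊕ Fin n) ℂ) : Prop where
  symm : Qᵀ = Q
  posSemidef : (Q.map re).PosSemidef
  observable : ∀ x : Fin n ⊕ Fin n → ℝ,
    (∀ k : ℕ, (Q.map re * (symJ n ℝ * Q.map im) ^ k) *ᵥ x = 0) → x = 0

namespace IsPartiallyElliptic

variable {Q : Matrix (Fin n ⊕ Fin n) (Fin n ⊕ Fin n) ℂ}

theorem accretive (hQ : IsPartiallyElliptic Q) (hP : IsCCR h P) (v : V) :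
    0 ≤ (inner ℂ v (quad P Q v)).re := by
  rw [hP.re_inner_quad hQ.symm]
  exact hP.re_inner_quad_nonneg hQ.posSemidef v

/-- The heat flow of `quad P Q` maps into the form domain of the harmonic oscillator. -/
theorem exists_smoothing (hQ : IsPartiallyElliptic Q) (hh : h ≠ 0) (hP : IsCCR h P) :
    ∃ (g : Matrix (Fin n ⊕ Fin n) (Fin n ⊕ Fin n) ℝ) (C : ℝ), g.PosDef ∧
      ∀ u : ℝ → V, IsFlow (quad P Q) u →
        (inner ℂ (u 1) (quad P (g.map ofReal) (u 1))).re ≤ C * ‖u 0‖ ^ 2 := by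
  set R := Q.map re with hR
  -- This scaling of J Im Q makes the transport term of the Gramian cancel the commutator with Im Q;
  -- nonzero scaling does not affect observability.
  set K : Matrix (Fin n ⊕ Fin n) (Fin n ⊕ Fin n) ℝ := (-(2 * h)) • (symJ n ℝ * Q.map im) with hK
  obtain ⟨g, hg0, hgd, hgs, hg1⟩ := exists_gramian (K := K) hQ.posSemidef (fun x hx =>
    hQ.observable x fun k => by
      have := hx k
      rw [hK, smul_pow, Matrix.mul_smul, smul_mulVec] at this
      exact (smul_eq_zero.mp this).resolve_left (pow_ne_zero _ (by simpa using hh)))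
  obtain ⟨r, hr⟩ := hP.le_re_inner_quad_quad (V := V) hQ.posSemidef
  have hgc : ∀ a b, Continuous fun s => g s a b := fun a b =>
    continuous_iff_continuousAt.mpr fun t => (hgd t a b).continuousAt
  set c : ℝ → ℝ := fun t => 2 * h ^ 2 * ∑ j, r j ⬝ᵥ symJ n ℝ *ᵥ (g t *ᵥ (symJ n ℝ *ᵥ r j))
    with hc
  have hcc : Continuous c := by
    have : Continuous g := continuous_matrix fun a b => hgc a b
    fun_prop
  obtain ⟨M, hM⟩ := (isCompact_Icc (a := (0 : ℝ)) (b := 1)).exists_bound_of_continuousOn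
    hcc.continuousOn
  refine ⟨g 1, M + 1 / 2, hg1, fun u hu => ?_⟩
  have hM0 : 0 ≤ M := (norm_nonneg _).trans (hM 0 (by simp))
  -- A Lyapunov function: the Gramian energy starts at 0 and its growth contains ⟨u, Ru⟩, which the
  -- decay of ½‖u‖² cancels exactly. The term linear in t pays for the scalar defect `c`.
  set φ : ℝ → ℝ := fun t => (inner ℂ (u t) (quad P ((g t).map ofReal) (u t))).re
    + 1 / 2 * ‖u t‖ ^ 2 - M * ‖u 0‖ ^ 2 * t with hφ
  have hquadd : ∀ t, HasDerivAt (fun s => quad P ((g s).map ofReal) (u s))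
      (quad P ((R + (Kᵀ * g t + g t * K)).map ofReal) (u t)
        - quad P ((g t).map ofReal) (quad P Q (u t))) t := by
    intro t
    have h1 : HasDerivAt (fun s => ∑ a, ∑ b, (g s a b : ℂ) • (P a * P b) (u s))
        (∑ a, ∑ b, ((g t a b : ℂ) • -(P a * P b) (quad P Q (u t)) +
          ((R + (Kᵀ * g t + g t * K)) a b : ℂ) • (P a * P b) (u t))) t :=
      HasDerivAt.fun_sum fun a _ => HasDerivAt.fun_sum fun b _ =>
        (hgd t a b).ofReal_comp.smul (hu (P a * P b) t)
    convert h1 using 1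
    · funext s
      simp [quad_apply, -Fintype.sum_sum_type]
    · simp only [quad_apply, Finset.sum_add_distrib, smul_neg, Finset.sum_neg_distrib,
        Module.End.mul_apply, map_apply]
      abel
  have hφd : ∀ t, HasDerivAt φ ((inner ℂ (u t) (quad P ((R + (Kᵀ * g t + g t * K)).map ofReal) (u t)
        - quad P ((g t).map ofReal) (quad P Q (u t)))
        + inner ℂ (-quad P Q (u t)) (quad P ((g t).map ofReal) (u t))).re
        + 1 / 2 * (-(2 * (inner ℂ (u t) (quad P Q (u t))).re)) - M * ‖u 0‖ ^ 2) t := by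
    intro t
    have h1 := reCLM.hasFDerivAt.comp_hasDerivAt t
      ((show HasDerivAt u (-quad P Q (u t)) t from hu 1 t).inner ℂ (hquadd t))
    have h3 := ((hasDerivAt_id t).const_mul (M * ‖u 0‖ ^ 2))
    rw [mul_one] at h3
    exact (h1.add ((hu.hasDerivAt_norm_sq t).const_mul (1 / 2))).sub h3
  have hnonpos : ∀ t ∈ Set.Icc (0 : ℝ) 1,
      (inner ℂ (u t) (quad P ((R + (Kᵀ * g t + g t * K)).map ofReal) (u t)
        - quad P ((g t).map ofReal) (quad P Q (u t)))
        + inner ℂ (-quad P Q (u t)) (quad P ((g t).map ofReal) (u t))).re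
        + 1 / 2 * (-(2 * (inner ℂ (u t) (quad P Q (u t))).re)) - M * ‖u 0‖ ^ 2 ≤ 0 := by
    intro t ht
    have hgsymm : (g t)ᵀ = g t := (hgs t ht.1).isHermitian
    have h1 := hP.re_inner_quad_quad hQ.symm hgsymm hK (u t)
    have h2 := hr (g t) (hgs t ht.1) (u t)
    have h3 := hP.re_inner_quad hQ.symm (u t)
    have h4 : -M ≤ c t := (abs_le.mp (hM t ht)).1
    have h5 := hu.norm_le (hQ.accretive hP) ht.1
    have h6 : ‖u t‖ ^ 2 ≤ ‖u 0‖ ^ 2 := by gcongr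
    have h7 : inner ℂ (u t) (quad P ((g t).map ofReal) (quad P Q (u t))) =
        star (inner ℂ (quad P Q (u t)) (quad P ((g t).map ofReal) (u t))) := by
      rw [← hP.inner_quad_real hgsymm]
      exact (inner_conj_symm _ _).symm
    have h8 : quad P ((R + (Kᵀ * g t + g t * K)).map ofReal) (u t) =
        quad P (R.map ofReal) (u t) + quad P ((Kᵀ * g t + g t * K).map ofReal) (u t) := by
      rw [← LinearMap.add_apply, ← quad_add]
      congr 2
      ext a b
      simp
    have h9 : (star (inner ℂ (quad P Q (u t)) (quad P ((g t).map ofReal) (u t)))).re =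
        (inner ℂ (quad P Q (u t)) (quad P ((g t).map ofReal) (u t))).re :=
      conj_re _
    have h10 : -(M * ‖u 0‖ ^ 2) ≤ c t * ‖u t‖ ^ 2 := by
      nlinarith [sq_nonneg ‖u t‖]
    have h11 : c t * ‖u t‖ ^ 2 ≤ 2 * (inner ℂ (quad P (R.map ofReal) (u t))
      (quad P ((g t).map ofReal) (u t))).re := h2
    rw [inner_sub_right, inner_neg_left, h7, h8, inner_add_right]
    simp only [add_re, sub_re, neg_re, h9]
    rw [h3]
    linarith
  have hanti : AntitoneOn φ (Set.Icc 0 1) := by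
    refine antitoneOn_of_deriv_nonpos (convex_Icc 0 1)
      (fun t _ => (hφd t).continuousAt.continuousWithinAt)
      (fun t _ => (hφd t).differentiableAt.differentiableWithinAt) fun t ht => ?_
    rw [interior_Icc] at ht
    rw [(hφd t).deriv]
    exact hnonpos t (Set.Ioo_subset_Icc_self ht)
  have h01 := hanti (Set.left_mem_Icc.mpr zero_le_one) (Set.right_mem_Icc.mpr zero_le_one)
    zero_le_one
  have hg0' : quad P ((g 0).map ofReal) (u 0) = 0 := by
    rw [hg0, quad_apply]
    simp
  simp only [hφ] at h01
  rw [hg0', inner_zero_right] at h01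
  simp only [zero_re] at h01
  have := sq_nonneg ‖u 1‖
  linarith

/-- Comparison of the heat flow at time one with the scalar evolution. -/
theorem norm_flow_sub_le (hQ : IsPartiallyElliptic Q) (hP : IsCCR h P) (ζ : ℂ) {u : ℝ → V}
    (hu : IsFlow (quad P Q) u) :
    ‖exp ζ • u 1 - u 0‖ ≤ Real.exp |ζ.re| * ‖quad P Q (u 0) - ζ • u 0‖ := by
  set A := quad P Q
  -- The defect (A − ζ)u solves the same equation, because A − ζ commutes with A, so accretivity
  -- bounds it by its initial value.
  have hz : IsFlow A fun t => (A - ζ • (1 : Module.End ℂ V)) (u t) :=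
    hu.map fun v => by simp
  have hd : ∀ t : ℝ, HasDerivAt (fun s : ℝ => exp (ζ * s) • u s)
      (-(exp (ζ * t) • (A - ζ • (1 : Module.End ℂ V)) (u t))) t := by
    intro t
    have h1 : HasDerivAt (fun s : ℝ => exp (ζ * s)) (exp (ζ * t) * ζ) t := by
      have := ((hasDerivAt_id (t : ℂ)).const_mul ζ).cexp.comp_ofReal
      simpa using this
    have h2 := h1.smul (show HasDerivAt u (-A (u t)) t from hu 1 t)
    have h3 : -(exp (ζ * t) • (A - ζ • (1 : Module.End ℂ V)) (u t)) =
        exp (ζ * t) • -A (u t) + (exp (ζ * t) * ζ) • u t := by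
      simp only [LinearMap.sub_apply, LinearMap.smul_apply, Module.End.one_apply]
      module
    rw [h3]
    exact h2
  have hbound : ∀ t ∈ Set.Icc (0 : ℝ) 1,
      ‖-(exp (ζ * t) • (A - ζ • (1 : Module.End ℂ V)) (u t))‖ ≤
        Real.exp |ζ.re| * ‖A (u 0) - ζ • u 0‖ := by
    intro t ht
    rw [norm_neg, norm_smul, norm_exp]
    have h1 : ‖(A - ζ • (1 : Module.End ℂ V)) (u t)‖ ≤ ‖A (u 0) - ζ • u 0‖ :=
      hz.norm_le (hQ.accretive hP) ht.1
    refine mul_le_mul (Real.exp_le_exp.mpr ?_) h1 (norm_nonneg _) (Real.exp_nonneg _)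
    rw [re_mul_ofReal]
    calc ζ.re * t ≤ |ζ.re| * t := by gcongr; exacts [ht.1, le_abs_self _]
      _ ≤ |ζ.re| * 1 := by gcongr; exact ht.2
      _ = |ζ.re| := mul_one _
  have := (convex_Icc (0 : ℝ) 1).norm_image_sub_le_of_norm_hasDerivWithin_le
    (fun t _ => (hd t).hasDerivWithinAt) hbound (Set.left_mem_Icc.mpr zero_le_one)
    (Set.right_mem_Icc.mpr zero_le_one)
  simpa using this

end IsPartiallyElliptic

end Smoothing

/-- Compare the two forms on the compact unit sphere and rescale. This replaces the Gramian energy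
by the oscillator energy, up to a constant. -/
theorem exists_smul_sub_posSemidef {ι : Type*} [Fintype ι] {g Q : Matrix ι ι ℝ}
    (hg : g.PosDef) (hQ : Q.IsHermitian) : ∃ C : ℝ, (C • g - Q).PosSemidef := by
  have hcont : ∀ A : Matrix ι ι ℝ, Continuous fun x : ι → ℝ => x ⬝ᵥ A *ᵥ x := fun A => by
    fun_prop
  obtain ⟨M, hM⟩ := (isCompact_sphere (0 : ι → ℝ) 1).exists_bound_of_continuousOn
    ((hcont Q).continuousOn)
  have hex : ∃ m : ℝ, 0 < m ∧ ∀ x ∈ Metric.sphere (0 : ι → ℝ) 1, m ≤ x ⬝ᵥ g *ᵥ x := by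
    rcases (Metric.sphere (0 : ι → ℝ) 1).eq_empty_or_nonempty with he | hne
    · exact ⟨1, one_pos, by simp [he]⟩
    · obtain ⟨x₀, hx₀, hmin⟩ := (isCompact_sphere (0 : ι → ℝ) 1).exists_isMinOn hne
        (hcont g).continuousOn
      have hx₀' : x₀ ≠ 0 := by
        rintro rfl
        simp at hx₀
      exact ⟨_, by simpa using hg.dotProduct_mulVec_pos hx₀', fun x hx => hmin hx⟩
  obtain ⟨m, hm, hmg⟩ := hex
  refine ⟨|M| / m, Matrix.PosSemidef.of_dotProduct_mulVec_nonneg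
    ((hg.isHermitian.smul (by simp [IsSelfAdjoint])).sub hQ) fun x => ?_⟩
  rw [star_trivial, sub_mulVec, smul_mulVec, dotProduct_sub, dotProduct_smul, smul_eq_mul]
  by_cases hx : x = 0
  · simp [hx]
  have hnx : ‖x‖ ≠ 0 := by simpa using hx
  have hy : ‖x‖⁻¹ • x ∈ Metric.sphere (0 : ι → ℝ) 1 := by
    simp [norm_smul, hnx]
  have hscale : ∀ A : Matrix ι ι ℝ, x ⬝ᵥ A *ᵥ x =
      ‖x‖ ^ 2 * ((‖x‖⁻¹ • x) ⬝ᵥ A *ᵥ (‖x‖⁻¹ • x)) := by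
    intro A
    rw [mulVec_smul, smul_dotProduct, dotProduct_smul, smul_eq_mul, smul_eq_mul]
    field_simp
  rw [hscale g, hscale Q, mul_left_comm, ← mul_sub]
  refine mul_nonneg (sq_nonneg _) ?_
  have h1 := hmg _ hy
  have h2 := (le_abs_self _).trans (hM _ hy)
  have h3 : |M| ≤ |M| / m * ((‖x‖⁻¹ • x) ⬝ᵥ g *ᵥ (‖x‖⁻¹ • x)) := by
    rw [div_mul_eq_mul_div, le_div_iff₀ hm]
    gcongr
  linarith [le_abs_self M]

/-! ### Compactness and the lower bound for the resolvent -/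

section LowerBound

variable {n : ℕ} {H : Type*} [NormedAddCommGroup H] [InnerProductSpace ℂ H] {V : Submodule ℂ H}
variable {h : ℝ} {P : Fin n ⊕ Fin n → Module.End ℂ V}

/-- Sets of bounded oscillator energy are totally bounded. -/
theorem totallyBounded_energy (hh : 0 < h) (hP : IsCCR h P) {Γ : Matrix (Fin n) (Fin n) ℂ}
    (hsymm : Γᵀ = Γ) (hpos : (Γ.map im).PosDef) {u : V} (hu : IsVacuum P Γ u)
    {g : Matrix (Fin n ⊕ Fin n) (Fin n ⊕ Fin n) ℝ} (hg : g.PosDef) (C : ℝ) :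
    TotallyBounded {f : H | ∃ w ∈ polySpanTop P u, (w : H) = f ∧ ‖w‖ ≤ 1 ∧
      (inner ℂ w (quad P (g.map ofReal) w)).re ≤ C} := by
  obtain ⟨Q₀, hQ₀, hΓ⟩ := exists_harmonic hh hsymm hpos
  obtain ⟨D, hD⟩ := exists_smul_sub_posSemidef hg hQ₀.isHermitian
  have hbound : ∀ w : V, (inner ℂ w (quad P (g.map ofReal) w)).re ≤ C →
      (inner ℂ w (quad P (Q₀.map ofReal) w)).re ≤ |D| * |C| := by
    intro w hw
    have h1 := hP.re_inner_quad_nonneg hD w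
    have e : (D • g - Q₀).map ofReal = (D : ℂ) • g.map ofReal - Q₀.map ofReal := by
      ext a b; simp
    have h2 := hP.re_inner_quad_nonneg hg.posSemidef w
    rw [e, quad_sub, quad_smul, LinearMap.sub_apply, LinearMap.smul_apply, inner_sub_right,
      inner_smul_right, sub_re, re_ofReal_mul] at h1
    have h3 : D * (inner ℂ w (quad P (g.map ofReal) w)).re ≤ |D| * |C| :=
      mul_le_mul (le_abs_self D) (hw.trans (le_abs_self C)) h2 (abs_nonneg D)
    linarith
  rw [Metric.totallyBounded_iff]
  intro ε hε
  -- This degree makes the truncation error of `exists_approx` smaller than ε/2; the truncations lie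
  -- in a finite-dimensional unit ball.
  obtain ⟨m, hm⟩ := exists_nat_gt (|D| * |C| / (ε / 2) ^ 2)
  have hcpt : IsCompact ((fun v : polySpan P u m => ((v : V) : H)) '' Metric.closedBall 0 1) := by
    have : ProperSpace (polySpan P u m) := FiniteDimensional.proper ℂ _
    exact (isCompact_closedBall _ _).image (by fun_prop)
  obtain ⟨t, htf, ht⟩ := Metric.totallyBounded_iff.mp hcpt.totallyBounded (ε / 2) (by positivity)
  refine ⟨t, htf, ?_⟩
  rintro f ⟨w, hw, rfl, hw1, hwC⟩
  obtain ⟨w', hw', hn', hd⟩ := hΓ.exists_approx hh.ne' hQ₀ hP hu m hw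
  have hmem : (w' : H) ∈ (fun v : polySpan P u m => ((v : V) : H)) '' Metric.closedBall 0 1 :=
    ⟨⟨w', hw'⟩, by simpa using hn'.trans hw1, rfl⟩
  obtain ⟨y, hy, hyw⟩ := Set.mem_iUnion₂.mp (ht hmem)
  refine Set.mem_iUnion₂.mpr ⟨y, hy, ?_⟩
  rw [Metric.mem_ball] at hyw ⊢
  have hsmall : dist (w : H) (w' : H) < ε / 2 := by
    rw [dist_eq_norm]
    change ‖w - w'‖ < ε / 2
    refine lt_of_pow_lt_pow_left₀ 2 (by positivity) ?_
    have h1 := hd.trans (hbound w hwC)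
    rw [div_lt_iff₀ (by positivity)] at hm
    by_contra hcon
    push Not at hcon
    have : (m : ℝ) * (ε / 2) ^ 2 ≤ (m + 1) * ‖w - w'‖ ^ 2 := by
      have := sq_nonneg (ε / 2)
      nlinarith
    linarith
  calc dist (w : H) y ≤ dist (w : H) (w' : H) + dist (w' : H) y := dist_triangle _ _ _
    _ < ε / 2 + ε / 2 := add_lt_add hsmall hyw
    _ = ε := by ring

open Filter Topology in
-- Otherwise there are unit vectors with (A − ζ)w → 0. For them w is close to e^ζ times the heat
-- flow at time one, which stays in a relatively compact set, so a subsequence converges to a unit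
-- vector. That limit is orthogonal to the range of the formal adjoint minus ζ̄ on `D`, hence to
-- `D`, which is a contradiction.
theorem exists_lower_bound [CompleteSpace H] (hh : 0 < h) (hP : IsCCR h P)
    {Q : Matrix (Fin n ⊕ Fin n) (Fin n ⊕ Fin n) ℂ} (hQ : IsPartiallyElliptic Q)
    {Γ N : Matrix (Fin n) (Fin n) ℂ} (hΓ : IsPolarization Q Γ N) {u₀ : V}
    (hu₀ : IsVacuum P Γ u₀) {D : Submodule ℂ V}
    (hD : ∀ f : H, (∀ e ∈ D, inner ℂ (e : H) f = 0) → f = 0) {ζ : ℂ}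
    (hsurj : ∀ e ∈ D, ∃ e' ∈ D, quad P (Q.map star) e' - star ζ • e' = e) :
    ∃ c > 0, ∀ w ∈ polySpanTop P u₀, c * ‖w‖ ≤ ‖quad P Q w - ζ • w‖ := by
  by_contra! hcon
  have hseq : ∀ k : ℕ, ∃ w ∈ polySpanTop P u₀, ‖w‖ = 1 ∧ ‖quad P Q w - ζ • w‖ < 1 / (k + 1) := by
    intro k
    obtain ⟨w, hw, hwk⟩ := hcon (1 / (k + 1)) (by positivity)
    have hw0 : w ≠ 0 := by
      rintro rfl
      simp at hwk
    have hn : ‖w‖ ≠ 0 := by simpa using hw0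
    have : ‖((‖w‖⁻¹ : ℝ) : ℂ)‖ = ‖w‖⁻¹ := by simp
    refine ⟨((‖w‖⁻¹ : ℝ) : ℂ) • w, Submodule.smul_mem _ _ hw, ?_, ?_⟩
    · rw [norm_smul, this, inv_mul_cancel₀ hn]
    rw [map_smul, smul_comm ζ, ← smul_sub, norm_smul]
    rw [this, inv_mul_lt_iff₀ (by positivity)]
    linarith
  choose w hwE hw1 hwk using hseq
  obtain ⟨g, C, hg, hC⟩ := hQ.exists_smoothing hh.ne' hP
  -- The flow is run inside the finite-dimensional space `polySpan P u₀ m` containing `w k`.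
  have hflow : ∀ k, ∃ y ∈ polySpanTop P u₀, ‖y‖ ≤ 1 ∧
      (inner ℂ y (quad P (g.map ofReal) y)).re ≤ C ∧
      ‖exp ζ • y - w k‖ ≤ Real.exp |ζ.re| * (1 / (k + 1)) := by
    intro k
    obtain ⟨m, hm⟩ := mem_polySpanTop.mp (hwE k)
    obtain ⟨u, hu0, hum, hu⟩ := exists_linear_flow (quad P Q) (polySpan P u₀ m)
      (fun v hv => quad_mem_polySpan hP hΓ.symm_form (hΓ.quad_vacuum hP hu₀) hv) hm
    refine ⟨u 1, mem_polySpanTop.mpr ⟨m, hum 1⟩, ?_, ?_, ?_⟩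
    · have := IsFlow.norm_le hu (hQ.accretive hP) zero_le_one
      rwa [hu0, hw1] at this
    · have := hC u hu
      rwa [hu0, hw1, one_pow, mul_one] at this
    · have := hQ.norm_flow_sub_le hP ζ hu
      rw [hu0] at this
      exact this.trans (by gcongr; exact (hwk k).le)
  choose y hyE hy1 hyC hyw using hflow
  have hcpt := (totallyBounded_energy hh hP hΓ.symm hΓ.posDef hu₀ hg C).closure.isCompact_of_isClosed
    isClosed_closure
  obtain ⟨f, -, φ, hφ, hf⟩ := hcpt.tendsto_subseq (x := fun k => (y k : H))
    fun k => subset_closure ⟨y k, hyE k, rfl, hy1 k, hyC k⟩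
  have hk0 : Tendsto (fun k : ℕ => 1 / ((φ k : ℝ) + 1)) atTop (𝓝 0) :=
    tendsto_one_div_add_atTop_nhds_zero_nat.comp hφ.tendsto_atTop
  have hwf : Tendsto (fun k => (w (φ k) : H)) atTop (𝓝 (exp ζ • f)) := by
    have h1 : Tendsto (fun k => exp ζ • (y (φ k) : H) - (w (φ k) : H)) atTop (𝓝 0) := by
      have h3 := hk0.const_mul (Real.exp |ζ.re|)
      rw [mul_zero] at h3
      exact squeeze_zero_norm (fun k => hyw (φ k)) h3
    have h2 := (hf.const_smul (exp ζ)).sub h1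
    simpa using h2
  have hnorm : ‖exp ζ • f‖ = 1 := by
    refine tendsto_nhds_unique hwf.norm ?_
    have : (fun k => ‖(w (φ k) : H)‖) = fun _ => 1 := by
      funext k
      exact hw1 (φ k)
    rw [this]
    exact tendsto_const_nhds
  -- Write e as (A* − ζ̄)e' and move the operator onto the sequence, where the defect tends to 0.
  have hzero : exp ζ • f = 0 := by
    refine hD _ fun e he => ?_
    obtain ⟨e', he', rfl⟩ := hsurj e he
    have h1 : Tendsto (fun k => inner ℂ ((quad P (Q.map star) e' - star ζ • e' : V) : H)
        (w (φ k) : H)) atTop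
        (𝓝 (inner ℂ ((quad P (Q.map star) e' - star ζ • e' : V) : H) (exp ζ • f))) :=
      tendsto_const_nhds.inner hwf
    refine tendsto_nhds_unique h1 ?_
    have hQ' : (Q.map star)ᵀ = Q.map star := by
      change Qᵀ.map star = _
      rw [hQ.symm]
    have hQQ : (Q.map star).map star = Q := by
      ext a b; simp
    have h2 : ∀ k, inner ℂ ((quad P (Q.map star) e' - star ζ • e' : V) : H) (w (φ k) : H) =
        inner ℂ e' (quad P Q (w (φ k)) - ζ • w (φ k)) := by
      intro k
      change inner ℂ (quad P (Q.map star) e' - star ζ • e') (w (φ k)) = _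
      rw [inner_sub_left, inner_sub_right, inner_smul_left, inner_smul_right, hP.inner_quad hQ', hQQ]
      simp
    have h3 := hk0.const_mul ‖e'‖
    rw [mul_zero] at h3
    refine squeeze_zero_norm (fun k => ?_) h3
    rw [h2]
    exact (norm_inner_le_norm _ _).trans
      (mul_le_mul_of_nonneg_left (hwk (φ k)).le (norm_nonneg _))
  rw [hzero] at hnorm
  simp at hnorm

end LowerBound

/-! ### Resolvents and Riesz projections of unbounded operators -/

section Resolvent

variable {H : Type*} [NormedAddCommGroup H] [InnerProductSpace ℂ H] {T : H →ₗ.[ℂ] H}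

theorem mem_eigenspace_iff {z : ℂ} {u : H} : u ∈ eigenspace T z ↔ (u, z • u) ∈ T.graph := by
  rw [LinearPMap.mem_graph_iff]
  constructor
  · rintro ⟨hu, h⟩
    exact ⟨⟨u, hu⟩, rfl, h⟩
  · rintro ⟨⟨y, hy⟩, rfl, h⟩
    exact ⟨hy, h⟩

theorem IsResolvent.mem_graph {z : ℂ} {R : H →L[ℂ] H} (hR : IsResolvent T z R) (f : H) :
    (R f, z • R f - f) ∈ T.graph := by
  obtain ⟨hv, h⟩ := hR.1 f
  rw [LinearPMap.mem_graph_iff]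
  exact ⟨⟨R f, hv⟩, rfl, by rw [eq_sub_iff_add_eq, ← eq_sub_iff_add_eq']; exact h.symm⟩

theorem IsResolvent.apply_of_mem_graph {z : ℂ} {R : H →L[ℂ] H} (hR : IsResolvent T z R) {u f : H}
    (hu : (u, f) ∈ T.graph) : R (z • u - f) = u := by
  rw [LinearPMap.mem_graph_iff] at hu
  obtain ⟨y, rfl, rfl⟩ := hu
  exact hR.2 y

theorem isResolvent_iff_graph {z : ℂ} {R : H →L[ℂ] H} : IsResolvent T z R ↔
    (∀ f, (R f, z • R f - f) ∈ T.graph) ∧ ∀ u f, (u, f) ∈ T.graph → R (z • u - f) = u := by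
  refine ⟨fun hR => ⟨hR.mem_graph, fun u f => hR.apply_of_mem_graph⟩, fun h => ⟨fun f => ?_, fun u =>
    h.2 _ _ (T.mem_graph u)⟩⟩
  obtain ⟨y, hy, hy'⟩ := T.mem_graph_iff.mp (h.1 f)
  have hRf : R f ∈ T.domain := by
    have := y.2
    rwa [hy] at this
  refine ⟨hRf, ?_⟩
  have : (⟨R f, hRf⟩ : T.domain) = y := Subtype.ext hy.symm
  rw [this, hy', sub_sub_cancel]

theorem isResolvent_resolvent {z : ℂ} (hz : z ∉ spec T) : IsResolvent T z (resolvent T z) := by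
  have h : ∃ R : H →L[ℂ] H, IsResolvent T z R := by simpa [spec] using hz
  rw [resolvent, dif_pos h]
  exact h.choose_spec

theorem IsResolvent.sub_eq {z w : ℂ} {R S : H →L[ℂ] H} (hR : IsResolvent T z R)
    (hS : IsResolvent T w S) (f : H) : S f - R f = (z - w) • R (S f) := by
  have := hR.apply_of_mem_graph (hS.mem_graph f)
  rw [← map_smul, ← this, ← map_sub, this]
  congr 1
  rw [sub_smul]
  abel

/-- The resolvent identity bounds the difference by ‖S‖ itself; the smallness assumption first gives
‖S‖ ≤ 2‖R‖. Continuity of the resolvent on the contour follows. -/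
theorem IsResolvent.norm_sub_le {z w : ℂ} {R S : H →L[ℂ] H} (hR : IsResolvent T z R)
    (hS : IsResolvent T w S) (hzw : ‖z - w‖ * ‖R‖ ≤ 1 / 2) :
    ‖S - R‖ ≤ 2 * ‖R‖ ^ 2 * ‖z - w‖ := by
  have h1 : ‖S - R‖ ≤ ‖z - w‖ * (‖R‖ * ‖S‖) := by
    have : S - R = (z - w) • (R ∘L S) := by
      ext f
      exact hR.sub_eq hS f
    rw [this, norm_smul]
    gcongr
    exact ContinuousLinearMap.opNorm_comp_le _ _
  have h2 : ‖S‖ ≤ ‖R‖ + ‖S - R‖ := by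
    have := norm_add_le R (S - R)
    rwa [add_sub_cancel] at this
  have h3 : ‖S‖ ≤ 2 * ‖R‖ := by nlinarith [norm_nonneg S]
  calc ‖S - R‖ ≤ ‖z - w‖ * (‖R‖ * ‖S‖) := h1
    _ ≤ ‖z - w‖ * (‖R‖ * (2 * ‖R‖)) := by gcongr
    _ = _ := by ring

open Filter Topology in
theorem continuousOn_resolvent {s : Set ℂ} (hs : ∀ z ∈ s, z ∉ spec T) :
    ContinuousOn (resolvent T) s := by
  intro z hz
  rw [ContinuousWithinAt, tendsto_iff_norm_sub_tendsto_zero]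
  set R := resolvent T z
  have hsub : Tendsto (fun w => ‖z - w‖) (𝓝[s] z) (𝓝 0) := by
    have : Continuous fun w : ℂ => ‖z - w‖ := by fun_prop
    simpa using (this.tendsto z).mono_left nhdsWithin_le_nhds
  have h1 := hsub.mul_const ‖R‖
  have h2 := hsub.const_mul (2 * ‖R‖ ^ 2)
  rw [zero_mul] at h1
  rw [mul_zero] at h2
  refine squeeze_zero' (Eventually.of_forall fun _ => norm_nonneg _) ?_ h2
  filter_upwards [h1.eventually_le_const (show (0 : ℝ) < 1 / 2 by norm_num), self_mem_nhdsWithin]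
    with w hw hws
  exact (isResolvent_resolvent (hs z hz)).norm_sub_le (isResolvent_resolvent (hs w hws)) hw

theorem notMem_spec_of_mem_sphere {z : ℂ} {r : ℝ} (hr : IsIsolatingRadius T z r) {w : ℂ}
    (hw : w ∈ Metric.closedBall z r) (hwz : w ≠ z) : w ∉ spec T := by
  intro hs
  have : w ∈ spec T ∩ Metric.closedBall z r := ⟨hs, hw⟩
  rw [hr.2] at this
  exact hwz this

theorem ne_center_of_mem_sphere {z : ℂ} {r : ℝ} (hr : 0 < r) {w : ℂ}
    (hw : w ∈ Metric.sphere z r) : w ≠ z := by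
  rintro rfl
  rw [mem_sphere_iff_norm, sub_self, norm_zero] at hw
  exact hr.ne hw

theorem circleIntegrable_resolvent {z : ℂ} {r : ℝ} (hr : IsIsolatingRadius T z r) :
    CircleIntegrable (resolvent T) z r :=
  (continuousOn_resolvent fun _ hw => notMem_spec_of_mem_sphere hr (Metric.sphere_subset_closedBall hw)
    (ne_center_of_mem_sphere hr.1 hw)).circleIntegrable hr.1.le

variable [CompleteSpace H]

theorem map_circleIntegral {E F : Type*} [NormedAddCommGroup E] [NormedSpace ℂ E] [CompleteSpace E]
    [NormedAddCommGroup F] [NormedSpace ℂ F] [CompleteSpace F] (L : E →L[ℂ] F) {f : ℂ → E} {c : ℂ}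
    {r : ℝ} (hf : CircleIntegrable f c r) : L (∮ z in C(c, r), f z) = ∮ z in C(c, r), L (f z) := by
  rw [circleIntegral, circleIntegral, ← L.intervalIntegral_comp_comm hf.out]
  simp only [map_smul]

theorem map_rieszProjection {G : Type*} [NormedAddCommGroup G] [NormedSpace ℂ G] [CompleteSpace G]
    {z : ℂ} {r : ℝ} (hr : IsIsolatingRadius T z r) (L : H →L[ℂ] G) (f : H) :
    L (rieszProjection T z r f) =
      (2 * Real.pi * I : ℂ)⁻¹ • ∮ w in C(z, r), L (resolvent T w f) := by
  rw [rieszProjection, _root_.smul_apply, map_smul]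
  congr 1
  exact map_circleIntegral (L ∘L ContinuousLinearMap.apply ℂ H f) (circleIntegrable_resolvent hr)

/-- The residue of a simple pole. It applies where the resolvent is known explicitly: on
eigenvectors, and when paired with eigenvectors of the adjoint. -/
theorem map_rieszProjection_eq {G : Type*} [NormedAddCommGroup G] [NormedSpace ℂ G]
    [CompleteSpace G] {z : ℂ} {r : ℝ} (hr : IsIsolatingRadius T z r) (L : H →L[ℂ] G) (f : H) (y : G)
    (hy : ∀ w ∉ spec T, w ≠ z → L (resolvent T w f) = (w - z)⁻¹ • y) :
    L (rieszProjection T z r f) = y := by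
  rw [map_rieszProjection hr, circleIntegral.integral_congr hr.1.le
    (g := fun w => (w - z)⁻¹ • y), circleIntegral.integral_smul_const,
    circleIntegral.integral_sub_center_inv _ hr.1.ne', inv_smul_smul₀ Complex.two_pi_I_ne_zero]
  intro w hw
  have := ne_center_of_mem_sphere hr.1 hw
  exact hy w (notMem_spec_of_mem_sphere hr (Metric.sphere_subset_closedBall hw) this) this

theorem rieszProjection_of_mem_eigenspace {z : ℂ} {r : ℝ} (hr : IsIsolatingRadius T z r) {u : H}
    (hu : u ∈ eigenspace T z) : rieszProjection T z r u = u := by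
  refine map_rieszProjection_eq hr (ContinuousLinearMap.id ℂ H) u u fun w hw hwz => ?_
  have := (isResolvent_resolvent hw).apply_of_mem_graph (mem_eigenspace_iff.mp hu)
  rw [← sub_smul, map_smul] at this
  rw [ContinuousLinearMap.id_apply, eq_inv_smul_iff₀ (sub_ne_zero.mpr hwz)]
  exact this

theorem inner_rieszProjection {z : ℂ} {r : ℝ} (hr : IsIsolatingRadius T z r) {v : H}
    (hv : ∀ u f, (u, f) ∈ T.graph → inner ℂ v f = z * inner ℂ v u) (f : H) :
    inner ℂ v (rieszProjection T z r f) = inner ℂ v f := by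
  refine map_rieszProjection_eq hr (innerSL ℂ v) f _ fun w hw hwz => ?_
  have := hv _ _ ((isResolvent_resolvent hw).mem_graph f)
  rw [inner_sub_right, inner_smul_right] at this
  rw [innerSL_apply_apply, eq_inv_smul_iff₀ (sub_ne_zero.mpr hwz), smul_eq_mul, sub_mul, ← this]
  ring

theorem mem_eigenspace_adjoint_iff (hT : Dense (T.domain : Set H)) {z : ℂ} {v : H} :
    v ∈ eigenspace T.adjoint (star z) ↔
      ∀ u f, (u, f) ∈ T.graph → inner ℂ v f = z * inner ℂ v u := by
  have key : (∀ x : T.domain, inner ℂ (star z • v) (x : H) = inner ℂ v (T x)) ↔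
      ∀ u f, (u, f) ∈ T.graph → inner ℂ v f = z * inner ℂ v u := by
    constructor
    · intro h u f huf
      obtain ⟨y, rfl, rfl⟩ := T.mem_graph_iff.mp huf
      rw [← h, inner_smul_left]
      simp
    · intro h x
      rw [h _ _ (T.mem_graph x), inner_smul_left]
      simp
  rw [← key]
  constructor
  · rintro ⟨hv, h⟩ x
    rw [← h]
    exact LinearPMap.adjoint_isFormalAdjoint hT ⟨v, hv⟩ x
  · intro h
    have hv := LinearPMap.mem_adjoint_domain_of_exists v ⟨_, h⟩
    exact ⟨hv, LinearPMap.adjoint_apply_eq hT ⟨v, hv⟩ h⟩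

theorem differentiableAt_resolvent_apply {W : Type*} [NormedAddCommGroup W] [NormedSpace ℂ W]
    [CompleteSpace W] (C : W →L[ℂ] W) {l : ℂ} (hl : l ∈ resolventSet ℂ C) (w : W) :
    DifferentiableAt ℂ (fun l => _root_.resolvent C l w) l :=
  (spectrum.hasDerivAt_resolvent_const_left hl).differentiableAt.clm_apply
    (differentiableAt_const w)

theorem smul_sub_apply_resolvent {W : Type*} [NormedAddCommGroup W] [NormedSpace ℂ W]
    (C : W →L[ℂ] W) {l : ℂ} (hl : l ∈ resolventSet ℂ C) (w : W) :
    l • _root_.resolvent C l w - C (_root_.resolvent C l w) = w := by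
  have h := congrArg (fun D : W →L[ℂ] W => D w) (Ring.mul_inverse_cancel _ hl)
  simpa [Algebra.algebraMap_eq_smul_one, _root_.resolvent] using h

/-- If `J` maps a finite-dimensional space onto an invariant space of `T` on which `T - z` is injective, then the Riesz
projection vanishes there. -/
theorem rieszProjection_eq_zero_of_invariant {z : ℂ} {r : ℝ} (hr : IsIsolatingRadius T z r)
    {W : Type*} [NormedAddCommGroup W] [NormedSpace ℂ W] [FiniteDimensional ℂ W] (J : W →L[ℂ] H)
    (hJ : Function.Injective J) (B : Module.End ℂ W) (hB : ∀ w, (J w, J (B w)) ∈ T.graph)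
    (hz : ∀ w, B w = z • w → w = 0) (w : W) : rieszProjection T z r (J w) = 0 := by
  have : CompleteSpace W := FiniteDimensional.complete ℂ W
  set C : W →L[ℂ] W := LinearMap.toContinuousLinearMap B
  -- Off the centre injectivity comes from the resolvent of `T`, at the centre from `hz`; finite
  -- dimension gives invertibility on the whole disc, so Cauchy's theorem applies.
  have hunit : ∀ l ∈ Metric.closedBall z r, l ∈ resolventSet ℂ C := by
    intro l hl
    rw [spectrum.mem_resolventSet_iff, ContinuousLinearMap.isUnit_iff_bijective]
    have hinj : Function.Injective (algebraMap ℂ (W →L[ℂ] W) l - C) := by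
      rw [injective_iff_map_eq_zero]
      intro x hx
      have hx' : B x = l • x := by
        have : l • x - B x = 0 := by
          simpa [Algebra.algebraMap_eq_smul_one, C] using hx
        exact (sub_eq_zero.mp this).symm
      by_cases hlz : l = z
      · exact hz x (hlz ▸ hx')
      · have h1 := (isResolvent_resolvent (notMem_spec_of_mem_sphere hr hl hlz)).apply_of_mem_graph
          (hB x)
        rw [hx', map_smul, sub_self, map_zero] at h1
        exact hJ (by rw [← h1, map_zero])
    exact ⟨hinj, LinearMap.surjective_of_injective
      (f := ((algebraMap ℂ (W →L[ℂ] W) l - C : W →L[ℂ] W) : W →ₗ[ℂ] W)) hinj⟩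
  have hd : ∀ l ∈ Metric.closedBall z r,
      DifferentiableAt ℂ (fun l => J (_root_.resolvent C l w)) l := by
    intro l hl
    exact J.differentiableAt.comp l (differentiableAt_resolvent_apply C (hunit l hl) w)
  have hcauchy := circleIntegral_eq_zero_of_differentiable_on_off_countable hr.1.le
    Set.countable_empty (fun l hl => (hd l hl).continuousAt.continuousWithinAt)
    (fun l hl => hd l (Metric.ball_subset_closedBall hl.1))
  have h2 := map_rieszProjection hr (ContinuousLinearMap.id ℂ H) (J w)
  rw [ContinuousLinearMap.id_apply] at h2
  rw [h2, circleIntegral.integral_congr hr.1.le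
    (g := fun l => J (_root_.resolvent C l w)), hcauchy, smul_zero]
  intro l hl
  have hl' := Metric.sphere_subset_closedBall hl
  set x := _root_.resolvent C l w with hx
  have hxe : l • x - B x = w := by
    exact smul_sub_apply_resolvent C (hunit l hl') w
  have h5 := (isResolvent_resolvent (notMem_spec_of_mem_sphere hr hl'
    (ne_center_of_mem_sphere hr.1 hl))).apply_of_mem_graph (hB x)
  rw [← map_smul, ← map_sub, hxe] at h5
  exact h5

end Resolvent

/-! ### From a gap on a finite-dimensional exhaustion to a rank-one spectral projection -/

section SpectralGap

variable {H : Type*} [NormedAddCommGroup H] [InnerProductSpace ℂ H] {V : Submodule ℂ H}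

/-- The operator `A` leaves invariant an exhaustion `E` of a dense subspace by finite-dimensional
spaces, on which `μ` is a simple eigenvalue with eigenvector `u` and all other eigenvalues have real
part at least `Re μ + γ`. -/
structure SpectralGap (A : Module.End ℂ V) (E : ℕ → Submodule ℂ V) (u : V) (μ : ℂ) (γ : ℝ) :
    Prop where
  mono : Monotone E
  finite : ∀ m, FiniteDimensional ℂ (E m)
  apply_mem : ∀ {m w}, w ∈ E m → A w ∈ E m
  mem : ∀ m, u ∈ E m
  ne_zero : u ≠ 0
  eigen : A u = μ • u
  pos : 0 < γ
  gap : ∀ {m w}, w ∈ E m → ∀ ζ : ℂ, A w - ζ • w ∈ Submodule.span ℂ {u} →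
    w ∈ Submodule.span ℂ {u} ∨ μ.re + γ ≤ ζ.re
  dense : ∀ f : H, (∀ m, ∀ e ∈ E m, inner ℂ (e : H) f = 0) → f = 0

namespace SpectralGap

variable {A : Module.End ℂ V} {E : ℕ → Submodule ℂ V} {u : V} {μ : ℂ} {γ : ℝ}

theorem mem_span_of_mem_span (G : SpectralGap A E u μ γ) {m : ℕ} {w : V} (hw : w ∈ E m)
    (h : A w - μ • w ∈ Submodule.span ℂ {u}) : w ∈ Submodule.span ℂ {u} := by
  rcases G.gap hw μ h with h | h
  · exact h
  · linarith [G.pos]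

theorem apply_span (G : SpectralGap A E u μ γ) {w : V} (hw : w ∈ Submodule.span ℂ {u}) :
    A w = μ • w := by
  obtain ⟨c, rfl⟩ := Submodule.mem_span_singleton.mp hw
  rw [map_smul, G.eigen, smul_comm]

theorem eq_zero_of_apply_eq (G : SpectralGap A E u μ γ) {ζ : ℂ} (hζ : ζ ≠ μ)
    (hre : ζ.re < μ.re + γ) {m : ℕ} {w : V} (hw : w ∈ E m) (h : A w - ζ • w = 0) : w = 0 := by
  rcases G.gap hw ζ (h ▸ Submodule.zero_mem _) with h1 | h1
  · rw [G.apply_span h1, ← sub_smul] at h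
    exact (smul_eq_zero.mp h).resolve_left (sub_ne_zero.mpr hζ.symm)
  · exact absurd h1 (not_le.mpr hre)

theorem sub_smul_mem (G : SpectralGap A E u μ γ) (ζ : ℂ) {m : ℕ} {w : V} (hw : w ∈ E m) :
    (A - ζ • 1) w ∈ E m :=
  Submodule.sub_mem _ (G.apply_mem hw) (Submodule.smul_mem _ _ hw)

theorem exists_apply_sub_eq (G : SpectralGap A E u μ γ) {ζ : ℂ} (hζ : ζ ≠ μ)
    (hre : ζ.re < μ.re + γ) {m : ℕ} {w : V} (hw : w ∈ E m) : ∃ w' ∈ E m, A w' - ζ • w' = w := by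
  have := G.finite m
  set B : Module.End ℂ (E m) := (A - ζ • 1).restrict fun w hw => G.sub_smul_mem ζ hw
  have hinj : Function.Injective B := by
    rw [injective_iff_map_eq_zero]
    intro x hx
    exact Subtype.ext (G.eq_zero_of_apply_eq hζ hre x.2 (congrArg Subtype.val hx))
  obtain ⟨x, hx⟩ := LinearMap.surjective_of_injective hinj ⟨w, hw⟩
  exact ⟨x, x.2, congrArg Subtype.val hx⟩

/-- The gap hypothesis, applied with ζ = μ, excludes Jordan blocks at μ: kernel and range of A − μ
on `E m` meet trivially, and rank-nullity makes them complementary. -/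
theorem exists_add_eq (G : SpectralGap A E u μ γ) {m : ℕ} {w : V} (hw : w ∈ E m) :
    ∃ c : ℂ, ∃ g ∈ E m, c • u + (A g - μ • g) = w := by
  have := G.finite m
  set B : Module.End ℂ (E m) := (A - μ • 1).restrict fun w hw => G.sub_smul_mem μ hw
  set S : Submodule ℂ (E m) := Submodule.span ℂ {⟨u, G.mem m⟩} with hS
  have hmemS : ∀ x : E m, x ∈ S ↔ (x : V) ∈ Submodule.span ℂ {u} := by
    intro x
    simp only [hS, Submodule.mem_span_singleton, Subtype.ext_iff]
    rfl
  have hker : LinearMap.ker B = S := by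
    ext x
    rw [hmemS, LinearMap.mem_ker]
    constructor
    · intro hx
      have hx' : A x - μ • (x : V) = 0 := congrArg Subtype.val hx
      exact G.mem_span_of_mem_span x.2 (hx' ▸ Submodule.zero_mem _)
    · intro hx
      refine Subtype.ext ?_
      change A x - μ • (x : V) = 0
      rw [G.apply_span hx, sub_self]
  have hdisj : Disjoint (LinearMap.ker B) (LinearMap.range B) := by
    rw [Submodule.disjoint_def]
    rintro _ hx ⟨y, rfl⟩
    rw [hker, hmemS] at hx
    have hy : y ∈ LinearMap.ker B := by
      rw [hker, hmemS]
      exact G.mem_span_of_mem_span y.2 hx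
    exact hy
  have htop : LinearMap.ker B ⊔ LinearMap.range B = ⊤ := by
    refine Submodule.eq_top_of_finrank_eq ?_
    have h1 := Submodule.finrank_sup_add_finrank_inf_eq (LinearMap.ker B) (LinearMap.range B)
    have h2 := LinearMap.finrank_range_add_finrank_ker B
    rw [hdisj.eq_bot, finrank_bot] at h1
    omega
  have hmem : (⟨w, hw⟩ : E m) ∈ LinearMap.ker B ⊔ LinearMap.range B := htop ▸ Submodule.mem_top
  obtain ⟨x, hx, _, ⟨g, rfl⟩, hxy⟩ := Submodule.mem_sup.mp hmem
  rw [hker, hmemS] at hx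
  obtain ⟨c, hc⟩ := Submodule.mem_span_singleton.mp hx
  refine ⟨c, g, g.2, ?_⟩
  rw [hc]
  exact congrArg Subtype.val hxy

theorem dense_iSup (G : SpectralGap A E u μ γ) [CompleteSpace H] :
    DenseRange (V.subtype ∘ₗ (⨆ m, E m).subtype) := by
  change Dense (LinearMap.range (V.subtype ∘ₗ (⨆ m, E m).subtype) : Set H)
  rw [Submodule.dense_iff_topologicalClosure_eq_top, Submodule.topologicalClosure_eq_top_iff,
    Submodule.eq_bot_iff]
  intro f hf
  refine G.dense f fun m e he => ?_
  rw [Submodule.mem_orthogonal] at hf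
  exact hf _ ⟨⟨e, Submodule.mem_iSup_of_mem m he⟩, rfl⟩

variable {T : H →ₗ.[ℂ] H} {A' : Module.End ℂ V} {E' : ℕ → Submodule ℂ V} {v : V}

/-- `T` is a closed extension of `A`, contained in the adjoint of `A'`, and both operators have
a spectral gap at a simple ground state. -/
structure _root_.QuadraticWeyl.GroundStatePair (T : H →ₗ.[ℂ] H) (A A' : Module.End ℂ V)
    (E E' : ℕ → Submodule ℂ V) (u v : V) (μ : ℂ) (γ : ℝ) : Prop where
  left : SpectralGap A E u μ γ
  right : SpectralGap A' E' v (star μ) γ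
  closed : T.IsClosed
  dense : Dense (T.domain : Set H)
  mem_graph : ∀ w : V, ((w : H), (A w : H)) ∈ T.graph
  pairing : ∀ {f g : H}, (f, g) ∈ T.graph → ∀ e : V, inner ℂ (e : H) g = inner ℂ (A' e : H) f
  bound : ∀ ζ ≠ μ, ζ.re < μ.re + γ → ∃ c > 0, ∀ m, ∀ w ∈ E m, c * ‖w‖ ≤ ‖A w - ζ • w‖

end SpectralGap

namespace GroundStatePair

variable {T : H →ₗ.[ℂ] H} {A A' : Module.End ℂ V} {E E' : ℕ → Submodule ℂ V} {u v : V}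
  {μ : ℂ} {γ : ℝ} [CompleteSpace H]

/-- On the core ζ − A is bijective, since it is injective on each finite-dimensional piece. The
lower bound extends its inverse to `H`, and closedness keeps the extension in the graph of `T`. It
is also a left inverse because the kernel of T − ζ is orthogonal to the dense range of A' − ζ̄. -/
theorem exists_isResolvent (G : GroundStatePair T A A' E E' u v μ γ) {ζ : ℂ} (hζ : ζ ≠ μ)
    (hre : ζ.re < μ.re + γ) : ∃ R : H →L[ℂ] H, IsResolvent T ζ R := by
  set D := ⨆ m, E m
  have hD : ∀ {w}, w ∈ D → ∃ m, w ∈ E m := fun {w} hw => by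
    rwa [Submodule.mem_iSup_of_directed _ G.left.mono.directed_le] at hw
  obtain ⟨c, hc, hbound⟩ := G.bound ζ hζ hre
  set f : D →ₗ[ℂ] H := V.subtype ∘ₗ D.subtype with hf
  set e : D →ₗ[ℂ] H := V.subtype ∘ₗ (ζ • 1 - A) ∘ₗ D.subtype with he
  have hnorm : ∀ x, ‖f x‖ ≤ c⁻¹ * ‖e x‖ := by
    intro x
    obtain ⟨m, hm⟩ := hD x.2
    have h1 := hbound m x hm
    rw [← div_eq_inv_mul, le_div_iff₀ hc, mul_comm]
    refine h1.trans_eq ?_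
    rw [norm_sub_rev]
    rfl
  have hedense : DenseRange e := by
    refine G.left.dense_iSup.mono ?_
    rintro _ ⟨x, rfl⟩
    obtain ⟨m, hm⟩ := hD x.2
    obtain ⟨w, hw, hwx⟩ := G.left.exists_apply_sub_eq hζ hre hm
    refine ⟨⟨-w, Submodule.mem_iSup_of_mem m (Submodule.neg_mem _ hw)⟩, ?_⟩
    have : (ζ • 1 - A) (-w) = (x : V) := by
      rw [← hwx, map_neg]
      exact neg_sub _ _
    change ((((ζ • 1 - A) (-w) : V)) : H) = _
    rw [this]
    rfl
  set R := f.extendOfNorm e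
  have hR : ∀ x, R (e x) = f x := LinearMap.extendOfNorm_eq hedense ⟨_, hnorm⟩
  have hgraph : ∀ g, (R g, ζ • R g - g) ∈ T.graph := by
    intro g
    refine hedense.induction_on (p := fun g => (R g, ζ • R g - g) ∈ T.graph) g ?_ ?_
    · exact G.closed.preimage (f := fun g => (R g, ζ • R g - g)) (by fun_prop)
    · intro x
      rw [hR]
      have : ζ • f x - e x = (A x : H) := by
        change ((ζ • (x : V) - (ζ • (x : V) - A x) : V) : H) = _
        rw [sub_sub_cancel]
      rw [this]
      exact G.mem_graph _
  refine ⟨R, isResolvent_iff_graph.mpr ⟨hgraph, fun x g hx => ?_⟩⟩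
  -- The failure of the left inverse is an eigenvector of `T` at ζ; `pairing` makes it orthogonal to
  -- the core of the adjoint.
  have hz : (R (ζ • x - g) - x, ζ • (R (ζ • x - g) - x)) ∈ T.graph := by
    have := T.graph.sub_mem (hgraph (ζ • x - g)) hx
    rw [Prod.mk_sub_mk] at this
    convert this using 2
    rw [smul_sub]
    abel
  rw [← sub_eq_zero]
  refine G.right.dense _ fun m e he => ?_
  have hζ' : star ζ ≠ star μ := star_injective.ne hζ
  obtain ⟨e', -, rfl⟩ := G.right.exists_apply_sub_eq hζ' (by simpa using hre) he
  have h1 := G.pairing hz e'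
  rw [Submodule.coe_sub, Submodule.coe_smul, inner_sub_left, ← h1, inner_smul_left,
    inner_smul_right]
  simp

omit [CompleteSpace H] in
theorem mem_eigenspace (G : GroundStatePair T A A' E E' u v μ γ) : (u : H) ∈ eigenspace T μ := by
  rw [mem_eigenspace_iff]
  have := G.mem_graph u
  rwa [G.left.eigen] at this

/-- Half the gap keeps the disc inside the half plane where the lower bound is available. -/
theorem exists_isIsolatingRadius (G : GroundStatePair T A A' E E' u v μ γ) :
    ∃ r, IsIsolatingRadius T μ r := by
  have hγ := G.left.pos
  refine ⟨γ / 2, by positivity, ?_⟩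
  ext ζ
  simp only [Set.mem_inter_iff, Set.mem_singleton_iff]
  constructor
  · rintro ⟨hs, hb⟩
    by_contra hne
    refine hs (G.exists_isResolvent hne ?_)
    rw [mem_closedBall_iff_norm] at hb
    have := (le_abs_self _).trans (Complex.abs_re_le_norm (ζ - μ))
    rw [sub_re] at this
    linarith
  · rintro rfl
    refine ⟨?_, Metric.mem_closedBall_self (by positivity)⟩
    rintro ⟨R, hR⟩
    have := hR.apply_of_mem_graph (mem_eigenspace_iff.mp G.mem_eigenspace)
    rw [sub_self, map_zero] at this
    exact G.left.ne_zero (Subtype.ext this.symm)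

variable {r : ℝ}

theorem rieszProjection_self (G : GroundStatePair T A A' E E' u v μ γ)
    (hr : IsIsolatingRadius T μ r) : rieszProjection T μ r u = u :=
  rieszProjection_of_mem_eigenspace hr G.mem_eigenspace

/-- The range of A − μ on `E m` is invariant, and A − μ is injective on it by simplicity, so the
contour integral vanishes there. -/
theorem rieszProjection_apply_sub (G : GroundStatePair T A A' E E' u v μ γ)
    (hr : IsIsolatingRadius T μ r) {m : ℕ} {g : V} (hg : g ∈ E m) :
    rieszProjection T μ r ((A g - μ • g : V) : H) = 0 := by
  have := G.left.finite m
  set W := (E m).map (A - μ • 1) with hW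
  have hWE : ∀ w ∈ W, w ∈ E m := by
    rintro _ ⟨w, hw, rfl⟩
    exact G.left.sub_smul_mem μ hw
  have hAW : ∀ w ∈ W, A w ∈ W := by
    rintro _ ⟨w, hw, rfl⟩
    refine ⟨A w, G.left.apply_mem hw, ?_⟩
    simp
  refine rieszProjection_eq_zero_of_invariant hr (V.subtypeL ∘L W.subtypeL)
    (Subtype.val_injective.comp Subtype.val_injective) (A.restrict hAW)
    (fun w => G.mem_graph w) ?_ ⟨A g - μ • g, ⟨g, hg, rfl⟩⟩
  rintro ⟨_, ⟨g', hg', rfl⟩⟩ hx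
  have h1 : A ((A - μ • 1) g') = μ • (A - μ • 1) g' := congrArg Subtype.val hx
  have h2 : (A - μ • 1) g' ∈ Submodule.span ℂ {u} := by
    refine G.left.mem_span_of_mem_span (G.left.sub_smul_mem μ hg') ?_
    rw [h1, sub_self]
    exact Submodule.zero_mem _
  have h3 := G.left.apply_span (G.left.mem_span_of_mem_span hg' h2)
  refine Subtype.ext ?_
  change A g' - μ • g' = 0
  rw [h3, sub_self]

theorem rieszProjection_mem_span (G : GroundStatePair T A A' E E' u v μ γ)
    (hr : IsIsolatingRadius T μ r) (f : H) :
    rieszProjection T μ r f ∈ Submodule.span ℂ {(u : H)} := by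
  refine G.left.dense_iSup.induction_on
    (p := fun f => rieszProjection T μ r f ∈ Submodule.span ℂ {(u : H)}) f ?_ ?_
  · exact (Submodule.closed_of_finiteDimensional (Submodule.span ℂ {(u : H)})).preimage
      (rieszProjection T μ r).continuous
  · rintro ⟨w, hw⟩
    rw [Submodule.mem_iSup_of_directed _ G.left.mono.directed_le] at hw
    obtain ⟨m, hm⟩ := hw
    obtain ⟨c, g, hg, rfl⟩ := G.left.exists_add_eq hm
    change rieszProjection T μ r ((c • u + (A g - μ • g) : V) : H) ∈ _
    rw [Submodule.coe_add, map_add, G.rieszProjection_apply_sub hr hg, add_zero, Submodule.coe_smul,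
      map_smul, G.rieszProjection_self hr]
    exact Submodule.smul_mem _ _ (Submodule.mem_span_singleton_self _)

omit [CompleteSpace H] in
theorem right_pairing (G : GroundStatePair T A A' E E' u v μ γ) :
    ∀ f g, (f, g) ∈ T.graph → inner ℂ (v : H) g = μ * inner ℂ (v : H) f := by
  intro f g hfg
  rw [G.pairing hfg, G.right.eigen, Submodule.coe_smul, inner_smul_left]
  simp

/-- Pairing with `v` is unchanged by the projection, whose range is the line through `u`. If u ⊥ v,
then ⟨v, v⟩ = ⟨v, Πv⟩ = 0. -/
theorem inner_ne_zero (G : GroundStatePair T A A' E E' u v μ γ) (hr : IsIsolatingRadius T μ r) :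
    inner ℂ (v : H) (u : H) ≠ 0 := by
  intro h
  refine G.right.ne_zero (Subtype.ext (inner_self_eq_zero (𝕜 := ℂ).mp ?_))
  rw [← inner_rieszProjection hr G.right_pairing]
  obtain ⟨c, hc⟩ := Submodule.mem_span_singleton.mp (G.rieszProjection_mem_span hr (v : H))
  rw [← hc, inner_smul_right, h, mul_zero]

theorem rieszProjection_apply (G : GroundStatePair T A A' E E' u v μ γ)
    (hr : IsIsolatingRadius T μ r) (f : H) :
    rieszProjection T μ r f = (inner ℂ (v : H) f / inner ℂ (v : H) (u : H)) • (u : H) := by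
  obtain ⟨c, hc⟩ := Submodule.mem_span_singleton.mp (G.rieszProjection_mem_span hr f)
  have := inner_rieszProjection hr G.right_pairing f
  rw [← hc, inner_smul_right] at this
  rw [← this, mul_div_cancel_right₀ _ (G.inner_ne_zero hr), hc]

theorem eigenspace_eq (G : GroundStatePair T A A' E E' u v μ γ) (hr : IsIsolatingRadius T μ r) :
    eigenspace T μ = (Submodule.span ℂ {(u : H)} : Set H) := by
  ext w
  constructor
  · intro hw
    have := G.rieszProjection_mem_span hr w
    rwa [rieszProjection_of_mem_eigenspace hr hw] at this
  · intro hw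
    obtain ⟨c, rfl⟩ := Submodule.mem_span_singleton.mp hw
    rw [mem_eigenspace_iff, smul_comm]
    exact T.graph.smul_mem c (mem_eigenspace_iff.mp G.mem_eigenspace)

/-- An adjoint eigenvector `w` satisfies ⟨w, f⟩ = ⟨w, Πf⟩, and the rank-one formula for Π expresses
this functional through ⟨v, f⟩ alone. -/
theorem eigenspace_adjoint_eq (G : GroundStatePair T A A' E E' u v μ γ)
    (hr : IsIsolatingRadius T μ r) :
    eigenspace T.adjoint (star μ) = (Submodule.span ℂ {(v : H)} : Set H) := by
  ext w
  rw [mem_eigenspace_adjoint_iff G.dense]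
  constructor
  · intro hw
    refine Submodule.mem_span_singleton.mpr
      ⟨star (inner ℂ w (u : H) / inner ℂ (v : H) (u : H)), ?_⟩
    refine ext_inner_right ℂ fun f => ?_
    have := inner_rieszProjection hr hw f
    rw [G.rieszProjection_apply hr, inner_smul_right] at this
    rw [← this, inner_smul_left]
    simp only [star_def, map_div₀, RingHomCompTriple.comp_apply, RingHom.id_apply]
    ring
  · intro hw f g hfg
    obtain ⟨c, rfl⟩ := Submodule.mem_span_singleton.mp hw
    rw [inner_smul_left, inner_smul_left, G.right_pairing f g hfg]
    ring

omit [CompleteSpace H] in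
theorem span_eq_iff (G : GroundStatePair T A A' E E' u v μ γ) :
    Submodule.span ℂ {(u : H)} = Submodule.span ℂ {(v : H)} ↔
      (v : H) ∈ Submodule.span ℂ {(u : H)} := by
  constructor
  · intro h
    exact h ▸ Submodule.mem_span_singleton_self _
  · intro h
    obtain ⟨c, hc⟩ := Submodule.mem_span_singleton.mp h
    have hc0 : c ≠ 0 := by
      rintro rfl
      rw [zero_smul] at hc
      exact G.right.ne_zero (Subtype.ext hc.symm)
    rw [← hc, Submodule.span_singleton_smul_eq (IsUnit.mk0 c hc0)]

theorem eigenspace_eq_iff (G : GroundStatePair T A A' E E' u v μ γ)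
    (hr : IsIsolatingRadius T μ r) : eigenspace T μ = eigenspace T.adjoint (star μ) ↔
      (v : H) ∈ Submodule.span ℂ {(u : H)} := by
  rw [G.eigenspace_eq hr, G.eigenspace_adjoint_eq hr, SetLike.coe_set_eq, G.span_eq_iff]

/-- The rank-one operator f ↦ ⟨v, f⟩u / ⟨v, u⟩ is self-adjoint exactly when `u` and `v` are
parallel; idempotence is automatic. -/
theorem isStarProjection_iff (G : GroundStatePair T A A' E E' u v μ γ)
    (hr : IsIsolatingRadius T μ r) : IsStarProjection (rieszProjection T μ r) ↔
      (v : H) ∈ Submodule.span ℂ {(u : H)} := by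
  have hvu := G.inner_ne_zero hr
  have huu : inner ℂ (u : H) (u : H) ≠ 0 := by
    rw [inner_self_ne_zero]
    exact fun h => G.left.ne_zero (Subtype.ext h)
  constructor
  · intro h
    have hsa := h.isSelfAdjoint
    rw [ContinuousLinearMap.isSelfAdjoint_iff_isSymmetric] at hsa
    have hsym : ∀ g, inner ℂ (u : H) g =
        inner ℂ (v : H) g / inner ℂ (v : H) (u : H) * inner ℂ (u : H) (u : H) := by
      intro g
      have h1 := hsa (u : H) g
      change inner ℂ (rieszProjection T μ r u) g = inner ℂ (u : H) (rieszProjection T μ r g) at h1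
      rwa [G.rieszProjection_self hr, G.rieszProjection_apply hr g, inner_smul_right] at h1
    refine Submodule.mem_span_singleton.mpr
      ⟨star (inner ℂ (v : H) (u : H) / inner ℂ (u : H) (u : H)), ?_⟩
    refine ext_inner_right ℂ fun g => ?_
    rw [inner_smul_left, hsym g]
    simp only [star_def, map_div₀, RingHomCompTriple.comp_apply, RingHom.id_apply]
    field_simp
  · intro h
    obtain ⟨c, hc⟩ := Submodule.mem_span_singleton.mp h
    have hc0 : (starRingEnd ℂ) c ≠ 0 := by
      intro h0
      rw [← hc, inner_smul_left, h0, zero_mul] at hvu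
      exact hvu rfl
    have happ : ∀ f, rieszProjection T μ r f =
        (inner ℂ (u : H) f / inner ℂ (u : H) (u : H)) • (u : H) := by
      intro f
      rw [G.rieszProjection_apply hr, ← hc, inner_smul_left, inner_smul_left,
        mul_div_mul_left _ _ hc0]
    refine ⟨?_, ?_⟩
    · ext f
      change rieszProjection T μ r (rieszProjection T μ r f) = rieszProjection T μ r f
      rw [happ f, map_smul, G.rieszProjection_self hr]
    · rw [ContinuousLinearMap.isSelfAdjoint_iff_isSymmetric]
      intro f g
      change inner ℂ (rieszProjection T μ r f) g = inner ℂ f (rieszProjection T μ r g)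
      rw [happ f, happ g, inner_smul_left, inner_smul_right, map_div₀, inner_conj_symm,
        inner_conj_symm]
      ring

end GroundStatePair

end SpectralGap

/-! ### Spectral subspaces of the Hamilton map and decaying orbits -/

section Flow

open Filter Topology

variable {ι : Type*} [Fintype ι] [DecidableEq ι]

/-- The sum of the generalized eigenspaces for the eigenvalues in the open upper half plane. -/
def upperSpace (F : Matrix ι ι ℂ) : Submodule ℂ (ι → ℂ) :=
  ⨆ (l : ℂ) (_ : 0 < l.im), Module.End.maxGenEigenspace (Matrix.toLin' F) l

/-- The sum of the generalized eigenspaces for the eigenvalues in the open lower half plane. -/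
def lowerSpace (F : Matrix ι ι ℂ) : Submodule ℂ (ι → ℂ) :=
  ⨆ (l : ℂ) (_ : l.im < 0), Module.End.maxGenEigenspace (Matrix.toLin' F) l

theorem mem_maxGenEigenspace_iff {F : Matrix ι ι ℂ} {l : ℂ} {v : ι → ℂ} :
    v ∈ Module.End.maxGenEigenspace (Matrix.toLin' F) l ↔ ∃ k, (F - l • 1) ^ k *ᵥ v = 0 := by
  rw [Module.End.mem_maxGenEigenspace]
  have : ∀ k, (Matrix.toLin' F - l • (1 : Module.End ℂ (ι → ℂ))) ^ k =
      Matrix.toLin' ((F - l • 1) ^ k) := by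
    intro k
    rw [Matrix.toLin'_pow, map_sub, map_smul, Matrix.toLin'_one]
    rfl
  simp only [this, Matrix.toLin'_apply]

theorem mulVec_mem_upperSpace {F : Matrix ι ι ℂ} {v : ι → ℂ} (hv : v ∈ upperSpace F) :
    F *ᵥ v ∈ upperSpace F := by
  suffices upperSpace F ≤ (upperSpace F).comap (Matrix.toLin' F) from this hv
  refine iSup₂_le fun l hl w hw => ?_
  have h1 := Module.End.mapsTo_maxGenEigenspace_of_comm (Commute.refl (Matrix.toLin' F)) l hw
  exact (le_iSup₂ (f := fun (l : ℂ) (_ : 0 < l.im) =>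
    Module.End.maxGenEigenspace (Matrix.toLin' F) l) l hl) h1

omit [DecidableEq ι] in
theorem hasDerivAt_exp_sum (a : ℕ → ι → ℂ) (K : ℕ) (t : ℝ) :
    HasDerivAt (fun s : ℝ => ∑ k ∈ Finset.range (K + 1), ((I * s) ^ k / (k.factorial : ℂ)) • a k)
      (I • ∑ k ∈ Finset.range K, ((I * t) ^ k / (k.factorial : ℂ)) • a (k + 1)) t := by
  induction K with
  | zero => simpa using hasDerivAt_const t (a 0)
  | succ K ih =>
    have h1 : HasDerivAt (fun s : ℝ => (I * s) ^ (K + 1) / ((K + 1).factorial : ℂ))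
        (I * ((I * t) ^ K / (K.factorial : ℂ))) t := by
      have h2 : HasDerivAt (fun s : ℝ => I * (s : ℂ)) I t := by
        simpa using (ofRealCLM.hasDerivAt (x := t)).const_mul I
      have h3 := (h2.pow (K + 1)).div_const ((K + 1).factorial : ℂ)
      have h4 : (K.factorial : ℂ) ≠ 0 := by exact_mod_cast K.factorial_ne_zero
      have h5 : ((K : ℂ) + 1) ≠ 0 := by exact_mod_cast K.succ_ne_zero
      have e : ((K + 1 : ℕ) : ℂ) * (I * t) ^ (K + 1 - 1) * I / ((K + 1).factorial : ℂ) =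
          I * ((I * t) ^ K / (K.factorial : ℂ)) := by
        rw [Nat.factorial_succ, Nat.add_sub_cancel]
        push_cast
        field_simp
      rw [e] at h3
      exact h3
    have h6 := ih.add (h1.smul_const (a (K + 1)))
    have e1 : (fun s : ℝ => ∑ k ∈ Finset.range (K + 1 + 1),
        ((I * s) ^ k / (k.factorial : ℂ)) • a k) = (fun s : ℝ => ∑ k ∈ Finset.range (K + 1),
        ((I * s) ^ k / (k.factorial : ℂ)) • a k) +
        fun s : ℝ => ((I * s) ^ (K + 1) / ((K + 1).factorial : ℂ)) • a (K + 1) := by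
      funext s
      rw [Finset.sum_range_succ]
      rfl
    rw [e1, Finset.sum_range_succ, smul_add, smul_smul]
    exact h6

theorem tendsto_exp_mul_pow {l : ℂ} (hl : 0 < l.im) (k : ℕ) :
    Tendsto (fun t : ℝ => exp (I * l * t) * (I * t) ^ k) atTop (𝓝 0) := by
  rw [tendsto_zero_iff_norm_tendsto_zero]
  have h1 := tendsto_rpow_mul_exp_neg_mul_atTop_nhds_zero k l.im hl
  refine h1.congr' ?_
  filter_upwards [eventually_ge_atTop 0] with t ht
  rw [norm_mul, norm_pow, norm_mul, norm_I, one_mul, Complex.norm_real, Real.norm_of_nonneg ht,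
    Complex.norm_exp, Real.rpow_natCast, mul_comm]
  congr 2
  simp

/-- Vectors in the upper spectral space decay under the flow of `I • F`. -/
theorem exists_decaying_flow {F : Matrix ι ι ℂ} {v : ι → ℂ} (hv : v ∈ upperSpace F) :
    ∃ w : ℝ → ι → ℂ, w 0 = v ∧ (∀ t, HasDerivAt w ((I • F) *ᵥ w t) t) ∧
      Tendsto w atTop (𝓝 0) := by
  rw [upperSpace, iSup_subtype'] at hv
  induction hv using Submodule.iSup_induction' with
  | zero =>
    refine ⟨fun _ => 0, rfl, fun t => ?_, tendsto_const_nhds⟩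
    rw [mulVec_zero]
    exact hasDerivAt_const t 0
  | add x y _ _ hx hy =>
    obtain ⟨w, hw0, hw, hwt⟩ := hx
    obtain ⟨w', hw0', hw', hwt'⟩ := hy
    refine ⟨fun t => w t + w' t, by simp [hw0, hw0'], fun t => ?_, by simpa using hwt.add hwt'⟩
    rw [mulVec_add]
    exact (hw t).add (hw' t)
  | mem l v hv =>
    obtain ⟨l, hl⟩ := l
    obtain ⟨K, hK⟩ := mem_maxGenEigenspace_iff.mp hv
    set a : ℕ → ι → ℂ := fun k => (F - l • 1) ^ k *ᵥ v with ha
    have haK : a (K + 1) = 0 := by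
      simp only [ha]
      rw [pow_succ', ← mulVec_mulVec, hK, mulVec_zero]
    have hFa : ∀ k, F *ᵥ a k = l • a k + a (k + 1) := by
      intro k
      simp only [ha]
      rw [pow_succ', ← mulVec_mulVec, sub_mulVec, smul_mulVec, one_mulVec]
      abel
    -- The exponential of itF on a generalized eigenvector is a scalar exponential times a finite
    -- sum. The extra vanishing term `a (K + 1)` lets the ranges match after differentiation.
    refine ⟨fun t => exp (I * l * t) • ∑ k ∈ Finset.range (K + 1),
      ((I * t) ^ k / (k.factorial : ℂ)) • a k, ?_, fun t => ?_, ?_⟩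
    · simp [Finset.sum_range_succ', ha]
    · have h1 : HasDerivAt (fun s : ℝ => exp (I * l * s)) (exp (I * l * t) * (I * l)) t := by
        have h2 : HasDerivAt (fun s : ℝ => I * l * (s : ℂ)) (I * l) t := by
          simpa using (ofRealCLM.hasDerivAt (x := t)).const_mul (I * l)
        exact h2.cexp
      have h3 := h1.smul (hasDerivAt_exp_sum a K t)
      have e : (I • F) *ᵥ (exp (I * l * t) • ∑ k ∈ Finset.range (K + 1),
          ((I * t) ^ k / (k.factorial : ℂ)) • a k) =
          exp (I * l * t) • (I • ∑ k ∈ Finset.range K,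
            ((I * t) ^ k / (k.factorial : ℂ)) • a (k + 1)) +
          (exp (I * l * t) * (I * l)) • ∑ k ∈ Finset.range (K + 1),
            ((I * t) ^ k / (k.factorial : ℂ)) • a k := by
        have e1 : F *ᵥ (∑ k ∈ Finset.range (K + 1), ((I * t) ^ k / (k.factorial : ℂ)) • a k) =
            l • (∑ k ∈ Finset.range (K + 1), ((I * t) ^ k / (k.factorial : ℂ)) • a k) +
            ∑ k ∈ Finset.range K, ((I * t) ^ k / (k.factorial : ℂ)) • a (k + 1) := by
          have e2 : ∑ k ∈ Finset.range K, ((I * t) ^ k / (k.factorial : ℂ)) • a (k + 1) =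
              ∑ k ∈ Finset.range (K + 1), ((I * t) ^ k / (k.factorial : ℂ)) • a (k + 1) := by
            rw [Finset.sum_range_succ, haK, smul_zero, add_zero]
          rw [e2, mulVec_sum, Finset.smul_sum, ← Finset.sum_add_distrib]
          refine Finset.sum_congr rfl fun k _ => ?_
          rw [mulVec_smul, hFa, smul_add, smul_comm]
        rw [smul_mulVec, mulVec_smul, e1, smul_add, smul_add, add_comm]
        simp only [smul_smul]
        congr 2 <;> ring
      rw [e]
      exact h3
    · have h4 : (fun t : ℝ => exp (I * l * t) • ∑ k ∈ Finset.range (K + 1),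
          ((I * t) ^ k / (k.factorial : ℂ)) • a k) = fun t : ℝ => ∑ k ∈ Finset.range (K + 1),
          (exp (I * l * t) * (I * t) ^ k) • ((k.factorial : ℂ)⁻¹ • a k) := by
        funext t
        rw [Finset.smul_sum]
        refine Finset.sum_congr rfl fun k _ => ?_
        rw [smul_smul, smul_smul]
        congr 1
        ring
      rw [h4]
      have h5 : Tendsto (fun t : ℝ => ∑ k ∈ Finset.range (K + 1),
          (exp (I * l * t) * (I * t) ^ k) • ((k.factorial : ℂ)⁻¹ • a k)) atTop
          (𝓝 (∑ k ∈ Finset.range (K + 1), (0 : ℂ) • ((k.factorial : ℂ)⁻¹ • a k))) :=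
        tendsto_finsetSum _ fun k _ => (tendsto_exp_mul_pow hl k).smul_const _
      simpa using h5

omit [DecidableEq ι] in
theorem hasDerivAt_dotProduct_mulVec {u w : ℝ → ι → ℂ} {u' w' : ι → ℂ} {t : ℝ} (M : Matrix ι ι ℂ)
    (hu : HasDerivAt u u' t) (hw : HasDerivAt w w' t) :
    HasDerivAt (fun s => u s ⬝ᵥ M *ᵥ w s) (u' ⬝ᵥ M *ᵥ w t + u t ⬝ᵥ M *ᵥ w') t := by
  have h1 := hasDerivAt_mulVec hw M
  rw [hasDerivAt_pi] at hu h1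
  have h2 : HasDerivAt (fun s => ∑ i, u s i * (M *ᵥ w s) i)
      (∑ i, (u' i * (M *ᵥ w t) i + u t i * (M *ᵥ w') i)) t :=
    HasDerivAt.fun_sum fun i _ => (hu i).mul (h1 i)
  rw [Finset.sum_add_distrib] at h2
  exact h2

omit [Fintype ι] [DecidableEq ι] in
theorem hasDerivAt_star {w : ℝ → ι → ℂ} {w' : ι → ℂ} {t : ℝ} (hw : HasDerivAt w w' t) :
    HasDerivAt (fun s => star (w s)) (star w') t := by
  rw [hasDerivAt_pi] at hw ⊢
  intro i
  exact (hw i).star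

omit [DecidableEq ι] in
theorem star_mulVec_eq (M : Matrix ι ι ℂ) (v : ι → ℂ) : star (M *ᵥ v) = M.map star *ᵥ star v := by
  ext i
  simp [mulVec, dotProduct]

theorem map_star_pow (M : Matrix ι ι ℂ) (k : ℕ) : (M ^ k).map star = M.map star ^ k :=
  map_pow (starRingEnd ℂ).mapMatrix M k

omit [Fintype ι] [DecidableEq ι] in
theorem map_star_map_star (M : Matrix ι ι ℂ) : (M.map star).map star = M := by
  ext a b; simp

theorem star_mem_upperSpace {F : Matrix ι ι ℂ} {v : ι → ℂ} (hv : v ∈ lowerSpace F) :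
    star v ∈ upperSpace (F.map star) := by
  rw [lowerSpace, iSup_subtype'] at hv
  induction hv using Submodule.iSup_induction' with
  | zero => rw [star_zero]; exact Submodule.zero_mem _
  | add x y _ _ hx hy => rw [star_add]; exact Submodule.add_mem _ hx hy
  | mem l v hv =>
    obtain ⟨l, hl⟩ := l
    obtain ⟨k, hk⟩ := mem_maxGenEigenspace_iff.mp hv
    refine (le_iSup₂ (f := fun (l : ℂ) (_ : 0 < l.im) =>
      Module.End.maxGenEigenspace (Matrix.toLin' (F.map star)) l) (star l) (by simpa using hl)) ?_
    rw [mem_maxGenEigenspace_iff]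
    refine ⟨k, ?_⟩
    have h1 := congrArg star hk
    rw [star_mulVec_eq, map_star_pow, star_zero] at h1
    have h2 : (F - l • 1).map star = F.map star - star l • 1 := by
      ext a b
      by_cases hab : a = b <;> simp [hab]
    rwa [h2] at h1

theorem star_mem_lowerSpace {F : Matrix ι ι ℂ} {v : ι → ℂ} (hv : v ∈ upperSpace F) :
    star v ∈ lowerSpace (F.map star) := by
  rw [upperSpace, iSup_subtype'] at hv
  induction hv using Submodule.iSup_induction' with
  | zero => rw [star_zero]; exact Submodule.zero_mem _
  | add x y _ _ hx hy => rw [star_add]; exact Submodule.add_mem _ hx hy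
  | mem l v hv =>
    obtain ⟨l, hl⟩ := l
    obtain ⟨k, hk⟩ := mem_maxGenEigenspace_iff.mp hv
    refine (le_iSup₂ (f := fun (l : ℂ) (_ : l.im < 0) =>
      Module.End.maxGenEigenspace (Matrix.toLin' (F.map star)) l) (star l) (by simpa using hl)) ?_
    rw [mem_maxGenEigenspace_iff]
    refine ⟨k, ?_⟩
    have h1 := congrArg star hk
    rw [star_mulVec_eq, map_star_pow, star_zero] at h1
    have h2 : (F - l • 1).map star = F.map star - star l • 1 := by
      ext a b
      by_cases hab : a = b <;> simp [hab]
    rwa [h2] at h1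

/-- The conjugate of Λ⁻ is the positive spectral space of the conjugate matrix. Condition (ii)
thereby compares the Lagrangians of the operator and of its formal adjoint. -/
theorem star_image_lowerSpace (F : Matrix ι ι ℂ) :
    star '' (lowerSpace F : Set (ι → ℂ)) = upperSpace (F.map star) := by
  ext v
  constructor
  · rintro ⟨w, hw, rfl⟩
    exact star_mem_upperSpace hw
  · intro hv
    have := star_mem_lowerSpace hv
    rw [map_star_map_star] at this
    exact ⟨_, this, star_star v⟩

end Flow

/-! ### Positivity and isotropy of the upper spectral space -/

section Positivity

open Filter Topology

variable {n : ℕ} {Q : Matrix (Fin n ⊕ Fin n) (Fin n ⊕ Fin n) ℂ}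

theorem symJ_map_star (n : ℕ) : (symJ n ℂ).map star = symJ n ℂ := by
  rw [← symJ_map, map_ofReal_map_star]

theorem symJ_mulVec_dotProduct (u w : Fin n ⊕ Fin n → ℂ) :
    (symJ n ℂ *ᵥ u) ⬝ᵥ symJ n ℂ *ᵥ w = u ⬝ᵥ w := by
  rw [dotProduct_mulVec, vecMul_mulVec, symJ_transpose, Matrix.neg_mul, symJ_mul_self, neg_neg,
    vecMul_one]

/-- Conjugation keeps Re Q and negates Im Q, which only changes signs in the observability
condition; the adjoint is thus covered by the same theory. -/
theorem IsPartiallyElliptic.map_star (hQ : IsPartiallyElliptic Q) :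
    IsPartiallyElliptic (Q.map star) := by
  have hre : (Q.map star).map re = Q.map re := by ext; simp
  have him : (Q.map star).map im = -Q.map im := by ext; simp
  refine ⟨?_, hre ▸ hQ.posSemidef, fun x hx => hQ.observable x fun k => ?_⟩
  · change Qᵀ.map star = _
    rw [hQ.symm]
  · have := hx k
    rw [hre, him, Matrix.mul_neg, neg_pow, ← Matrix.mul_assoc] at this
    rcases neg_one_pow_eq_or (Matrix (Fin n ⊕ Fin n) (Fin n ⊕ Fin n) ℝ) k with h | h <;>
      rw [h] at this <;> simpa [neg_mulVec] using this

theorem dotProduct_re_add (Q : Matrix (Fin n ⊕ Fin n) (Fin n ⊕ Fin n) ℂ) (v : Fin n ⊕ Fin n → ℂ) :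
    star v ⬝ᵥ Q.map star *ᵥ v + star v ⬝ᵥ Q *ᵥ v =
      2 * (star v ⬝ᵥ (Q.map re).map ofReal *ᵥ v) := by
  rw [← dotProduct_add, ← add_mulVec, ← smul_eq_mul, ← dotProduct_smul, ← smul_mulVec]
  congr 2
  ext a b
  simp only [Matrix.add_apply, Matrix.map_apply, Matrix.smul_apply, smul_eq_mul]
  rw [add_comm, star_def, Complex.add_conj]
  push_cast
  rfl

open scoped ComplexOrder in
theorem posSemidef_map_ofReal {ι : Type*} [Fintype ι] [DecidableEq ι] {R : Matrix ι ι ℝ}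
    (hR : R.PosSemidef) : (R.map ofReal).PosSemidef := by
  obtain ⟨B, rfl⟩ := hR.exists_eq_conjTranspose_mul_self
  have : (Bᴴ * B).map ofReal = (B.map ofReal)ᴴ * B.map ofReal := by
    ext a b
    simp [Matrix.mul_apply]
  rw [this]
  exact posSemidef_conjTranspose_mul_self _

/-- Inductively JQ may be replaced by i J Im Q, since Re Q kills every earlier iterate. Real
observability then applies to the real and imaginary parts of `v`. -/
theorem IsPartiallyElliptic.eq_zero_of_mulVec_pow (hQ : IsPartiallyElliptic Q)
    {v : Fin n ⊕ Fin n → ℂ}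
    (hv : ∀ k : ℕ, ((Q.map re).map ofReal * (symJ n ℂ * Q) ^ k) *ᵥ v = 0) : v = 0 := by
  set R := (Q.map re).map ofReal with hR
  set M := symJ n ℝ * Q.map im with hM
  have hMC : M.map ofReal = symJ n ℂ * (Q.map im).map ofReal := by
    rw [hM, ← symJ_map]
    exact (ofRealHom.mapMatrix.map_mul _ _)
  have key : ∀ k, (symJ n ℂ * Q) ^ k *ᵥ v = I ^ k • (M.map ofReal) ^ k *ᵥ v := by
    intro k
    induction k with
    | zero => simp
    | succ k ih =>
      have h1 := hv k
      rw [← mulVec_mulVec, ih, mulVec_smul] at h1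
      have h2 := (smul_eq_zero.mp h1).resolve_left (pow_ne_zero _ I_ne_zero)
      have hF : symJ n ℂ * Q = symJ n ℂ * R + I • M.map ofReal := by
        conv_lhs => rw [eq_map_re_add Q]
        rw [Matrix.mul_add, Matrix.mul_smul, hMC]
      rw [pow_succ', ← mulVec_mulVec, ih, mulVec_smul, hF, add_mulVec, ← mulVec_mulVec, h2,
        mulVec_zero, zero_add, smul_mulVec, smul_smul, mulVec_mulVec, ← pow_succ', ← pow_succ]
  have hreal : ∀ k, ((Q.map re * M ^ k).map ofReal) *ᵥ v = 0 := by
    intro k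
    have h1 := hv k
    rw [← mulVec_mulVec, key, mulVec_smul, mulVec_mulVec] at h1
    have h2 := (smul_eq_zero.mp h1).resolve_left (pow_ne_zero _ I_ne_zero)
    have e : (Q.map re * M ^ k).map ofReal = R * (M.map ofReal) ^ k := by
      rw [hR]
      have := (ofRealHom.mapMatrix (m := Fin n ⊕ Fin n)).map_mul (Q.map re) (M ^ k)
      rw [map_pow] at this
      exact this
    rw [e, h2]
  have hre : (fun a => (v a).re) = 0 := hQ.observable _ fun k => by
    ext a
    have := congrArg re (congrFun (hreal k) a)
    simpa [mulVec, dotProduct] using this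
  have him : (fun a => (v a).im) = 0 := hQ.observable _ fun k => by
    ext a
    have := congrArg im (congrFun (hreal k) a)
    simpa [mulVec, dotProduct] using this
  ext a
  exact Complex.ext (congrFun hre a) (congrFun him a)

theorem hamilton_dotProduct (hQ : Qᵀ = Q) (u w : Fin n ⊕ Fin n → ℂ) :
    (symJ n ℂ * Q) *ᵥ u ⬝ᵥ symJ n ℂ *ᵥ w = u ⬝ᵥ Q *ᵥ w := by
  rw [← mulVec_mulVec, symJ_mulVec_dotProduct, dotProduct_mulVec, ← mulVec_transpose, hQ]

theorem dotProduct_hamilton (u w : Fin n ⊕ Fin n → ℂ) :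
    u ⬝ᵥ symJ n ℂ *ᵥ ((symJ n ℂ * Q) *ᵥ w) = -(u ⬝ᵥ Q *ᵥ w) := by
  rw [mulVec_mulVec, ← Matrix.mul_assoc, symJ_mul_self, Matrix.neg_mul, Matrix.one_mul, neg_mulVec,
    dotProduct_neg]

theorem star_hamilton (v : Fin n ⊕ Fin n → ℂ) :
    star ((symJ n ℂ * Q) *ᵥ v) = (symJ n ℂ * Q.map star) *ᵥ star v := by
  rw [← mulVec_mulVec, star_mulVec_eq, star_mulVec_eq, symJ_map_star, mulVec_mulVec]

theorem transpose_map_star (hQ : Qᵀ = Q) : (Q.map star)ᵀ = Q.map star := by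
  change Qᵀ.map star = _
  rw [hQ]

/-- Evaluate v̄ · JFv with `F` on either side of the symplectic form; adding the two expressions
leaves Re Q. This ties the sign of Im l to the sign of the Krein form. -/
theorem sub_mul_krein_eq (hQ : Qᵀ = Q) {l : ℂ} {v : Fin n ⊕ Fin n → ℂ}
    (hv : (symJ n ℂ * Q) *ᵥ v = l • v) :
    (star l - l) * (star v ⬝ᵥ symJ n ℂ *ᵥ v) =
      2 * (star v ⬝ᵥ (Q.map re).map ofReal *ᵥ v) := by
  have h1 := hamilton_dotProduct (transpose_map_star hQ) (star v) v
  have h2 := dotProduct_hamilton (Q := Q) (star v) v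
  rw [← star_hamilton, hv, star_smul, smul_dotProduct, smul_eq_mul] at h1
  rw [hv, mulVec_smul, dotProduct_smul, smul_eq_mul] at h2
  rw [← dotProduct_re_add, ← h1, sub_mul, h2]
  ring

open scoped ComplexOrder in
theorem IsPartiallyElliptic.re_mulVec_eq_zero (hQ : IsPartiallyElliptic Q)
    {v : Fin n ⊕ Fin n → ℂ} (hv : star v ⬝ᵥ (Q.map re).map ofReal *ᵥ v = 0) :
    (Q.map re).map ofReal *ᵥ v = 0 :=
  ((posSemidef_map_ofReal hQ.posSemidef).dotProduct_mulVec_zero_iff v).mp hv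

open scoped ComplexOrder in
theorem IsPartiallyElliptic.dotProduct_re_nonneg (hQ : IsPartiallyElliptic Q)
    (v : Fin n ⊕ Fin n → ℂ) : 0 ≤ (star v ⬝ᵥ (Q.map re).map ofReal *ᵥ v).re ∧
      (star v ⬝ᵥ (Q.map re).map ofReal *ᵥ v).im = 0 := by
  have := (posSemidef_map_ofReal hQ.posSemidef).dotProduct_mulVec_nonneg v
  rw [Complex.le_def] at this
  exact ⟨this.1, this.2.symm⟩

/-- The Hamilton map has no real eigenvalues. -/
theorem IsPartiallyElliptic.im_ne_zero (hQ : IsPartiallyElliptic Q) {l : ℂ}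
    {v : Fin n ⊕ Fin n → ℂ} (hv0 : v ≠ 0) (hv : (symJ n ℂ * Q) *ᵥ v = l • v) : l.im ≠ 0 := by
  intro hl
  have hlr : star l = l := Complex.conj_eq_iff_im.mpr hl
  have h1 := sub_mul_krein_eq hQ.symm hv
  rw [hlr, sub_self, zero_mul] at h1
  have h2 := hQ.re_mulVec_eq_zero ((mul_eq_zero.mp h1.symm).resolve_left two_ne_zero)
  refine hv0 (hQ.eq_zero_of_mulVec_pow fun k => ?_)
  have h3 : (symJ n ℂ * Q) ^ k *ᵥ v = l ^ k • v := by
    induction k with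
    | zero => simp
    | succ k ih => rw [pow_succ', ← mulVec_mulVec, ih, mulVec_smul, hv, smul_smul, pow_succ]
  rw [← mulVec_mulVec, h3, mulVec_smul, h2, smul_zero]

theorem hasDerivAt_krein (hQ : Qᵀ = Q) {w : ℝ → Fin n ⊕ Fin n → ℂ} {t : ℝ}
    (hw : HasDerivAt w ((I • (symJ n ℂ * Q)) *ᵥ w t) t) :
    HasDerivAt (fun s => (star (w s) ⬝ᵥ symJ n ℂ *ᵥ w s).im)
      (-2 * (star (w t) ⬝ᵥ (Q.map re).map ofReal *ᵥ w t).re) t := by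
  have h1 := hasDerivAt_dotProduct_mulVec (symJ n ℂ) (hasDerivAt_star hw) hw
  have e : star ((I • (symJ n ℂ * Q)) *ᵥ w t) ⬝ᵥ symJ n ℂ *ᵥ w t +
      star (w t) ⬝ᵥ symJ n ℂ *ᵥ ((I • (symJ n ℂ * Q)) *ᵥ w t) =
      -(2 * I) * (star (w t) ⬝ᵥ (Q.map re).map ofReal *ᵥ w t) := by
    have hI : star I = -I := conj_I
    rw [smul_mulVec, star_smul, star_hamilton, smul_dotProduct, mulVec_smul, dotProduct_smul,
      hamilton_dotProduct (transpose_map_star hQ), dotProduct_hamilton, smul_eq_mul, smul_eq_mul,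
      hI]
    linear_combination (-I) * dotProduct_re_add Q (w t)
  rw [e] at h1
  have h2 := imCLM.hasFDerivAt.comp_hasDerivAt t h1
  have e2 : imCLM (-(2 * I) * (star (w t) ⬝ᵥ (Q.map re).map ofReal *ᵥ w t)) =
      -2 * (star (w t) ⬝ᵥ (Q.map re).map ofReal *ᵥ w t).re := by
    simp
  rw [e2] at h2
  exact h2

/-- The upper spectral space of the Hamilton map is a positive subspace. -/
theorem IsPartiallyElliptic.krein_pos (hQ : IsPartiallyElliptic Q) {v : Fin n ⊕ Fin n → ℂ}
    (hv : v ∈ upperSpace (symJ n ℂ * Q)) (hv0 : v ≠ 0) :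
    0 < (star v ⬝ᵥ symJ n ℂ *ᵥ v).im := by
  obtain ⟨w, hw0, hw, hwt⟩ := exists_decaying_flow hv
  set s : ℝ → ℝ := fun t => (star (w t) ⬝ᵥ symJ n ℂ *ᵥ w t).im with hs
  have hsd : ∀ t, HasDerivAt s (-2 * (star (w t) ⬝ᵥ (Q.map re).map ofReal *ᵥ w t).re) t :=
    fun t => hasDerivAt_krein hQ.symm (hw t)
  have hanti : Antitone s := antitone_of_deriv_nonpos (fun t => (hsd t).differentiableAt) fun t => by
    rw [(hsd t).deriv]
    linarith [(hQ.dotProduct_re_nonneg (w t)).1]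
  have hlim : Tendsto s atTop (𝓝 0) := by
    have hc : Continuous fun v : Fin n ⊕ Fin n → ℂ => (star v ⬝ᵥ symJ n ℂ *ᵥ v).im := by fun_prop
    have h0 : (star (0 : Fin n ⊕ Fin n → ℂ) ⬝ᵥ symJ n ℂ *ᵥ 0).im = 0 := by simp
    exact h0 ▸ (hc.tendsto 0).comp hwt
  have hnn : ∀ t, 0 ≤ s t := fun t => hanti.le_of_tendsto hlim t
  have hs0 : s 0 = (star v ⬝ᵥ symJ n ℂ *ᵥ v).im := by rw [hs]; simp only [hw0]
  rw [← hs0]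
  refine lt_of_le_of_ne (hnn 0) fun h0 => hv0 ?_
  -- The form is nonincreasing and nonnegative, so starting at 0 it remains 0, and its derivative
  -- forces Re Q to vanish along the orbit.
  have hz : ∀ t ∈ Set.Ioo (0 : ℝ) 1, (Q.map re).map ofReal *ᵥ w t = 0 := by
    intro t ht
    refine hQ.re_mulVec_eq_zero ?_
    have hloc : s =ᶠ[𝓝 t] fun _ => 0 := by
      filter_upwards [Ioi_mem_nhds ht.1] with r hr
      exact le_antisymm ((hanti (le_of_lt hr)).trans_eq h0.symm) (hnn r)
    have h1 := (hsd t).unique ((hasDerivAt_const t (0 : ℝ)).congr_of_eventuallyEq hloc)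
    have h2 := hQ.dotProduct_re_nonneg (w t)
    exact Complex.ext (by simpa using h1) h2.2
  refine hQ.eq_zero_of_mulVec_pow fun k => ?_
  have h1 := mulVec_pow_eq_zero_of_flow hw hz k
  have h2 : ∀ t ∈ Set.Ioo (0 : ℝ) 1,
      ((Q.map re).map ofReal * (symJ n ℂ * Q) ^ k) *ᵥ w t = 0 := by
    intro t ht
    have := h1 t ht
    rw [smul_pow, Matrix.mul_smul, smul_mulVec] at this
    exact (smul_eq_zero.mp this).resolve_left (pow_ne_zero _ I_ne_zero)
  -- The vanishing is known only for t in (0, 1); continuity carries it to the initial vector.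
  have hcont : Tendsto (fun t => ((Q.map re).map ofReal * (symJ n ℂ * Q) ^ k) *ᵥ w t) (𝓝[>] 0)
      (𝓝 (((Q.map re).map ofReal * (symJ n ℂ * Q) ^ k) *ᵥ w 0)) :=
    ((hasDerivAt_mulVec (hw 0) _).continuousAt.tendsto).mono_left nhdsWithin_le_nhds
  rw [← hw0]
  refine tendsto_nhds_unique hcont (tendsto_const_nhds.congr' ?_)
  filter_upwards [Ioo_mem_nhdsGT (zero_lt_one' ℝ)] with t ht
  exact (h2 t ht).symm

/-- The upper spectral space of the Hamilton map is isotropic. -/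
theorem symplectic_eq_zero (hQ : Qᵀ = Q) {u v : Fin n ⊕ Fin n → ℂ}
    (hu : u ∈ upperSpace (symJ n ℂ * Q)) (hv : v ∈ upperSpace (symJ n ℂ * Q)) :
    u ⬝ᵥ symJ n ℂ *ᵥ v = 0 := by
  obtain ⟨w, hw0, hw, hwt⟩ := exists_decaying_flow hu
  obtain ⟨w', hw0', hw', hwt'⟩ := exists_decaying_flow hv
  -- `F` is skew for the symplectic form, so the pairing of two orbits is constant, and both orbits
  -- decay.
  have hd : ∀ t, HasDerivAt (fun s => w s ⬝ᵥ symJ n ℂ *ᵥ w' s) 0 t := by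
    intro t
    have h1 := hasDerivAt_dotProduct_mulVec (symJ n ℂ) (hw t) (hw' t)
    rw [smul_mulVec, smul_mulVec, smul_dotProduct, mulVec_smul, dotProduct_smul,
      hamilton_dotProduct hQ, dotProduct_hamilton, smul_neg, add_neg_cancel] at h1
    exact h1
  have hlim : Tendsto (fun s => w s ⬝ᵥ symJ n ℂ *ᵥ w' s) atTop (𝓝 0) := by
    have hc : Continuous fun p : (Fin n ⊕ Fin n → ℂ) × (Fin n ⊕ Fin n → ℂ) =>
        p.1 ⬝ᵥ symJ n ℂ *ᵥ p.2 := by fun_prop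
    have h1 := (hc.tendsto (0, 0)).comp (hwt.prodMk_nhds hwt')
    simp only [mulVec_zero, dotProduct_zero] at h1
    exact h1
  have hconst : ∀ t, w t ⬝ᵥ symJ n ℂ *ᵥ w' t = w 0 ⬝ᵥ symJ n ℂ *ᵥ w' 0 := fun t =>
    is_const_of_deriv_eq_zero (fun t => (hd t).differentiableAt) (fun t => (hd t).deriv) t 0
  rw [← hw0, ← hw0']
  exact tendsto_nhds_unique (tendsto_const_nhds.congr fun t => (hconst t).symm) hlim

end Positivity

/-! ### The upper spectral space as a Lagrangian graph -/

section Polarization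

variable {n : ℕ} {Q : Matrix (Fin n ⊕ Fin n) (Fin n ⊕ Fin n) ℂ}

theorem mem_maxGenEigenspace_eq_bot {ι : Type*} [Fintype ι] [DecidableEq ι] {F : Matrix ι ι ℂ}
    {l : ℂ} (h : ∀ v, F *ᵥ v = l • v → v = 0) :
    Module.End.maxGenEigenspace (Matrix.toLin' F) l = ⊥ := by
  rw [Submodule.eq_bot_iff]
  intro v hv
  obtain ⟨k, hk⟩ := mem_maxGenEigenspace_iff.mp hv
  induction k with
  | zero => simpa using hk
  | succ k ih =>
    rw [pow_succ', ← mulVec_mulVec] at hk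
    refine ih (h _ ?_)
    rw [sub_mulVec, smul_mulVec, one_mulVec, sub_eq_zero] at hk
    exact hk

theorem IsPartiallyElliptic.upperSpace_sup_lowerSpace (hQ : IsPartiallyElliptic Q) :
    upperSpace (symJ n ℂ * Q) ⊔ lowerSpace (symJ n ℂ * Q) = ⊤ := by
  rw [eq_top_iff, ← Module.End.iSup_maxGenEigenspace_eq_top (Matrix.toLin' (symJ n ℂ * Q))]
  refine iSup_le fun l => ?_
  rcases lt_trichotomy l.im 0 with h | h | h
  · exact le_sup_of_le_right (le_iSup₂ (f := fun (l : ℂ) (_ : l.im < 0) =>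
      Module.End.maxGenEigenspace (Matrix.toLin' (symJ n ℂ * Q)) l) l h)
  · rw [mem_maxGenEigenspace_eq_bot]
    · exact bot_le
    · intro v hv
      by_contra h0
      exact hQ.im_ne_zero h0 hv h
  · exact le_sup_of_le_left (le_iSup₂ (f := fun (l : ℂ) (_ : 0 < l.im) =>
      Module.End.maxGenEigenspace (Matrix.toLin' (symJ n ℂ * Q)) l) l h)

theorem krein_elim (x y : Fin n → ℂ) :
    star (Sum.elim x y) ⬝ᵥ symJ n ℂ *ᵥ Sum.elim x y = star x ⬝ᵥ y - star y ⬝ᵥ x := by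
  have : star (Sum.elim x y) = Sum.elim (star x) (star y) := by
    ext (i | i) <;> rfl
  rw [symJ_mulVec_elim, this, sumElim_dotProduct_sumElim, dotProduct_neg, sub_eq_add_neg]

/-- The Krein form vanishes on vectors without position component, which positivity on Λ⁺ forbids
unless the vector is 0. -/
theorem IsPartiallyElliptic.eq_zero_of_mem_upperSpace (hQ : IsPartiallyElliptic Q)
    {v : Fin n ⊕ Fin n → ℂ} (hv : v ∈ upperSpace (symJ n ℂ * Q)) (hx : ∀ i, v (Sum.inl i) = 0) :
    v = 0 := by
  by_contra h0
  have h1 := hQ.krein_pos hv h0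
  have h2 : v = Sum.elim (0 : Fin n → ℂ) (v ∘ Sum.inr) := by
    ext (i | i)
    · exact hx i
    · rfl
  rw [h2, krein_elim] at h1
  simp at h1

theorem IsPartiallyElliptic.eq_zero_of_mem_lowerSpace (hQ : IsPartiallyElliptic Q)
    {v : Fin n ⊕ Fin n → ℂ} (hv : v ∈ lowerSpace (symJ n ℂ * Q)) (hx : ∀ i, v (Sum.inl i) = 0) :
    v = 0 := by
  have h1 := star_mem_upperSpace hv
  have h2 : (symJ n ℂ * Q).map star = symJ n ℂ * Q.map star := by
    have := ((starRingEnd ℂ).mapMatrix (m := Fin n ⊕ Fin n)).map_mul (symJ n ℂ) Q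
    refine this.trans ?_
    congr 1
    exact symJ_map_star n
  rw [h2] at h1
  rw [← star_eq_zero]
  exact hQ.map_star.eq_zero_of_mem_upperSpace h1 fun i => by simp [hx i]

/-- The upper spectral space of the Hamilton map is a graph over the position space. -/
theorem IsPartiallyElliptic.exists_graph (hQ : IsPartiallyElliptic Q) :
    ∃ Γ : Matrix (Fin n) (Fin n) ℂ,
      (upperSpace (symJ n ℂ * Q) : Set (Fin n ⊕ Fin n → ℂ)) = Set.range (graphVec Γ) := by
  set U := upperSpace (symJ n ℂ * Q)
  set L := lowerSpace (symJ n ℂ * Q)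
  set π : (Fin n ⊕ Fin n → ℂ) →ₗ[ℂ] (Fin n → ℂ) := LinearMap.funLeft ℂ ℂ Sum.inl with hπ
  have hUinj : Function.Injective (π ∘ₗ U.subtype) := by
    rw [injective_iff_map_eq_zero]
    intro v hv
    exact Subtype.ext (hQ.eq_zero_of_mem_upperSpace v.2 fun i => congrFun hv i)
  have hLinj : Function.Injective (π ∘ₗ L.subtype) := by
    rw [injective_iff_map_eq_zero]
    intro v hv
    exact Subtype.ext (hQ.eq_zero_of_mem_lowerSpace v.2 fun i => congrFun hv i)
  -- Both spectral spaces inject into the position space, so each has dimension at most n; together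
  -- they span dimension 2n, hence equality.
  have h1 := LinearMap.finrank_le_finrank_of_injective hUinj
  have h2 := LinearMap.finrank_le_finrank_of_injective hLinj
  have h3 := Submodule.finrank_add_le_finrank_add_finrank U L
  rw [hQ.upperSpace_sup_lowerSpace, finrank_top] at h3
  simp only [Module.finrank_fintype_fun_eq_card, Fintype.card_sum, Fintype.card_fin] at h1 h2 h3
  have hdim : Module.finrank ℂ U = Module.finrank ℂ (Fin n → ℂ) := by
    rw [Module.finrank_fintype_fun_eq_card, Fintype.card_fin]
    omega
  set e : U ≃ₗ[ℂ] (Fin n → ℂ) := LinearEquiv.ofInjectiveOfFinrankEq (π ∘ₗ U.subtype) hUinj hdim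
  have he : ∀ v : U, e v = π v := fun v => rfl
  set G : (Fin n → ℂ) →ₗ[ℂ] (Fin n → ℂ) :=
    LinearMap.funLeft ℂ ℂ Sum.inr ∘ₗ U.subtype ∘ₗ (e.symm : (Fin n → ℂ) →ₗ[ℂ] U) with hG
  have key : ∀ x, graphVec (LinearMap.toMatrix' G) x = (e.symm x : Fin n ⊕ Fin n → ℂ) := by
    intro x
    ext (i | i)
    · have := congrFun (he (e.symm x)) i
      rw [e.apply_symm_apply] at this
      exact this
    · simp only [graphVec, Sum.elim_inr, ← Matrix.toLin'_apply, Matrix.toLin'_toMatrix']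
      rfl
  refine ⟨LinearMap.toMatrix' G, Set.ext fun v => ⟨fun hv => ⟨e ⟨v, hv⟩, ?_⟩, ?_⟩⟩
  · rw [key, e.symm_apply_apply]
  · rintro ⟨x, rfl⟩
    rw [key]
    exact (e.symm x).2

theorem graphVec_injective (Γ : Matrix (Fin n) (Fin n) ℂ) : Function.Injective (graphVec Γ) := by
  intro x y hxy
  ext i
  exact congrFun hxy (Sum.inl i)

theorem graphVec_smul (Γ : Matrix (Fin n) (Fin n) ℂ) (c : ℂ) (x : Fin n → ℂ) :
    graphVec Γ (c • x) = c • graphVec Γ x := by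
  ext (i | i) <;> simp [graphVec, mulVec_smul]

theorem graphVec_zero (Γ : Matrix (Fin n) (Fin n) ℂ) : graphVec Γ 0 = 0 := by
  ext (i | i) <;> simp [graphVec]

theorem eq_of_range_graphVec_eq {Γ Γ' : Matrix (Fin n) (Fin n) ℂ}
    (h : Set.range (graphVec Γ) = Set.range (graphVec Γ')) : Γ = Γ' := by
  refine Matrix.ext_iff_mulVec.mpr fun x => ?_
  obtain ⟨y, hy⟩ : graphVec Γ x ∈ Set.range (graphVec Γ') := h ▸ ⟨x, rfl⟩
  have hyx : y = x := by
    ext i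
    exact congrFun hy (Sum.inl i)
  rw [hyx] at hy
  ext i
  exact (congrFun hy (Sum.inr i)).symm

/-- The matrix of the Hamilton map on the graph of `Γ`. -/
def graphMatrix (Q : Matrix (Fin n ⊕ Fin n) (Fin n ⊕ Fin n) ℂ) (Γ : Matrix (Fin n) (Fin n) ℂ) :
    Matrix (Fin n) (Fin n) ℂ :=
  (symJ n ℂ * Q).toBlocks₁₁ + (symJ n ℂ * Q).toBlocks₁₂ * Γ

/-- Each property of Λ⁺ becomes one of `Γ`: isotropy is symmetry, positivity of the Krein form on
graph vectors over real positions is Im Γ > 0, and invariance yields `N`. -/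
theorem IsPartiallyElliptic.isPolarization (hQ : IsPartiallyElliptic Q)
    {Γ : Matrix (Fin n) (Fin n) ℂ}
    (hΓ : (upperSpace (symJ n ℂ * Q) : Set (Fin n ⊕ Fin n → ℂ)) = Set.range (graphVec Γ)) :
    IsPolarization Q Γ (graphMatrix Q Γ) := by
  have hmem : ∀ x, graphVec Γ x ∈ upperSpace (symJ n ℂ * Q) := fun x => by
    rw [← SetLike.mem_coe, hΓ]
    exact ⟨x, rfl⟩
  have hsymm : Γᵀ = Γ := by
    refine Matrix.ext_iff_mulVec.mpr fun y => ?_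
    refine dotProduct_eq _ _ fun x => ?_
    have h1 := symplectic_eq_zero hQ.symm (hmem x) (hmem y)
    simp only [graphVec] at h1
    rw [symJ_mulVec_elim, sumElim_dotProduct_sumElim, dotProduct_neg, ← sub_eq_add_neg,
      sub_eq_zero] at h1
    rw [dotProduct_comm _ x, dotProduct_comm _ x, h1, mulVec_transpose, dotProduct_comm x,
      dotProduct_comm _ y, dotProduct_mulVec]
  have hF : ∀ x, (symJ n ℂ * Q) *ᵥ graphVec Γ x = graphVec Γ (graphMatrix Q Γ *ᵥ x) := by
    intro x
    have h1 := mulVec_mem_upperSpace (hmem x)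
    rw [← SetLike.mem_coe, hΓ] at h1
    obtain ⟨y, hy⟩ := h1
    have h2 : y = graphMatrix Q Γ *ᵥ x := by
      ext i
      have h3 := congrFun hy (Sum.inl i)
      rw [← fromBlocks_toBlocks (symJ n ℂ * Q), graphVec, graphVec, fromBlocks_mulVec] at h3
      simp only [Sum.elim_inl, Sum.elim_comp_inl, Sum.elim_comp_inr] at h3
      rw [h3, graphMatrix, add_mulVec, mulVec_mulVec]
    rw [← hy, h2]
  refine ⟨hQ.symm, hsymm, ?_, fun x => ?_⟩
  · refine Matrix.PosDef.of_dotProduct_mulVec_pos ?_ fun x hx => ?_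
    · ext i j
      have := congrFun (congrFun hsymm i) j
      simp only [transpose_apply] at this
      simp [this]
    · set z : Fin n → ℂ := fun i => (x i : ℂ) with hz
      have hz0 : graphVec Γ z ≠ 0 := by
        rw [← graphVec_zero Γ]
        refine (graphVec_injective Γ).ne ?_
        intro h0
        refine hx (funext fun i => ?_)
        exact Complex.ofReal_eq_zero.mp (congrFun h0 i)
      have h1 := hQ.krein_pos (hmem z) hz0
      rw [graphVec, krein_elim] at h1
      have h2 : (star z ⬝ᵥ Γ *ᵥ z - star (Γ *ᵥ z) ⬝ᵥ z).im = 2 * (x ⬝ᵥ Γ.map im *ᵥ x) := by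
        have h3 : star (Γ *ᵥ z) ⬝ᵥ z = star (star z ⬝ᵥ Γ *ᵥ z) := by
          rw [← star_dotProduct_star, star_star]
        have h4 : (star z ⬝ᵥ Γ *ᵥ z).im = x ⬝ᵥ Γ.map im *ᵥ x := by
          simp [hz, dotProduct, mulVec, Finset.mul_sum]
        rw [h3, sub_im, star_def, conj_im, h4]
        ring
      rw [h2] at h1
      rw [star_trivial]
      linarith
  · have h1 := congrArg (fun v => -(symJ n ℂ *ᵥ v)) (hF x)
    simp only [mulVec_mulVec, ← Matrix.mul_assoc, symJ_mul_self, Matrix.neg_mul, Matrix.one_mul,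
      neg_mulVec, neg_neg] at h1
    rw [h1, graphVec, annVec, symJ_mulVec_elim]
    ext (i | i) <;> simp

theorem IsPolarization.hamilton_mulVec {Γ N : Matrix (Fin n) (Fin n) ℂ} (hΓ : IsPolarization Q Γ N)
    (x : Fin n → ℂ) : (symJ n ℂ * Q) *ᵥ graphVec Γ x = graphVec Γ (N *ᵥ x) := by
  rw [← mulVec_mulVec, hΓ.mulVec_graph, symJ_mulVec_annVec]

/-- An eigenvector of `N` lifts to one of `F` in Λ⁺. There Im l times the positive Krein form is
nonnegative, and l is not real. -/
theorem IsPartiallyElliptic.im_pos_of_mulVec_eq (hQ : IsPartiallyElliptic Q)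
    {Γ N : Matrix (Fin n) (Fin n) ℂ} (hΓ : IsPolarization Q Γ N)
    (hmem : ∀ x, graphVec Γ x ∈ upperSpace (symJ n ℂ * Q)) {l : ℂ} {x : Fin n → ℂ} (hx : x ≠ 0) (hl : N *ᵥ x = l • x) : 0 < l.im := by
  have hv0 : graphVec Γ x ≠ 0 := by
    rw [← graphVec_zero Γ]
    exact (graphVec_injective Γ).ne hx
  have hv : (symJ n ℂ * Q) *ᵥ graphVec Γ x = l • graphVec Γ x := by
    rw [hΓ.hamilton_mulVec, hl, graphVec_smul]
  have h1 := congrArg re (sub_mul_krein_eq hQ.symm hv)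
  have h2 := hQ.dotProduct_re_nonneg (graphVec Γ x)
  have h3 := hQ.im_ne_zero hv0 hv
  have h4 : (star l - l) = (-(2 * l.im) : ℝ) * I := by
    apply Complex.ext <;> simp; ring
  have hpos := hQ.krein_pos (hmem x) hv0
  rw [h4, mul_assoc, re_ofReal_mul, I_mul_re] at h1
  have h5 : 2 * l.im * (star (graphVec Γ x) ⬝ᵥ symJ n ℂ *ᵥ graphVec Γ x).im =
      2 * (star (graphVec Γ x) ⬝ᵥ (Q.map re).map ofReal *ᵥ graphVec Γ x).re := by
    have : (2 * (star (graphVec Γ x) ⬝ᵥ (Q.map re).map ofReal *ᵥ graphVec Γ x)).re =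
        2 * (star (graphVec Γ x) ⬝ᵥ (Q.map re).map ofReal *ᵥ graphVec Γ x).re := by simp
    rw [← this, ← h1]
    ring
  refine lt_of_le_of_ne ?_ (Ne.symm h3)
  by_contra hneg
  push Not at hneg
  nlinarith

end Polarization

/-! ### Eigenvalues of the Hamilton map and the trace of `N` -/

section Trace

variable {ι : Type*} [Fintype ι] [DecidableEq ι]

theorem exists_mulVec_eq_of_mem_roots {M : Matrix ι ι ℂ} {l : ℂ} (hl : l ∈ M.charpoly.roots) :
    ∃ x ≠ 0, M *ᵥ x = l • x := by
  have h1 := (Polynomial.mem_roots'.mp hl).2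
  rw [Polynomial.IsRoot.def, Matrix.eval_charpoly, ← Matrix.exists_mulVec_eq_zero_iff] at h1
  obtain ⟨x, hx, h⟩ := h1
  refine ⟨x, hx, ?_⟩
  rw [sub_mulVec, sub_eq_zero] at h
  rw [← h]
  ext i
  simp [Matrix.scalar_apply, mulVec_diagonal]

theorem exists_pos_le_im {M : Matrix ι ι ℂ} (hM : ∀ (l : ℂ) x, x ≠ 0 → M *ᵥ x = l • x → 0 < l.im) :
    ∃ δ > 0, ∀ (l : ℂ) x, x ≠ 0 → M *ᵥ x = l • x → δ ≤ l.im := by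
  have hroot : ∀ (l : ℂ) x, x ≠ 0 → M *ᵥ x = l • x → l ∈ M.charpoly.roots.toFinset := by
    intro l x hx h
    rw [Multiset.mem_toFinset, Polynomial.mem_roots (Matrix.charpoly_monic M).ne_zero,
      Polynomial.IsRoot.def, Matrix.eval_charpoly, ← Matrix.exists_mulVec_eq_zero_iff]
    refine ⟨x, hx, ?_⟩
    rw [sub_mulVec, h, sub_eq_zero]
    ext i
    simp [Matrix.scalar_apply, mulVec_diagonal]
  rcases M.charpoly.roots.toFinset.eq_empty_or_nonempty with he | hne
  -- There are no eigenvalues at all when the index type is empty, and any δ works.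
  · exact ⟨1, one_pos, fun l x hx h => absurd (hroot l x hx h) (by simp [he])⟩
  · obtain ⟨l₀, hl₀, hmin⟩ := Finset.exists_min_image _ Complex.im hne
    obtain ⟨x₀, hx₀, h₀⟩ := exists_mulVec_eq_of_mem_roots (Multiset.mem_toFinset.mp hl₀)
    exact ⟨l₀.im, hM l₀ x₀ hx₀ h₀, fun l x hx h => hmin l (hroot l x hx h)⟩

theorem sum_roots_map_star (F : Matrix ι ι ℂ) :
    ((F.map star).charpoly.roots.filter fun l => 0 < l.im).sum =
      star (F.charpoly.roots.filter fun l => l.im < 0).sum := by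
  have h1 : (F.map star).charpoly.roots = F.charpoly.roots.map (starRingEnd ℂ) := by
    have h := Polynomial.roots_map_of_injective_of_card_eq_natDegree (p := F.charpoly)
      (RingHom.injective (starRingEnd ℂ)) IsAlgClosed.card_roots_eq_natDegree
    rw [h, ← Matrix.charpoly_map]
    rfl
  rw [h1, Multiset.filter_map]
  have h2 : ((fun l : ℂ => 0 < l.im) ∘ starRingEnd ℂ) = fun l => l.im < 0 := by
    funext l
    simp
  simp only [h2]
  exact (map_multiset_sum (starRingEnd ℂ) _).symm

variable {n : ℕ} {Q : Matrix (Fin n ⊕ Fin n) (Fin n ⊕ Fin n) ℂ}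

/-- The symplectic shear (x, ξ) ↦ (x, ξ + Γx) makes the Hamilton map block triangular with diagonal
blocks `N` and −Nᵀ. The eigenvalues in the upper half plane, with multiplicity, are therefore those
of `N`. -/
theorem IsPolarization.charpoly_eq {Γ N : Matrix (Fin n) (Fin n) ℂ} (hΓ : IsPolarization Q Γ N) :
    (symJ n ℂ * Q).charpoly = N.charpoly * (-Nᵀ).charpoly := by
  set F := symJ n ℂ * Q with hF
  have hQb := fromBlocks_toBlocks Q
  set A := Q.toBlocks₁₁
  set B := Q.toBlocks₁₂
  set C := Q.toBlocks₂₁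
  set D := Q.toBlocks₂₂
  have hsymm := hΓ.symm_form
  rw [← hQb, fromBlocks_transpose, fromBlocks_inj] at hsymm
  obtain ⟨hA, hC, -, hD⟩ := hsymm
  have hFb : F = fromBlocks C D (-A) (-B) := by
    rw [hF, ← hQb, symJ, fromBlocks_multiply]
    simp
  have h1 : C + D * Γ = N ∧ -A - B * Γ = Γ * N := by
    constructor
    all_goals
      refine Matrix.ext_iff_mulVec.mpr fun x => ?_
      have h2 := hΓ.hamilton_mulVec x
      rw [← hF, hFb, graphVec, graphVec, fromBlocks_mulVec] at h2
    · have h3 := funext fun i => congrFun h2 (Sum.inl i)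
      simp only [Sum.elim_inl, Sum.elim_comp_inl, Sum.elim_comp_inr] at h3
      rw [add_mulVec, ← mulVec_mulVec]
      exact h3
    · have h3 := funext fun i => congrFun h2 (Sum.inr i)
      simp only [Sum.elim_inr, Sum.elim_comp_inl, Sum.elim_comp_inr] at h3
      rw [sub_mulVec, ← mulVec_mulVec, ← mulVec_mulVec, sub_eq_add_neg, ← neg_mulVec]
      exact h3
  have hS : fromBlocks (1 : Matrix (Fin n) (Fin n) ℂ) 0 (-Γ) (1 : Matrix (Fin n) (Fin n) ℂ) *
      fromBlocks (1 : Matrix (Fin n) (Fin n) ℂ) 0 Γ (1 : Matrix (Fin n) (Fin n) ℂ) = 1 := by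
    rw [fromBlocks_multiply]
    simp
  have hS' : fromBlocks (1 : Matrix (Fin n) (Fin n) ℂ) 0 Γ (1 : Matrix (Fin n) (Fin n) ℂ) *
      fromBlocks (1 : Matrix (Fin n) (Fin n) ℂ) 0 (-Γ) (1 : Matrix (Fin n) (Fin n) ℂ) = 1 := by
    rw [fromBlocks_multiply]
    simp
  set S : (Matrix (Fin n ⊕ Fin n) (Fin n ⊕ Fin n) ℂ)ˣ := ⟨_, _, hS', hS⟩
  have hconj : F = S.val * fromBlocks N D 0 (-Nᵀ) * S⁻¹.val := by
    change F = fromBlocks 1 0 Γ 1 * fromBlocks N D 0 (-Nᵀ) * fromBlocks 1 0 (-Γ) 1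
    rw [fromBlocks_multiply, fromBlocks_multiply, hFb, ← h1.1]
    have hN : Γ * C + Γ * (D * Γ) = -A - B * Γ := by rw [← Matrix.mul_add, h1.1, h1.2]
    have hCt : Cᵀ = B := hC
    rw [fromBlocks_inj]
    refine ⟨?_, ?_, ?_, ?_⟩
    · simp
    · simp
    · simp only [transpose_add, transpose_mul, hCt, hD, hΓ.symm, Matrix.mul_one, Matrix.mul_add,
        Matrix.mul_neg, Matrix.mul_zero, add_zero, Matrix.add_mul, Matrix.one_mul, Matrix.neg_mul,
        Matrix.mul_assoc, neg_add, neg_neg]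
      have : Γ * C = -A - B * Γ - Γ * (D * Γ) := by rw [← hN]; abel
      rw [this]
      abel
    · simp only [transpose_add, transpose_mul, hCt, hD, hΓ.symm, Matrix.mul_one, Matrix.mul_zero,
        Matrix.one_mul, zero_add, neg_add]
      abel
  rw [hconj, Matrix.coe_units_inv, Matrix.charpoly_units_conj, charpoly_fromBlocks_zero₂₁]

variable {Γ N : Matrix (Fin n) (Fin n) ℂ}

theorem im_neg_of_mem_roots (hN : ∀ (l : ℂ) x, x ≠ 0 → N *ᵥ x = l • x → 0 < l.im) {l : ℂ}
    (hl : l ∈ (-Nᵀ).charpoly.roots) : l.im < 0 := by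
  obtain ⟨x, hx, h⟩ := exists_mulVec_eq_of_mem_roots hl
  have h1 : ∃ v ≠ 0, (Nᵀ + l • 1) *ᵥ v = 0 := by
    refine ⟨x, hx, ?_⟩
    rw [neg_mulVec] at h
    rw [add_mulVec, smul_mulVec, one_mulVec, ← h, add_neg_cancel]
  rw [Matrix.exists_mulVec_eq_zero_iff, ← det_transpose, transpose_add, transpose_transpose,
    transpose_smul, transpose_one, ← Matrix.exists_mulVec_eq_zero_iff] at h1
  obtain ⟨v, hv, h2⟩ := h1
  rw [add_mulVec, smul_mulVec, one_mulVec, add_eq_zero_iff_eq_neg, ← neg_smul] at h2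
  have := hN _ v hv h2
  simpa using this

theorem im_pos_of_mem_roots (hN : ∀ (l : ℂ) x, x ≠ 0 → N *ᵥ x = l • x → 0 < l.im) {l : ℂ}
    (hl : l ∈ N.charpoly.roots) : 0 < l.im := by
  obtain ⟨x, hx, h⟩ := exists_mulVec_eq_of_mem_roots hl
  exact hN l x hx h

theorem IsPolarization.roots_eq (hΓ : IsPolarization Q Γ N) :
    (symJ n ℂ * Q).charpoly.roots = N.charpoly.roots + (-Nᵀ).charpoly.roots := by
  rw [hΓ.charpoly_eq, Polynomial.roots_mul
    (mul_ne_zero (charpoly_monic _).ne_zero (charpoly_monic _).ne_zero)]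

theorem IsPolarization.sum_roots_pos (hΓ : IsPolarization Q Γ N)
    (hN : ∀ (l : ℂ) x, x ≠ 0 → N *ᵥ x = l • x → 0 < l.im) :
    ((symJ n ℂ * Q).charpoly.roots.filter fun l => 0 < l.im).sum = N.trace := by
  rw [hΓ.roots_eq, Multiset.filter_add,
    Multiset.filter_eq_self.mpr fun l hl => im_pos_of_mem_roots hN hl,
    Multiset.filter_eq_nil.mpr fun l hl => (im_neg_of_mem_roots hN hl).not_gt, add_zero,
    Matrix.trace_eq_sum_roots_charpoly]

theorem IsPolarization.sum_roots_neg (hΓ : IsPolarization Q Γ N)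
    (hN : ∀ (l : ℂ) x, x ≠ 0 → N *ᵥ x = l • x → 0 < l.im) :
    ((symJ n ℂ * Q).charpoly.roots.filter fun l => l.im < 0).sum = -N.trace := by
  rw [hΓ.roots_eq, Multiset.filter_add,
    Multiset.filter_eq_nil.mpr fun l hl => (im_pos_of_mem_roots hN hl).not_gt,
    Multiset.filter_eq_self.mpr fun l hl => im_neg_of_mem_roots hN hl, zero_add,
    ← Matrix.trace_eq_sum_roots_charpoly, trace_neg, trace_transpose]

end Trace

/-! ### Positions and momenta on Schwartz functions and on tempered distributions -/

section SchwartzOperators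

open MeasureTheory

variable {n : ℕ} {h : ℝ}

theorem hasTemperateGrowth_coord (j : Fin n) :
    (fun x : Conf n => (x j : ℂ)).HasTemperateGrowth := by
  have : (fun x : Conf n => (x j : ℂ)) =
      (Complex.ofRealCLM ∘L EuclideanSpace.proj j : Conf n →L[ℝ] ℂ) := by
    ext x; simp
  rw [this]
  fun_prop

/-- The unit vector in the direction of the `j`-th coordinate. -/
def unitVec (j : Fin n) : Conf n := EuclideanSpace.single j (1 : ℝ)

/-- The operators `x_j` and `h D_{x_j}` on Schwartz functions. -/
def schwartzOp (h : ℝ) : Fin n ⊕ Fin n → Module.End ℂ 𝓢(Conf n, ℂ) :=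
  Sum.elim (fun j => (SchwartzMap.smulLeftCLM ℂ fun x : Conf n => (x j : ℂ) :
      𝓢(Conf n, ℂ) →L[ℂ] 𝓢(Conf n, ℂ)).toLinearMap)
    fun j => ((h : ℂ) / I) • (LineDeriv.lineDerivOpCLM ℂ 𝓢(Conf n, ℂ) (unitVec j)).toLinearMap

theorem schwartzOp_inl_apply (j : Fin n) (f : 𝓢(Conf n, ℂ)) (x : Conf n) :
    schwartzOp h (Sum.inl j) f x = (x j : ℂ) * f x := by
  change SchwartzMap.smulLeftCLM ℂ (fun x : Conf n => (x j : ℂ)) f x = _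
  rw [SchwartzMap.smulLeftCLM_apply_apply (hasTemperateGrowth_coord j), smul_eq_mul]

theorem schwartzOp_inr_apply (j : Fin n) (f : 𝓢(Conf n, ℂ)) (x : Conf n) :
    schwartzOp h (Sum.inr j) f x = (h : ℂ) / I * fderiv ℝ f x (unitVec j) := rfl

theorem schwartzOp_inl_fun (j : Fin n) (f : 𝓢(Conf n, ℂ)) :
    (schwartzOp h (Sum.inl j) f : Conf n → ℂ) = fun x => (x j : ℂ) * f x :=
  funext (schwartzOp_inl_apply j f)

theorem schwartzOp_inr_fun (j : Fin n) (f : 𝓢(Conf n, ℂ)) :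
    (schwartzOp h (Sum.inr j) f : Conf n → ℂ) =
      fun x => (h : ℂ) / I * fderiv ℝ f x (unitVec j) := rfl

theorem hasFDerivAt_coord (j : Fin n) (x : Conf n) :
    HasFDerivAt (fun x : Conf n => (x j : ℂ))
      (Complex.ofRealCLM ∘L EuclideanSpace.proj j : Conf n →L[ℝ] ℂ) x :=
  (Complex.ofRealCLM ∘L EuclideanSpace.proj j : Conf n →L[ℝ] ℂ).hasFDerivAt

theorem unitVec_apply (j k : Fin n) : unitVec j k = if k = j then 1 else 0 := by
  rw [unitVec, PiLp.single_apply]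

theorem schwartzOp_inl_inr (j k : Fin n) (f : 𝓢(Conf n, ℂ)) :
    schwartzOp h (Sum.inl j) (schwartzOp h (Sum.inr k) f) -
      schwartzOp h (Sum.inr k) (schwartzOp h (Sum.inl j) f) =
      (I * h * (1 : Matrix (Fin n) (Fin n) ℂ) j k) • f := by
  ext x
  have h1 := ((hasFDerivAt_coord j x).mul (f.hasFDerivAt x)).fderiv
  have h2 : fderiv ℝ (fun x => (x j : ℂ) * f x) x (unitVec k) =
      (x j : ℂ) * fderiv ℝ f x (unitVec k) + f x * (1 : Matrix (Fin n) (Fin n) ℂ) j k := by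
    change fderiv ℝ ((fun x : Conf n => (x j : ℂ)) * (f : Conf n → ℂ)) x (unitVec k) = _
    rw [h1]
    by_cases hjk : j = k <;> simp [unitVec_apply, Matrix.one_apply, hjk]
  rw [_root_.sub_apply, schwartzOp_inl_apply, schwartzOp_inr_apply, schwartzOp_inr_apply,
    schwartzOp_inl_fun, h2, _root_.smul_apply, smul_eq_mul, Complex.div_I]
  ring

theorem schwartzOp_inr_inr (j k : Fin n) (f : 𝓢(Conf n, ℂ)) :
    schwartzOp h (Sum.inr j) (schwartzOp h (Sum.inr k) f) =
      schwartzOp h (Sum.inr k) (schwartzOp h (Sum.inr j) f) := by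
  ext x
  have hd : ∀ x, DifferentiableAt ℝ (fderiv ℝ f) x := fun x =>
    ((f.smooth 2).fderiv_right (m := 1) (by norm_num)).differentiable one_ne_zero x
  have h1 : ∀ v w : Conf n, fderiv ℝ (fun y => (h : ℂ) / I * fderiv ℝ f y v) x w =
      (h : ℂ) / I * fderiv ℝ (fderiv ℝ f) x w v := by
    intro v w
    have h2 : HasFDerivAt (fun y => fderiv ℝ f y v)
        ((ContinuousLinearMap.apply ℝ ℂ v) ∘L fderiv ℝ (fderiv ℝ f) x) x :=
      (ContinuousLinearMap.apply ℝ ℂ v).hasFDerivAt.comp x (hd x).hasFDerivAt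
    rw [(h2.const_mul ((h : ℂ) / I)).fderiv]
    rfl
  have hsymm : IsSymmSndFDerivAt ℝ f x :=
    (f.smooth 2).contDiffAt.isSymmSndFDerivAt (by simp)
  rw [schwartzOp_inr_apply, schwartzOp_inr_apply, schwartzOp_inr_fun, schwartzOp_inr_fun, h1, h1,
    hsymm.eq]

theorem schwartzOp_comm (a b : Fin n ⊕ Fin n) (f : 𝓢(Conf n, ℂ)) :
    schwartzOp h a (schwartzOp h b f) - schwartzOp h b (schwartzOp h a f) =
      (I * h * symJ n ℂ a b) • f := by
  rcases a with j | j <;> rcases b with k | k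
  · have : schwartzOp h (Sum.inl j) (schwartzOp h (Sum.inl k) f) =
        schwartzOp h (Sum.inl k) (schwartzOp h (Sum.inl j) f) := by
      ext x
      simp only [schwartzOp_inl_apply]
      ring
    rw [this, sub_self]
    simp [symJ]
  · rw [schwartzOp_inl_inr]
    simp [symJ]
  · rw [← neg_sub, schwartzOp_inl_inr, ← neg_smul]
    simp [symJ, Matrix.one_apply, eq_comm]
  · rw [schwartzOp_inr_inr, sub_self]
    simp [symJ]

/-- Complex conjugation of Schwartz functions. -/
def conjSchwartz (f : 𝓢(Conf n, ℂ)) : 𝓢(Conf n, ℂ) :=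
  SchwartzMap.postcompCLM (𝕜 := ℝ) (Complex.conjCLE : ℂ →L[ℝ] ℂ) f

theorem conjSchwartz_apply (f : 𝓢(Conf n, ℂ)) (x : Conf n) : conjSchwartz f x = star (f x) := rfl

theorem conjSchwartz_conjSchwartz (f : 𝓢(Conf n, ℂ)) : conjSchwartz (conjSchwartz f) = f := by
  ext x
  simp [conjSchwartz_apply]

theorem conjSchwartz_inl (j : Fin n) (f : 𝓢(Conf n, ℂ)) :
    SchwartzMap.smulLeftCLM ℂ (fun x : Conf n => (x j : ℂ)) (conjSchwartz f) =
      conjSchwartz (schwartzOp h (Sum.inl j) f) := by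
  ext x
  rw [SchwartzMap.smulLeftCLM_apply_apply (hasTemperateGrowth_coord j), conjSchwartz_apply,
    conjSchwartz_apply, schwartzOp_inl_apply]
  simp

theorem fderiv_conjSchwartz (f : 𝓢(Conf n, ℂ)) (x v : Conf n) :
    fderiv ℝ (conjSchwartz f) x v = star (fderiv ℝ f x v) := by
  have : HasFDerivAt (conjSchwartz f) ((Complex.conjCLE : ℂ →L[ℝ] ℂ) ∘L fderiv ℝ f x) x :=
    (Complex.conjCLE : ℂ →L[ℝ] ℂ).hasFDerivAt.comp x (f.hasFDerivAt x)
  rw [this.fderiv]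
  rfl

theorem conjSchwartz_inr (j : Fin n) (f : 𝓢(Conf n, ℂ)) :
    ((h : ℂ) / I) • (-LineDeriv.lineDerivOp (unitVec j) (conjSchwartz f)) =
      conjSchwartz (schwartzOp h (Sum.inr j) f) := by
  ext x
  rw [conjSchwartz_apply, schwartzOp_inr_apply, _root_.smul_apply, _root_.neg_apply,
    SchwartzMap.lineDerivOp_apply_eq_fderiv, fderiv_conjSchwartz]
  simp [Complex.div_I]

/-- The operators `x_j` and `h D_{x_j}` on tempered distributions. -/
def distOp (h : ℝ) : Fin n ⊕ Fin n → 𝓢'(Conf n, ℂ) →L[ℂ] 𝓢'(Conf n, ℂ) :=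
  Sum.elim mulX (hD h)

/-- The distribution pairing is bilinear while the L² pairing is sesquilinear. Testing against
conjugates makes the formal transposes match the symmetric operators x and hD. -/
theorem distOp_apply_conj (a : Fin n ⊕ Fin n) (T : 𝓢'(Conf n, ℂ)) (f : 𝓢(Conf n, ℂ)) :
    distOp h a T (conjSchwartz f) = T (conjSchwartz (schwartzOp h a f)) := by
  rcases a with j | j
  · rw [← conjSchwartz_inl]
    rfl
  · rw [← conjSchwartz_inr, map_smul]
    rfl

theorem lp_apply_conj (u : L2 n) (f : 𝓢(Conf n, ℂ)) :
    incl n u (conjSchwartz f) = inner ℂ (f.toLp 2 volume) u := by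
  rw [MeasureTheory.L2.inner_def]
  refine (Lp.toTemperedDistribution_apply u (conjSchwartz f)).trans (integral_congr_ae ?_)
  filter_upwards [f.coeFn_toLp 2 volume] with x hx
  rw [hx, RCLike.inner_apply, conjSchwartz_apply, smul_eq_mul, mul_comm]
  rfl

theorem inner_schwartzOp (a : Fin n ⊕ Fin n) (f g : 𝓢(Conf n, ℂ)) :
    inner ℂ ((schwartzOp h a f).toLp 2 volume) (g.toLp 2 volume) =
      inner ℂ (f.toLp 2 volume) ((schwartzOp h a g).toLp 2 volume) := by
  rw [SchwartzMap.inner_toL2_toL2_eq (schwartzOp h a f) g volume,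
    SchwartzMap.inner_toL2_toL2_eq f (schwartzOp h a g) volume]
  rcases a with j | j
  · refine integral_congr_ae (Filter.Eventually.of_forall fun x => ?_)
    simp only [schwartzOp_inl_apply, RCLike.inner_apply]
    simp
    ring
  · have h1 := SchwartzMap.integral_mul_lineDerivOp_right_eq_neg_left (μ := volume)
      (conjSchwartz f) g (unitVec j)
    have h2 : ∀ x, inner ℂ (schwartzOp h (Sum.inr j) f x) (g x) =
        -((h : ℂ) / I) * (LineDeriv.lineDerivOp (unitVec j) (conjSchwartz f) x * g x) := by
      intro x
      rw [schwartzOp_inr_apply, SchwartzMap.lineDerivOp_apply_eq_fderiv, fderiv_conjSchwartz,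
        RCLike.inner_apply]
      simp [Complex.div_I]
      ring
    have h3 : ∀ x, inner ℂ (f x) (schwartzOp h (Sum.inr j) g x) =
        ((h : ℂ) / I) * (conjSchwartz f x * LineDeriv.lineDerivOp (unitVec j) g x) := by
      intro x
      rw [schwartzOp_inr_apply, SchwartzMap.lineDerivOp_apply_eq_fderiv, RCLike.inner_apply,
        conjSchwartz_apply]
      simp
      ring
    simp only [h2, h3]
    rw [integral_const_mul, integral_const_mul, h1]
    ring

/-- The Schwartz functions as a subspace of `L²`. -/
def schwartzL2 (n : ℕ) : Submodule ℂ (L2 n) :=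
  LinearMap.range (SchwartzMap.toLpCLM ℂ ℂ 2 (volume : Measure (Conf n))).toLinearMap

/-- The identification of the Schwartz space with a subspace of `L²`. -/
def schwartzEquiv (n : ℕ) : 𝓢(Conf n, ℂ) ≃ₗ[ℂ] schwartzL2 n :=
  LinearEquiv.ofInjective (SchwartzMap.toLpCLM ℂ ℂ 2 (volume : Measure (Conf n))).toLinearMap
    (SchwartzMap.injective_toLp 2 volume)

theorem coe_schwartzEquiv (f : 𝓢(Conf n, ℂ)) :
    (schwartzEquiv n f : L2 n) = f.toLp 2 volume := rfl

/-- The operators `x_j` and `h D_{x_j}` on the Schwartz functions in `L²`. -/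
def weylOp (h : ℝ) (a : Fin n ⊕ Fin n) : Module.End ℂ (schwartzL2 n) :=
  (schwartzEquiv n).conj (schwartzOp h a)

theorem weylOp_apply (a : Fin n ⊕ Fin n) (f : 𝓢(Conf n, ℂ)) :
    weylOp h a (schwartzEquiv n f) = schwartzEquiv n (schwartzOp h a f) := by
  rw [weylOp, LinearEquiv.conj_apply_apply, LinearEquiv.symm_apply_apply]

theorem isCCR_weylOp : IsCCR h (weylOp h : Fin n ⊕ Fin n → _) where
  symm a u v := by
    obtain ⟨f, rfl⟩ := (schwartzEquiv n).surjective u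
    obtain ⟨g, rfl⟩ := (schwartzEquiv n).surjective v
    rw [weylOp_apply, weylOp_apply]
    exact inner_schwartzOp a f g
  comm a b u := by
    obtain ⟨f, rfl⟩ := (schwartzEquiv n).surjective u
    rw [weylOp_apply, weylOp_apply, weylOp_apply, weylOp_apply, ← map_sub, schwartzOp_comm, map_smul]

/-- The symmetric matrix of the form `q`. -/
def formMatrix (q : Form n) : Matrix (Fin n ⊕ Fin n) (Fin n ⊕ Fin n) ℂ :=
  (1 / 2 : ℂ) • Matrix.fromBlocks (dxx q) (dxXi q) (dXix q) (dXiXi q)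

theorem symJ_mul_formMatrix (q : Form n) : symJ n ℂ * formMatrix q = hamiltonMatrix q := by
  rw [formMatrix, Matrix.mul_smul, symJ, fromBlocks_multiply, hamiltonMatrix]
  simp

theorem formMatrix_transpose (q : Form n) : (formMatrix q)ᵀ = formMatrix q := by
  ext (i | i) (j | j) <;>
    simp [formMatrix, dxx, dxXi, dXix, dXiXi, QuadraticMap.polar_comm q]

/-- The symmetrized product in the Weyl ordering is exactly what the two equal off-diagonal blocks
of the symmetric matrix produce. -/
theorem weylDistribution_apply (q : Form n) (T : 𝓢'(Conf n, ℂ)) :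
    weylDistribution q h T = ∑ a, ∑ b, formMatrix q a b • distOp h a (distOp h b T) := by
  have h1 : weylDistribution q h T = ∑ j, ∑ k,
      ((dxx q j k / 2) • mulX j (mulX k T)
        + (dxXi q j k / 2) • (mulX j (hD h k T) + hD h k (mulX j T))
        + (dXiXi q j k / 2) • hD h j (hD h k T)) := by
    simp only [weylDistribution, _root_.sum_apply]
    rfl
  have h2 : ∑ j, ∑ k, (dxXi q j k / 2) • hD h k (mulX j T) =
      ∑ j, ∑ k, (dXix q j k / 2) • hD h j (mulX k T) := by
    rw [Finset.sum_comm]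
    refine Finset.sum_congr rfl fun j _ => Finset.sum_congr rfl fun k _ => ?_
    simp [dxXi, dXix, QuadraticMap.polar_comm q]
  rw [h1]
  simp only [smul_add, Finset.sum_add_distrib, h2]
  simp only [Fintype.sum_sum_type, distOp, Sum.elim_inl, Sum.elim_inr, Finset.sum_add_distrib]
  simp only [formMatrix, Matrix.smul_apply, fromBlocks_apply₁₁, fromBlocks_apply₁₂,
    fromBlocks_apply₂₁, fromBlocks_apply₂₂, smul_eq_mul, div_eq_inv_mul, mul_one]
  abel

theorem weylDistribution_apply_conj (q : Form n) (u : L2 n) (f : 𝓢(Conf n, ℂ)) :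
    weylDistribution q h (incl n u) (conjSchwartz f) =
      inner ℂ ((quad (weylOp h) ((formMatrix q).map star) (schwartzEquiv n f) : schwartzL2 n) : L2 n)
        u := by
  have h1 : ((quad (weylOp h) ((formMatrix q).map star) (schwartzEquiv n f) : schwartzL2 n) : L2 n) =
      ∑ a, ∑ b, star (formMatrix q a b) • (schwartzOp h a (schwartzOp h b f)).toLp 2 volume := by
    rw [quad_apply]
    simp only [weylOp_apply, Submodule.coe_sum, Submodule.coe_smul, coe_schwartzEquiv,
      Matrix.map_apply]
  have h2 : weylDistribution q h (incl n u) (conjSchwartz f) =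
      ∑ a, ∑ b, formMatrix q a b • distOp h a (distOp h b (incl n u)) (conjSchwartz f) := by
    rw [weylDistribution_apply]
    simp only [_root_.sum_apply, _root_.smul_apply]
  have hsymm : ∀ a b, formMatrix q a b = formMatrix q b a := fun a b =>
    congrFun (congrFun (formMatrix_transpose q) b) a
  rw [h1, h2, Finset.sum_comm, sum_inner]
  refine Finset.sum_congr rfl fun a _ => ?_
  rw [sum_inner]
  refine Finset.sum_congr rfl fun b _ => ?_
  rw [distOp_apply_conj, distOp_apply_conj, lp_apply_conj, inner_smul_left, hsymm]
  simp

/-- The distributional action tested on Schwartz functions: the maximal operator is contained in the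
adjoint of the conjugate quantization on the Schwartz core. -/
theorem weyl_pairing (q : Form n) {u v : L2 n} (huv : (u, v) ∈ (weyl q h).graph)
    (e : schwartzL2 n) : inner ℂ (e : L2 n) v =
      inner ℂ ((quad (weylOp h) ((formMatrix q).map star) e : schwartzL2 n) : L2 n) u := by
  obtain ⟨f, rfl⟩ := (schwartzEquiv n).surjective e
  rw [mem_graph_weyl_iff] at huv
  rw [← weylDistribution_apply_conj, huv, lp_apply_conj]
  rfl

theorem mem_weyl_graph (q : Form n) (w : schwartzL2 n) :
    ((w : L2 n), ((quad (weylOp h) (formMatrix q) w : schwartzL2 n) : L2 n)) ∈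
      (weyl q h).graph := by
  rw [mem_graph_weyl_iff]
  ext φ
  obtain ⟨f, rfl⟩ : ∃ f, conjSchwartz f = φ := ⟨_, conjSchwartz_conjSchwartz φ⟩
  rw [weylDistribution_apply_conj, lp_apply_conj]
  have := isCCR_weylOp.inner_quad (transpose_map_star (formMatrix_transpose q))
    (schwartzEquiv n f) w (h := h)
  rw [map_star_map_star] at this
  exact this

end SchwartzOperators

/-! ### Exponentials of functions with quadratically decaying real part are Schwartz -/

section Gaussian

theorem linear_sub_mul_sq_le {m : ℝ} (hm : 0 < m) (a t : ℝ) :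
    a * t - m * t ^ 2 ≤ a ^ 2 / (4 * m) := by
  rw [le_div_iff₀ (by positivity)]
  nlinarith [sq_nonneg (2 * m * t - a)]

theorem exists_pow_mul_exp_neg_sq_le {m : ℝ} (hm : 0 < m) (p : ℕ) :
    ∃ C, ∀ t : ℝ, 0 ≤ t → (1 + t) ^ p * Real.exp (-m * t ^ 2) ≤ C := by
  refine ⟨p.factorial * Real.exp (1 + 1 ^ 2 / (4 * m)), fun t ht => ?_⟩
  have h1 : (1 + t) ^ p ≤ p.factorial * Real.exp (1 + t) := by
    have := Real.pow_div_factorial_le_exp (1 + t) (by positivity) p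
    rwa [div_le_iff₀ (by positivity), mul_comm] at this
  calc (1 + t) ^ p * Real.exp (-m * t ^ 2)
      ≤ p.factorial * Real.exp (1 + t) * Real.exp (-m * t ^ 2) := by gcongr
    _ = p.factorial * Real.exp (1 + (1 * t - m * t ^ 2)) := by
        rw [mul_assoc, ← Real.exp_add]
        ring_nf
    _ ≤ _ := by
        gcongr
        exact linear_sub_mul_sq_le hm 1 t

theorem iteratedFDeriv_cexp (i : ℕ) (z : ℂ) :
    iteratedFDeriv ℝ i Complex.exp z = Complex.exp z • iteratedFDeriv ℝ i Complex.exp 0 := by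
  have h1 : (fun w => Complex.exp (z + w)) = Complex.exp z • Complex.exp := by
    ext w
    simp [Complex.exp_add]
  have h2 := iteratedFDeriv_comp_add_left (𝕜 := ℝ) (f := Complex.exp) i z 0
  rw [h1, add_zero, iteratedFDeriv_const_smul_apply] at h2
  · exact h2.symm
  · exact Complex.contDiff_exp.contDiffAt

variable {E : Type*} [NormedAddCommGroup E] [NormedSpace ℝ E]

/-- By the chain rule bound each derivative is at most a polynomial times exp(−m‖x‖²), since all
derivatives of exp at z are exp z times fixed multilinear maps. -/
theorem exists_schwartzMap_exp {f : E → ℂ} (hf : f.HasTemperateGrowth) {m : ℝ} (hm : 0 < m)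
    (hre : ∀ x, (f x).re ≤ -m * ‖x‖ ^ 2) : ∃ g : 𝓢(E, ℂ), ∀ x, g x = Complex.exp (f x) := by
  refine ⟨⟨Complex.exp ∘ f, Complex.contDiff_exp.comp hf.1, fun k i => ?_⟩, fun x => rfl⟩
  obtain ⟨l, C, hC, hgrowth⟩ := hf.norm_iteratedFDeriv_le_uniform i
  obtain ⟨B, hB⟩ := exists_pow_mul_exp_neg_sq_le hm (k + l * i)
  set S := ∑ j ∈ Finset.range (i + 1), ‖iteratedFDeriv ℝ j Complex.exp 0‖ with hS
  have hS0 : 0 ≤ S := by positivity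
  refine ⟨i.factorial * S * (C + 1) ^ i * B, fun x => ?_⟩
  have h1 := norm_iteratedFDeriv_comp_le (𝕜 := ℝ) (n := i) (g := Complex.exp) (f := f) (N := ((⊤ : ℕ∞) : WithTop ℕ∞))
    Complex.contDiff_exp hf.1 (mod_cast le_top) x (C := Real.exp (-m * ‖x‖ ^ 2) * S)
    -- C + 1 instead of C makes the base at least 1, as needed to pass from D to its j-th power for
    -- j ≥ 1.
    (D := (C + 1) * (1 + ‖x‖) ^ l)
    (fun j hj => by
      rw [iteratedFDeriv_cexp, norm_smul, Complex.norm_exp]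
      gcongr
      · exact hre x
      · exact Finset.single_le_sum (f := fun j => ‖iteratedFDeriv ℝ j Complex.exp 0‖)
          (fun _ _ => norm_nonneg _) (Finset.mem_range.mpr (Nat.lt_succ_of_le hj)))
    (fun j hj1 hj => by
      have h2 : 1 ≤ (C + 1) * (1 + ‖x‖) ^ l :=
        one_le_mul_of_one_le_of_one_le (by linarith) (one_le_pow₀ (by linarith [norm_nonneg x]))
      calc _ ≤ C * (1 + ‖x‖) ^ l := hgrowth j hj x
        _ ≤ (C + 1) * (1 + ‖x‖) ^ l := by gcongr; linarith
        _ ≤ _ := le_self_pow₀ h2 (by omega))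
  calc ‖x‖ ^ k * ‖iteratedFDeriv ℝ i (Complex.exp ∘ f) x‖
      ≤ (1 + ‖x‖) ^ k * (i.factorial * (Real.exp (-m * ‖x‖ ^ 2) * S) *
          ((C + 1) * (1 + ‖x‖) ^ l) ^ i) := by
        gcongr
        linarith
    _ = i.factorial * S * (C + 1) ^ i * ((1 + ‖x‖) ^ (k + l * i) * Real.exp (-m * ‖x‖ ^ 2)) := by
        rw [mul_pow, pow_add, pow_mul]
        ring
    _ ≤ _ := by
        gcongr
        exact hB _ (norm_nonneg x)

end Gaussian

/-! ### The Gaussian as vacuum vector -/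

section GaussianVacuum

variable {n : ℕ} {h : ℝ} {Γ : Matrix (Fin n) (Fin n) ℂ}

/-- The phase of the Gaussian with covariance `Γ`. -/
def gaussPhase (h : ℝ) (Γ : Matrix (Fin n) (Fin n) ℂ) (x : Conf n) : ℂ :=
  I / (2 * h) * ∑ j, ∑ k, Γ j k * (x j * x k)

theorem hasTemperateGrowth_gaussPhase : (gaussPhase h Γ).HasTemperateGrowth := by
  have h1 : ∀ j k, (fun x : Conf n => Γ j k * ((x j : ℂ) * x k)).HasTemperateGrowth := fun j k =>
    (Function.HasTemperateGrowth.const _).mul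
      ((hasTemperateGrowth_coord j).mul (hasTemperateGrowth_coord k))
  exact (Function.HasTemperateGrowth.const _).mul
    (Function.HasTemperateGrowth.sum fun j _ => Function.HasTemperateGrowth.sum fun k _ => h1 j k)

theorem gaussPhase_re (x : Conf n) :
    (gaussPhase h Γ x).re = -(1 / (2 * h)) * (x.ofLp ⬝ᵥ (Γ.map im *ᵥ x.ofLp)) := by
  have h1 : ∑ j, ∑ k, Γ j k * ((x j : ℂ) * x k) = ∑ j, ∑ k, Γ j k * ((x j * x k : ℝ) : ℂ) := by
    push_cast
    rfl
  have h2 : (I / (2 * h) : ℂ) = ((1 / (2 * h) : ℝ) : ℂ) * I := by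
    push_cast
    ring
  rw [gaussPhase, h1, h2, mul_assoc, re_ofReal_mul, I_mul_re, neg_mul, mul_neg, im_sum]
  congr 2
  simp only [dotProduct, mulVec, Finset.mul_sum, im_sum, im_mul_ofReal, Matrix.map_apply]
  refine Finset.sum_congr rfl fun j _ => Finset.sum_congr rfl fun k _ => ?_
  ring

theorem exists_pos_mul_norm_sq_le {M : Matrix (Fin n) (Fin n) ℝ} (hM : M.PosDef) :
    ∃ m > 0, ∀ x : Conf n, m * ‖x‖ ^ 2 ≤ x.ofLp ⬝ᵥ (M *ᵥ x.ofLp) := by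
  set q : Conf n → ℝ := fun x => x.ofLp ⬝ᵥ (M *ᵥ x.ofLp) with hq
  have hcont : Continuous q := by
    simp only [hq, dotProduct, mulVec]
    fun_prop
  have hpos : ∀ x : Conf n, x ≠ 0 → 0 < q x := fun x hx => by
    have := hM.dotProduct_mulVec_pos (x := x.ofLp) (by simpa using hx)
    simpa using this
  rcases (Metric.sphere (0 : Conf n) 1).eq_empty_or_nonempty with h0 | h0
  · refine ⟨1, one_pos, fun x => ?_⟩
    have hx : x = 0 := by
      by_contra hx
      have : (‖x‖⁻¹ • x) ∈ Metric.sphere (0 : Conf n) 1 := by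
        simp [norm_smul, hx]
      rw [h0] at this
      exact this
    simp [hx]
  · obtain ⟨x₀, hx₀, hmin⟩ := (isCompact_sphere (0 : Conf n) 1).exists_isMinOn h0 hcont.continuousOn
    refine ⟨q x₀, hpos x₀ (by rintro rfl; simp at hx₀), fun x => ?_⟩
    rcases eq_or_ne x 0 with rfl | hx
    · simp
    · have h1 : (‖x‖⁻¹ • x) ∈ Metric.sphere (0 : Conf n) 1 := by
        simp [norm_smul, hx]
      have h2 := hmin h1
      have h3 : q (‖x‖⁻¹ • x) = (‖x‖ ^ 2)⁻¹ * q x := by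
        simp only [hq, WithLp.ofLp_smul, mulVec_smul, dotProduct_smul, smul_dotProduct, smul_eq_mul]
        ring
      have h4 : 0 < ‖x‖ ^ 2 := by positivity
      change q x₀ ≤ q (‖x‖⁻¹ • x) at h2
      rw [h3, ← div_eq_inv_mul, le_div_iff₀ h4] at h2
      exact h2

theorem gaussPhase_re_le (hh : 0 < h) (hΓ : (Γ.map im).PosDef) :
    ∃ m > 0, ∀ x, (gaussPhase h Γ x).re ≤ -m * ‖x‖ ^ 2 := by
  obtain ⟨m, hm, hle⟩ := exists_pos_mul_norm_sq_le hΓ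
  refine ⟨1 / (2 * h) * m, by positivity, fun x => ?_⟩
  have := mul_le_mul_of_nonneg_left (hle x) (show (0 : ℝ) ≤ 1 / (2 * h) by positivity)
  rw [gaussPhase_re]
  linarith

/-- `g` is the Gaussian with covariance `Γ`. -/
def IsGaussian (h : ℝ) (Γ : Matrix (Fin n) (Fin n) ℂ) (g : 𝓢(Conf n, ℂ)) : Prop :=
  ∀ x, g x = Complex.exp (gaussPhase h Γ x)

theorem exists_isGaussian (hh : 0 < h) (hΓ : (Γ.map im).PosDef) : ∃ g, IsGaussian h Γ g := by
  obtain ⟨m, hm, hle⟩ := gaussPhase_re_le hh hΓ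
  exact exists_schwartzMap_exp hasTemperateGrowth_gaussPhase hm hle

theorem fderiv_gaussPhase (hΓ : Γᵀ = Γ) (x : Conf n) (i : Fin n) :
    HasFDerivAt (gaussPhase h Γ) (fderiv ℝ (gaussPhase h Γ) x) x ∧
      fderiv ℝ (gaussPhase h Γ) x (unitVec i) = I / h * ∑ k, Γ i k * x k := by
  have h1 := fun j k => ((hasFDerivAt_coord j x).mul (hasFDerivAt_coord k x)).const_mul (Γ j k)
  have h2 := (HasFDerivAt.fun_sum (u := Finset.univ) fun j _ =>
    HasFDerivAt.fun_sum (u := Finset.univ) fun k _ => h1 j k).const_mul (I / (2 * h) : ℂ)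
  have h3 : HasFDerivAt (gaussPhase h Γ) _ x := h2
  refine ⟨h3.differentiableAt.hasFDerivAt, ?_⟩
  have hs : ∀ j k, Γ j k = Γ k j := fun j k => congrFun (congrFun hΓ k) j
  have h4 : ∑ j, Γ j i * (x j : ℂ) = ∑ k, Γ i k * x k :=
    Finset.sum_congr rfl fun j _ => by rw [hs]
  have hu : ∀ k, ((unitVec i k : ℝ) : ℂ) = if k = i then 1 else 0 := fun k => by
    rw [unitVec_apply]
    split_ifs <;> simp
  have h5 : fderiv ℝ (gaussPhase h Γ) x (unitVec i) = I / (2 * h) *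
      ∑ j, ∑ k, Γ j k * (x j * (unitVec i k : ℝ) + x k * (unitVec i j : ℝ)) := by
    rw [h3.fderiv]
    simp only [_root_.smul_apply, _root_.sum_apply, _root_.add_apply, smul_eq_mul]
    rfl
  have h6 : ∑ j, ∑ k, Γ j k * ((x j : ℂ) * (unitVec i k : ℝ) + x k * (unitVec i j : ℝ)) =
      2 * ∑ k, Γ i k * x k := by
    simp only [hu, mul_add, Finset.sum_add_distrib, mul_ite, mul_one, mul_zero,
      Finset.sum_ite_eq', Finset.mem_univ, if_true]
    rw [h4, Finset.sum_comm]
    simp only [Finset.sum_ite_eq', Finset.mem_univ, if_true]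
    ring
  rw [h5, h6]
  ring

/-- Differentiating the phase gives hD g = (Γx) g; the symmetry of `Γ` merges the two halves of the
derivative of the quadratic form. -/
theorem IsGaussian.momentum {g : 𝓢(Conf n, ℂ)} (hg : IsGaussian h Γ g) (hh : h ≠ 0)
    (hΓ : Γᵀ = Γ) (j : Fin n) :
    schwartzOp h (Sum.inr j) g = ∑ k, Γ j k • schwartzOp h (Sum.inl k) g := by
  ext x
  obtain ⟨h1, h2⟩ := fderiv_gaussPhase (h := h) hΓ x j
  have h3 : HasFDerivAt g
      (Complex.exp (gaussPhase h Γ x) • fderiv ℝ (gaussPhase h Γ) x) x := by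
    rw [show (g : Conf n → ℂ) = fun x => Complex.exp (gaussPhase h Γ x) from funext hg]
    exact h1.cexp
  have h4 : (h : ℂ) ≠ 0 := mod_cast hh
  rw [schwartzOp_inr_apply, h3.fderiv, _root_.smul_apply, h2, _root_.sum_apply]
  simp only [_root_.smul_apply, schwartzOp_inl_apply, smul_eq_mul]
  rw [hg x]
  have h5 : ∑ k, Γ j k * (x k * Complex.exp (gaussPhase h Γ x)) =
      Complex.exp (gaussPhase h Γ x) * ∑ k, Γ j k * x k := by
    rw [Finset.mul_sum]
    exact Finset.sum_congr rfl fun k _ => by ring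
  rw [h5]
  field_simp

theorem IsGaussian.isVacuum {g : 𝓢(Conf n, ℂ)} (hg : IsGaussian h Γ g) (hh : h ≠ 0)
    (hΓ : Γᵀ = Γ) : IsVacuum (weylOp h) Γ (schwartzEquiv n g) := by
  intro x
  have hs : ∀ j k, Γ j k = Γ k j := fun j k => congrFun (congrFun hΓ k) j
  have h1 : ∀ j, weylOp h (Sum.inr j) (schwartzEquiv n g) =
      ∑ k, Γ j k • weylOp h (Sum.inl k) (schwartzEquiv n g) := by
    intro j
    simp only [weylOp_apply]
    rw [hg.momentum hh hΓ, map_sum]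
    simp only [map_smul]
  rw [lin_apply, Fintype.sum_sum_type]
  simp only [annVec, Sum.elim_inl, Sum.elim_inr, h1, Pi.neg_apply, neg_smul,
    Finset.sum_neg_distrib, mulVec, dotProduct, Finset.sum_smul, Finset.smul_sum, smul_smul]
  rw [neg_add_eq_zero, Finset.sum_comm]
  refine Finset.sum_congr rfl fun j _ => Finset.sum_congr rfl fun k _ => ?_
  rw [hs, mul_comm]

theorem IsGaussian.ne_zero {g : 𝓢(Conf n, ℂ)} (hg : IsGaussian h Γ g) : g ≠ 0 := by
  rintro rfl
  exact Complex.exp_ne_zero _ (hg 0).symm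

/-- Both Gaussians are 1 at the origin, so proportionality means equality; the momentum relation
evaluated at coordinate vectors then recovers the matrix. -/
theorem IsGaussian.mem_span_iff {Γ' : Matrix (Fin n) (Fin n) ℂ} {g g' : 𝓢(Conf n, ℂ)}
    (hg : IsGaussian h Γ g) (hg' : IsGaussian h Γ' g') (hh : h ≠ 0) (hΓ : Γᵀ = Γ)
    (hΓ' : Γ'ᵀ = Γ') : g' ∈ Submodule.span ℂ {g} ↔ Γ = Γ' := by
  constructor
  · intro hmem
    obtain ⟨c, hc⟩ := Submodule.mem_span_singleton.mp hmem
    have h0 : ∀ Γ : Matrix (Fin n) (Fin n) ℂ, gaussPhase h Γ 0 = 0 := fun Γ => by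
      simp [gaussPhase]
    have h1 : c = 1 := by
      have := congrArg (fun f : 𝓢(Conf n, ℂ) => f 0) hc
      simpa [hg 0, hg' 0, h0] using this
    rw [h1, one_smul] at hc
    subst hc
    ext j k
    have h2 := (hg.momentum hh hΓ j).symm.trans (hg'.momentum hh hΓ' j)
    have h3 := congrArg (fun f : 𝓢(Conf n, ℂ) => f (unitVec k)) h2
    have h4 : ∀ M : Matrix (Fin n) (Fin n) ℂ,
        (∑ l, M j l • schwartzOp h (Sum.inl l) g) (unitVec k) = M j k * g (unitVec k) := by
      intro M
      rw [_root_.sum_apply]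
      simp [schwartzOp_inl_apply, unitVec_apply, apply_ite]
    simp only [h4] at h3
    exact mul_right_cancel₀ (by rw [hg]; exact Complex.exp_ne_zero _) h3
  · rintro rfl
    have : g' = g := by
      ext x
      rw [hg, hg']
    rw [this]
    exact Submodule.mem_span_singleton_self g

end GaussianVacuum

/-! ### Density of polynomials times a Gaussian in L² -/

section Density

open MeasureTheory

section FourierUniqueness

variable {E : Type*} [NormedAddCommGroup E] [InnerProductSpace ℝ E] [FiniteDimensional ℝ E]
  [MeasurableSpace E] [BorelSpace E]

open FourierTransform in
-- Move the Fourier transform from `φ` onto a Schwartz function; as every Schwartz function is a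
-- transform, `φ` vanishes as a distribution.
theorem ae_eq_zero_of_fourier_eq_zero {φ : E → ℂ} (hφ : Integrable φ) (h0 : ∀ ξ, 𝓕 φ ξ = 0) :
    φ =ᵐ[volume] 0 := by
  have h1 : ∀ ψ : 𝓢(E, ℂ), ∫ x, ψ x • φ x = 0 := by
    intro ψ
    have h2 := VectorFourier.integral_fourierIntegral_smul_eq_flip (μ := volume) (ν := volume)
      (L := innerₗ E) (f := (𝓕⁻ ψ : 𝓢(E, ℂ))) (g := φ) Real.continuous_fourierChar
      continuous_inner (𝓕⁻ ψ : 𝓢(E, ℂ)).integrable hφ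
    have h3 : ∀ ξ, VectorFourier.fourierIntegral Real.fourierChar volume (innerₗ E)
        (𝓕⁻ ψ : 𝓢(E, ℂ)) ξ = ψ ξ := by
      intro ξ
      change 𝓕 ((𝓕⁻ ψ : 𝓢(E, ℂ)) : E → ℂ) ξ = ψ ξ
      rw [← SchwartzMap.fourier_coe, FourierTransform.fourier_fourierInv_eq]
    have h4 : ∀ ξ, VectorFourier.fourierIntegral Real.fourierChar volume (innerₗ E).flip φ ξ =
        0 := by
      intro ξ
      rw [flip_innerₗ]
      exact h0 ξ
    simp only [h3, h4, smul_zero, integral_zero] at h2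
    exact h2
  have hmem : MemLp φ 1 := memLp_one_iff_integrable.mpr hφ
  have h2 : Lp.toTemperedDistributionCLM ℂ volume 1 (hmem.toLp φ) = 0 := by
    ext ψ
    refine (Lp.toTemperedDistribution_apply (hmem.toLp φ) ψ).trans (Eq.trans ?_ (h1 ψ))
    refine integral_congr_ae ?_
    filter_upwards [hmem.coeFn_toLp] with x hx
    rw [hx]
  have h3 : hmem.toLp φ ∈ (Lp.toTemperedDistributionCLM (E := E) ℂ volume 1).ker := h2
  rw [Lp.ker_toTemperedDistributionCLM_eq_bot] at h3
  have h4 : hmem.toLp φ = 0 := h3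
  refine hmem.coeFn_toLp.symm.trans ?_
  rw [h4]
  exact Lp.coeFn_zero ℂ 1 volume

theorem integral_cexp_mul_eq_zero {φ : E → ℂ} (hφ : AEStronglyMeasurable φ) (ξ : E)
    (hexp : Integrable fun x => Real.exp (‖ξ‖ * ‖x‖) * ‖φ x‖)
    (hmom : ∀ k : ℕ, ∫ x, ((inner ℝ x ξ : ℝ) : ℂ) ^ k * φ x = 0) (c : ℂ) (hc : ‖c‖ ≤ 1) :
    ∫ x, Complex.exp (c * (inner ℝ x ξ : ℝ)) * φ x = 0 := by
  have hcont : Continuous fun x : E => ((inner ℝ x ξ : ℝ) : ℂ) :=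
    continuous_ofReal.comp (continuous_id.inner continuous_const)
  have hsum : ∀ x : E, HasSum (fun k : ℕ => (‖ξ‖ * ‖x‖) ^ k / k.factorial * ‖φ x‖)
      (Real.exp (‖ξ‖ * ‖x‖) * ‖φ x‖) := by
    intro x
    have := NormedSpace.expSeries_div_hasSum_exp (‖ξ‖ * ‖x‖)
    rw [← Real.exp_eq_exp_ℝ] at this
    exact this.mul_right _
  have key := hasSum_integral_of_dominated_convergence (μ := volume)
    (F := fun (k : ℕ) x => (c * (inner ℝ x ξ : ℝ)) ^ k / k.factorial * φ x)
    (f := fun x => Complex.exp (c * (inner ℝ x ξ : ℝ)) * φ x)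
    (fun (k : ℕ) x => (‖ξ‖ * ‖x‖) ^ k / k.factorial * ‖φ x‖)
    (fun k => (((continuous_const.mul hcont).pow k).div_const _).aestronglyMeasurable.mul hφ)
    (fun k => Filter.Eventually.of_forall fun x => by
      rw [norm_mul, norm_div, norm_pow, norm_mul, Complex.norm_natCast, Complex.norm_real]
      have h1 : ‖c‖ * ‖(inner ℝ x ξ : ℝ)‖ ≤ ‖ξ‖ * ‖x‖ := by
        calc ‖c‖ * ‖(inner ℝ x ξ : ℝ)‖ ≤ 1 * (‖x‖ * ‖ξ‖) := by
              gcongr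
              exact norm_inner_le_norm x ξ
          _ = ‖ξ‖ * ‖x‖ := by ring
      have h2 := pow_le_pow_left₀ (by positivity) h1 k
      gcongr)
    (Filter.Eventually.of_forall fun x => (hsum x).summable)
    (by simpa only [(hsum _).tsum_eq] using hexp)
    (Filter.Eventually.of_forall fun x => by
      have := NormedSpace.expSeries_div_hasSum_exp (c * (inner ℝ x ξ : ℝ))
      rw [← Complex.exp_eq_exp_ℂ] at this
      exact this.mul_right _)
  have hz : ∀ k : ℕ, ∫ x, (c * (inner ℝ x ξ : ℝ)) ^ k / k.factorial * φ x = 0 := by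
    intro k
    have : ∀ x, (c * (inner ℝ x ξ : ℝ)) ^ k / k.factorial * φ x =
        c ^ k / k.factorial * (((inner ℝ x ξ : ℝ) : ℂ) ^ k * φ x) := fun x => by
      rw [mul_pow]
      ring
    simp only [this]
    rw [integral_const_mul, hmom, mul_zero]
  simp only [hz] at key
  exact key.unique hasSum_zero

open FourierTransform in
-- Exponential integrability allows the characters to be expanded in their power series under the
-- integral, so vanishing moments make the Fourier transform vanish.
theorem ae_eq_zero_of_moments_eq_zero {φ : E → ℂ} (hφ : AEStronglyMeasurable φ)
    (hexp : ∀ a : ℝ, Integrable fun x => Real.exp (a * ‖x‖) * ‖φ x‖)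
    (hmom : ∀ (ξ : E) (k : ℕ), ∫ x, ((inner ℝ x ξ : ℝ) : ℂ) ^ k * φ x = 0) :
    φ =ᵐ[volume] 0 := by
  have hint : Integrable φ := by
    have := hexp 0
    simp only [zero_mul, Real.exp_zero, one_mul] at this
    exact (integrable_norm_iff hφ).mp this
  refine ae_eq_zero_of_fourier_eq_zero hint fun ξ => ?_
  rw [Real.fourier_eq']
  have h1 := integral_cexp_mul_eq_zero hφ ((-2 * Real.pi) • ξ) (hexp _) (hmom _) I (by simp)
  refine Eq.trans (integral_congr_ae (Filter.Eventually.of_forall fun x => ?_)) h1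
  simp only [smul_eq_mul]
  rw [inner_smul_right, mul_comm I]

end FourierUniqueness

variable {n : ℕ} {h : ℝ} {Γ : Matrix (Fin n) (Fin n) ℂ}

/-- The product of the Schwartz function `g` with a power of the linear form `⟨x, ξ⟩`. -/
def linPowMul (h : ℝ) (ξ : Conf n) (g : 𝓢(Conf n, ℂ)) : ℕ → 𝓢(Conf n, ℂ)
  | 0 => g
  | k + 1 => ∑ j, (ξ j : ℂ) • schwartzOp h (Sum.inl j) (linPowMul h ξ g k)

theorem linPowMul_apply (ξ : Conf n) (g : 𝓢(Conf n, ℂ)) (k : ℕ) (x : Conf n) :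
    linPowMul h ξ g k x = ((inner ℝ x ξ : ℝ) : ℂ) ^ k * g x := by
  induction k with
  | zero => simp [linPowMul]
  | succ k ih =>
    rw [linPowMul, _root_.sum_apply]
    simp only [_root_.smul_apply, schwartzOp_inl_apply, ih, smul_eq_mul]
    have : ((inner ℝ x ξ : ℝ) : ℂ) = ∑ j, (ξ j : ℂ) * x j := by
      rw [PiLp.inner_apply]
      push_cast
      simp
    rw [pow_succ, mul_right_comm _ _ (g x)]
    nth_rewrite 3 [this]
    rw [Finset.mul_sum]
    exact Finset.sum_congr rfl fun j _ => by ring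

theorem linPowMul_mem (ξ : Conf n) (g : 𝓢(Conf n, ℂ)) (k : ℕ) :
    schwartzEquiv n (linPowMul h ξ g k) ∈ polySpan (weylOp h) (schwartzEquiv n g) k := by
  induction k with
  | zero => exact self_mem_polySpan 0
  | succ k ih =>
    rw [linPowMul, map_sum]
    refine Submodule.sum_mem _ fun j _ => ?_
    rw [map_smul, ← weylOp_apply]
    exact Submodule.smul_mem _ _ (apply_mem_polySpan _ ih)

theorem IsGaussian.integrable_exp_mul {g : 𝓢(Conf n, ℂ)} (hg : IsGaussian h Γ g) (hh : 0 < h)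
    (hΓ : (Γ.map im).PosDef) (f : L2 n) (a : ℝ) :
    Integrable fun x => Real.exp (a * ‖x‖) * ‖star (g x) * f x‖ := by
  obtain ⟨m, hm, hle⟩ := gaussPhase_re_le hh hΓ
  have htg : (fun x : Conf n => ((-(m / 2) * ‖x‖ ^ 2 : ℝ) : ℂ)).HasTemperateGrowth :=
    Function.Complex.hasTemperateGrowth_ofReal.comp
      ((Function.HasTemperateGrowth.const _).mul (Function.hasTemperateGrowth_norm_sq _))
  -- Half of the Gaussian decay absorbs exp(a‖x‖); the other half is the Schwartz function `G`,
  -- whose product with f ∈ L² is integrable.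
  obtain ⟨G, hG⟩ := exists_schwartzMap_exp htg (m := m / 2) (by positivity) (fun x => by
    rw [ofReal_re])
  have h1 : Integrable fun x => G x * f x :=
    MemLp.integrable_mul (p := 2) (q := 2) (G.memLp 2) (Lp.memLp f)
  have hmeas : AEStronglyMeasurable (fun x => Real.exp (a * ‖x‖) * ‖star (g x) * f x‖)
      (volume : Measure (Conf n)) := by
    have h2 : Continuous fun x => star (g x) := g.continuous.star
    have h3 : Continuous fun x : Conf n => Real.exp (a * ‖x‖) := by fun_prop
    exact h3.aestronglyMeasurable.mul
      (h2.aestronglyMeasurable.mul (Lp.aestronglyMeasurable f)).norm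
  refine (h1.const_mul (Real.exp (a ^ 2 / (4 * (m / 2))) : ℂ)).mono hmeas
    (Filter.Eventually.of_forall fun x => ?_)
  have h4 : Real.exp (a * ‖x‖) * ‖g x‖ ≤ Real.exp (a ^ 2 / (4 * (m / 2))) * ‖G x‖ := by
    rw [hg, hG, Complex.norm_exp, Complex.norm_exp, ofReal_re, ← Real.exp_add, ← Real.exp_add]
    refine Real.exp_le_exp.mpr ?_
    have := linear_sub_mul_sq_le (show 0 < m / 2 by positivity) a ‖x‖
    linarith [hle x]
  rw [Real.norm_of_nonneg (by positivity), norm_mul, norm_mul, norm_mul, norm_star,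
    Complex.norm_real, Real.norm_of_nonneg (Real.exp_pos _).le, ← mul_assoc, ← mul_assoc]
  gcongr

/-- Orthogonality says that all moments of ḡf vanish, so ḡf = 0, and a Gaussian has no zeros. -/
theorem IsGaussian.eq_zero_of_orthogonal {g : 𝓢(Conf n, ℂ)} (hg : IsGaussian h Γ g) (hh : 0 < h)
    (hΓ : (Γ.map im).PosDef) (f : L2 n)
    (hf : ∀ m, ∀ e ∈ polySpan (weylOp h) (schwartzEquiv n g) m, inner ℂ (e : L2 n) f = 0) :
    f = 0 := by
  have hmeas : AEStronglyMeasurable (fun x => star (g x) * f x) (volume : Measure (Conf n)) :=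
    (g.continuous.star.aestronglyMeasurable).mul (Lp.aestronglyMeasurable f)
  have h0 := ae_eq_zero_of_moments_eq_zero hmeas (hg.integrable_exp_mul hh hΓ f) (fun ξ k => by
    rw [← hf k _ (linPowMul_mem ξ g k), L2.inner_def]
    refine integral_congr_ae ?_
    filter_upwards [(linPowMul h ξ g k).coeFn_toLp 2 volume] with x hx
    rw [coe_schwartzEquiv, hx, linPowMul_apply, RCLike.inner_apply, map_mul, map_pow, conj_ofReal,
      starRingEnd_apply]
    ring)
  rw [Lp.eq_zero_iff_ae_eq_zero]
  filter_upwards [h0] with x hx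
  refine (mul_eq_zero.mp hx).resolve_left ?_
  rw [star_eq_zero, hg]
  exact Complex.exp_ne_zero _

end Density

/-! ### The matrix of the quadratic form and its ellipticity -/

section Form

variable {n : ℕ} (q : Form n)

/-- The standard basis of phase space. -/
def phaseBasis : Fin n ⊕ Fin n → PhaseSpace n := Sum.elim ePos eMom

theorem formMatrix_apply (a b : Fin n ⊕ Fin n) :
    formMatrix q a b = 1 / 2 * QuadraticMap.polar q (phaseBasis a) (phaseBasis b) := by
  rcases a with a | a <;> rcases b with b | b <;>
    simp [formMatrix, phaseBasis, dxx, dxXi, dXix, dXiXi]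

theorem sum_smul_phaseBasis (x : Fin n ⊕ Fin n → ℝ) :
    ∑ a, x a • phaseBasis a = (x ∘ Sum.inl, x ∘ Sum.inr) := by
  ext i <;>
    simp [phaseBasis, ePos, eMom, Prod.fst_sum, Prod.snd_sum, Finset.sum_apply, Pi.single_apply]

theorem apply_eq_sum_formMatrix (x : Fin n ⊕ Fin n → ℝ) :
    q (x ∘ Sum.inl, x ∘ Sum.inr) = ∑ a, ∑ b, (x a * x b : ℝ) * formMatrix q a b := by
  have h1 : q (∑ a, x a • phaseBasis a) = 1 / 2 * QuadraticMap.polarBilin q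
      (∑ a, x a • phaseBasis a) (∑ b, x b • phaseBasis b) := by
    rw [QuadraticMap.polarBilin_apply_apply, QuadraticMap.polar_self]
    simp
  rw [← sum_smul_phaseBasis, h1]
  simp only [map_sum, LinearMap.sum_apply, map_smul, LinearMap.smul_apply,
    QuadraticMap.polarBilin_apply_apply, Finset.mul_sum, formMatrix_apply, real_smul, ofReal_mul]
  rw [Finset.sum_comm]
  refine Finset.sum_congr rfl fun a _ => Finset.sum_congr rfl fun b _ => ?_
  ring

theorem symJ_mul_map_re (Q : Matrix (Fin n ⊕ Fin n) (Fin n ⊕ Fin n) ℂ) :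
    (symJ n ℂ * Q).map re = symJ n ℝ * Q.map re := by
  ext (i | i) j <;> simp [symJ, Matrix.mul_apply, Matrix.one_apply]

theorem symJ_mul_map_im (Q : Matrix (Fin n ⊕ Fin n) (Fin n ⊕ Fin n) ℂ) :
    (symJ n ℂ * Q).map im = symJ n ℝ * Q.map im := by
  ext (i | i) j <;> simp [symJ, Matrix.mul_apply, Matrix.one_apply]

variable {q}

theorem isPartiallyElliptic_formMatrix (hq : ∀ X, 0 ≤ (q X).re) (hS : singularSpace q = ⊥) :
    IsPartiallyElliptic (formMatrix q) where
  symm := formMatrix_transpose q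
  posSemidef := by
    refine .of_dotProduct_mulVec_nonneg ?_ fun x => ?_
    · change (formMatrix q)ᵀ.map re = _
      rw [formMatrix_transpose]
    · refine (hq (x ∘ Sum.inl, x ∘ Sum.inr)).trans_eq ?_
      rw [apply_eq_sum_formMatrix]
      simp only [re_sum, re_ofReal_mul, star_trivial, dotProduct, mulVec, Finset.mul_sum,
        Matrix.map_apply]
      refine Finset.sum_congr rfl fun a _ => Finset.sum_congr rfl fun b _ => ?_
      ring
  observable x hx := by
    have hmem : x ∈ singularSpace q := by
      rw [singularSpace, Submodule.mem_iInf]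
      intro k
      -- Re F (Im F)ᵏ is J times Re Q (J Im Q)ᵏ, because `J` is real.
      rw [LinearMap.mem_ker, toLin'_apply, ← symJ_mul_formMatrix, symJ_mul_map_re,
        symJ_mul_map_im, Matrix.mul_assoc, ← mulVec_mulVec, hx, mulVec_zero]
    rwa [hS, Submodule.mem_bot] at hmem

end Form

theorem symJ_mul_map_star {n : ℕ} (Q : Matrix (Fin n ⊕ Fin n) (Fin n ⊕ Fin n) ℂ) :
    (symJ n ℂ * Q).map star = symJ n ℂ * Q.map star := by
  have := Matrix.map_mul (f := starRingEnd ℂ) (L := symJ n ℂ) (M := Q)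
  refine this.trans ?_
  congr 1
  exact symJ_map_star n

/-! ### Ground states of the operator and its adjoint -/

section GroundState

variable {n : ℕ} {h : ℝ}

/-- `g` is the Gaussian ground state of the quantization of the form with matrix `Q`, whose
stable Lagrangian is the graph of `Γ`; the eigenvalues of `N` are the eigenvalues of the
Hamilton map in the upper half plane. -/
structure IsGroundState (h : ℝ) (Q : Matrix (Fin n ⊕ Fin n) (Fin n ⊕ Fin n) ℂ)
    (Γ N : Matrix (Fin n) (Fin n) ℂ) (g : 𝓢(Conf n, ℂ)) : Prop where
  elliptic : IsPartiallyElliptic Q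
  polarization : IsPolarization Q Γ N
  range_graph : (upperSpace (symJ n ℂ * Q) : Set (Fin n ⊕ Fin n → ℂ)) = Set.range (graphVec Γ)
  im_pos : ∀ (l : ℂ) x, x ≠ 0 → N *ᵥ x = l • x → 0 < l.im
  gaussian : IsGaussian h Γ g

theorem IsPartiallyElliptic.exists_isGroundState {Q : Matrix (Fin n ⊕ Fin n) (Fin n ⊕ Fin n) ℂ}
    (hQ : IsPartiallyElliptic Q) (hh : 0 < h) : ∃ Γ N g, IsGroundState h Q Γ N g := by
  obtain ⟨Γ, hΓ⟩ := hQ.exists_graph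
  have hpol := hQ.isPolarization hΓ
  obtain ⟨g, hg⟩ := exists_isGaussian hh hpol.posDef
  refine ⟨Γ, _, g, hQ, hpol, hΓ, fun l x hx hl => hQ.im_pos_of_mulVec_eq hpol (fun y => ?_) hx hl,
    hg⟩
  rw [← SetLike.mem_coe, hΓ]
  exact ⟨y, rfl⟩

namespace IsGroundState

variable {Q : Matrix (Fin n ⊕ Fin n) (Fin n ⊕ Fin n) ℂ} {Γ N : Matrix (Fin n) (Fin n) ℂ}
  {g : 𝓢(Conf n, ℂ)}

theorem isVacuum (G : IsGroundState h Q Γ N g) (hh : 0 < h) :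
    IsVacuum (weylOp h) Γ (schwartzEquiv n g) :=
  G.gaussian.isVacuum hh.ne' G.polarization.symm

theorem spectralGap (G : IsGroundState h Q Γ N g) (hh : 0 < h) {δ : ℝ} (hδ0 : 0 < δ)
    (hδ : ∀ (l : ℂ) x, x ≠ 0 → N *ᵥ x = l • x → δ ≤ l.im) :
    SpectralGap (quad (weylOp h) Q) (polySpan (weylOp h) (schwartzEquiv n g)) (schwartzEquiv n g)
      (h / I * N.trace) (2 * h * δ) where
  mono := polySpan_mono
  finite m := inferInstance
  apply_mem hw := quad_mem_polySpan isCCR_weylOp G.elliptic.symm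
    (G.polarization.quad_vacuum isCCR_weylOp (G.isVacuum hh)) hw
  mem m := self_mem_polySpan m
  ne_zero := (map_ne_zero_iff _ (schwartzEquiv n).injective).mpr G.gaussian.ne_zero
  eigen := G.polarization.quad_vacuum isCCR_weylOp (G.isVacuum hh)
  pos := by positivity
  gap {m w} hw ζ hζ := by
    refine G.polarization.mem_span_or_gap_le hh hδ hδ0 isCCR_weylOp (G.isVacuum hh)
      (mem_polySpanTop.mpr ⟨m, hw⟩) ζ fun x => ?_
    obtain ⟨c, hc⟩ := Submodule.mem_span_singleton.mp hζ
    rw [← hc, map_smul, G.isVacuum hh x, smul_zero]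
  dense f hf := G.gaussian.eq_zero_of_orthogonal hh G.polarization.posDef f hf

end IsGroundState

theorem mem_span_coe_schwartzEquiv_iff (f g : 𝓢(Conf n, ℂ)) :
    (schwartzEquiv n f : L2 n) ∈ Submodule.span ℂ {(schwartzEquiv n g : L2 n)} ↔
      f ∈ Submodule.span ℂ {g} := by
  simp only [Submodule.mem_span_singleton]
  refine exists_congr fun c => ?_
  rw [← Submodule.coe_smul, SetLike.coe_eq_coe, ← map_smul, (schwartzEquiv n).injective.eq_iff]

/-- The operator and its formal adjoint are treated alike, with the smaller of the two spectral
distances as a common gap; solvability for the adjoint on its own core supplies the hypothesis of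
`exists_lower_bound`. -/
theorem groundStatePair_weyl {q : Form n} (hh : 0 < h) {Γ N Γ' N' : Matrix (Fin n) (Fin n) ℂ}
    {g g' : 𝓢(Conf n, ℂ)} (G : IsGroundState h (formMatrix q) Γ N g)
    (G' : IsGroundState h ((formMatrix q).map star) Γ' N' g') :
    ∃ γ, GroundStatePair (weyl q h) (quad (weylOp h) (formMatrix q))
      (quad (weylOp h) ((formMatrix q).map star)) (polySpan (weylOp h) (schwartzEquiv n g))
      (polySpan (weylOp h) (schwartzEquiv n g')) (schwartzEquiv n g) (schwartzEquiv n g')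
      (mu0 q h) γ := by
  obtain ⟨δ₁, hδ₁, hle₁⟩ := exists_pos_le_im G.im_pos
  obtain ⟨δ₂, hδ₂, hle₂⟩ := exists_pos_le_im G'.im_pos
  have hδ := lt_min hδ₁ hδ₂
  have hμ : mu0 q h = h / I * N.trace := by
    rw [mu0, ← symJ_mul_formMatrix, G.polarization.sum_roots_pos G.im_pos]
  have htr : N'.trace = -star N.trace := by
    -- Eigenvalues of the conjugate matrix in the upper half plane are conjugates of those of `F` in
    -- the lower one, whose sum is −tr N. This makes the adjoint ground energy the conjugate of μ₀.
    rw [← G'.polarization.sum_roots_pos G'.im_pos, ← symJ_mul_map_star, sum_roots_map_star,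
      G.polarization.sum_roots_neg G.im_pos, star_neg]
  have hμ' : star (mu0 q h) = h / I * N'.trace := by
    rw [hμ, htr, Complex.div_I, Complex.star_def, map_mul]
    simp
  have L := G.spectralGap hh hδ fun l x hx hl => (min_le_left _ _).trans (hle₁ l x hx hl)
  have R := G'.spectralGap hh hδ fun l x hx hl => (min_le_right _ _).trans (hle₂ l x hx hl)
  rw [← hμ] at L
  rw [← hμ'] at R
  refine ⟨2 * h * min δ₁ δ₂, L, R, isClosed_weyl q h, dense_domain_weyl q h, mem_weyl_graph q,
    weyl_pairing q, fun ζ hζ hre => ?_⟩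
  obtain ⟨c, hc, hbound⟩ := exists_lower_bound (ζ := ζ)
    (D := polySpanTop (weylOp h) (schwartzEquiv n g')) hh isCCR_weylOp G.elliptic G.polarization (G.isVacuum hh)
    (fun f hf => R.dense f fun m e he => hf e (mem_polySpanTop.mpr ⟨m, he⟩))
    (fun e he => by
      obtain ⟨m, hm⟩ := mem_polySpanTop.mp he
      obtain ⟨e', he', h1⟩ := R.exists_apply_sub_eq (ζ := star ζ)
        (fun h0 => hζ (star_injective h0)) (by simpa using hre) hm
      exact ⟨e', mem_polySpanTop.mpr ⟨m, he'⟩, h1⟩)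
  exact ⟨c, hc, fun m w hw => hbound w (mem_polySpanTop.mpr ⟨m, hw⟩)⟩

theorem lambdaPlus_eq_star_image_iff {q : Form n} {Γ N Γ' N' : Matrix (Fin n) (Fin n) ℂ}
    {g g' : 𝓢(Conf n, ℂ)} (G : IsGroundState h (formMatrix q) Γ N g)
    (G' : IsGroundState h ((formMatrix q).map star) Γ' N' g') :
    (lambdaPlus q : Set (Fin n ⊕ Fin n → ℂ)) = star '' (lambdaMinus q : Set (Fin n ⊕ Fin n → ℂ)) ↔
      Γ = Γ' := by
  have h1 : (lambdaPlus q : Set (Fin n ⊕ Fin n → ℂ)) = Set.range (graphVec Γ) := by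
    rw [← G.range_graph, symJ_mul_formMatrix]
    rfl
  have h2 : star '' (lambdaMinus q : Set (Fin n ⊕ Fin n → ℂ)) = Set.range (graphVec Γ') := by
    rw [← G'.range_graph, ← symJ_mul_map_star, symJ_mul_formMatrix,
      ← star_image_lowerSpace]
    rfl
  rw [h1, h2]
  exact ⟨eq_of_range_graphVec_eq, fun e => by rw [e]⟩

end GroundState

end QuadraticWeyl

end

theorem theorem1p4 (n : ℕ) (h : ℝ) (hh : 0 < h) (q : QuadraticWeyl.Form n)
    (hq : ∀ X : QuadraticWeyl.PhaseSpace n, 0 ≤ (q X).re)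
    (hS : QuadraticWeyl.singularSpace q = ⊥) :
    (∃ r : ℝ, QuadraticWeyl.IsIsolatingRadius
      (QuadraticWeyl.weyl q h) (QuadraticWeyl.mu0 q h) r) ∧
    ∀ r : ℝ, QuadraticWeyl.IsIsolatingRadius
        (QuadraticWeyl.weyl q h) (QuadraticWeyl.mu0 q h) r →
      List.TFAE [
        QuadraticWeyl.eigenspace (QuadraticWeyl.weyl q h) (QuadraticWeyl.mu0 q h) =
          QuadraticWeyl.eigenspace (QuadraticWeyl.weyl q h).adjoint
            (star (QuadraticWeyl.mu0 q h)),
        (QuadraticWeyl.lambdaPlus q : Set (Fin n ⊕ Fin n → ℂ)) =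
          star '' (QuadraticWeyl.lambdaMinus q : Set (Fin n ⊕ Fin n → ℂ)),
        IsStarProjection (QuadraticWeyl.rieszProjection
          (QuadraticWeyl.weyl q h) (QuadraticWeyl.mu0 q h) r)] := by
  have hQ := QuadraticWeyl.isPartiallyElliptic_formMatrix hq hS
  obtain ⟨Γ, N, g, G⟩ := hQ.exists_isGroundState hh
  obtain ⟨Γ', N', g', G'⟩ := hQ.map_star.exists_isGroundState hh
  obtain ⟨γ, P⟩ := QuadraticWeyl.groundStatePair_weyl hh G G'
  refine ⟨P.exists_isIsolatingRadius, fun r hr => ?_⟩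
  -- All three conditions reduce to Γ = Γ'.
  have hspan := (QuadraticWeyl.mem_span_coe_schwartzEquiv_iff g' g).trans
    (G.gaussian.mem_span_iff G'.gaussian hh.ne' G.polarization.symm G'.polarization.symm)
  have hi := (P.eigenspace_eq_iff hr).trans hspan
  have hii := QuadraticWeyl.lambdaPlus_eq_star_image_iff G G'
  have hiii := (P.isStarProjection_iff hr).trans hspan
  tfae_have 1 ↔ 2 := hi.trans hii.symm
  tfae_have 2 ↔ 3 := hii.trans hiii.symm
  tfae_finish
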